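/- Let $d\ge 1$, $n\ge 1$, let $\mathcal H_A=\mathbb C^d$ with a fixed orthonormal basis, and let $Y_n^d$ be the set of Young diagrams $\mathbf n=(n_1\ge\dots\ge n_d\ge 0)$ with $\sum_i n_i=n$. By Schur–Weyl duality $\mathcal H_A^{\otimes n}=\bigoplus_{\mathbf n\in Y_n^d}\mathcal U_{\mathbf n}\otimes\mathcal V_{\mathbf n}$, where $\mathcal U_{\mathbf n}$, $\mathcal V_{\mathbf n}$ are the irreducible representations of $\mathrm U(d)$ and of $S_n$ labelled by $\mathbf n$; let $P_{\mathbf n}$ be the orthogonal projection onto $\mathcal U_{\mathbf n}\otimes\mathcal V_{\mathbf n}$. Let $s_{\mathbf n}(\mathbf t)=\det(t_i^{n_j+d-j})_{i,j}/\det(t_i^{d-j})_{i,j}$ be the Schur polynomial (a polynomial in $\mathbf t\in\mathbb R^d$, hence defined for all $\mathbf t$), and put $$f_q(n,d;\mathbf n)=\frac{\dim\mathcal U_{\mathbf n}}{s_{\mathbf n}(\mathbf n/n)\,\dim\mathcal V_{\mathbf n}},\qquad f_q(n,d)=\frac{(n+d-1)^{(d^2-1)/2}}{\sqrt{2\pi(d/e^2)^d}\,\prod_{i=0}^{d-1}i!},$$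 $$\tau_{\mathbf n}=\mathbb E_{U\sim\mathrm{Haar}(d)}\bigl[(U\,\mathrm{diag}(\mathbf n/n)\,U^\dagger)^{\otimes n}\bigr].$$ (a) There exist completely positive trace-preserving maps $\mathcal S,\mathcal R$ on the operators on $\mathcal H_A^{\otimes n}$ such that, for every complex Hilbert space $\mathcal H_E$: (i) for every density operator $\rho_{A^nE}$ on $\mathcal H_A^{\otimes n}\otimes\mathcal H_E$ and every $\mathbf n\in Y_n^d$, $(\mathcal S\otimes\mathrm{Id}_E)(P_{\mathbf n}\rho_{A^nE}P_{\mathbf n})=P_{\mathbf n}\,(\mathcal S\otimes\mathrm{Id}_E)(\rho_{A^nE})\,P_{\mathbf n}$ (where $P_{\mathbf n}$ acts trivially on $\mathcal H_E$); (ii) for every density operator $\rho_{A^nE}$ that is invariant under permutations of the $n$ systems of $A^n$, $((\mathcal R\circ\mathcal S)\otimes\mathrm{Id}_E)(\rho_{A^nE})=\rho_{A^nE}$; (iii) for every permutation-invariant density operator $\rho_{A^n}$ on $\mathcal H_A^{\otimes n}$ and every $\mathbf n\in Y_n^d$, $\mathrm{supp}\bigl(\mathcal S(P_{\mathbf n}\rho_{A^n}P_{\mathbf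 n})\bigr)\le f_q(n,d;\mathbf n)\,\mathcal S(\tau_{\mathbf n})$, where $\mathrm{supp}(\tau)$ is the least projection $Q$ with $\mathrm{Tr}[Q\tau]=\mathrm{Tr}[\tau]$. (b) Consequently, for every permutation-invariant density operator $\rho_{A^n}$, the numbers $\mathrm{Tr}[P_{\mathbf n}\rho_{A^n}]$ ($\mathbf n\in Y_n^d$) form a probability distribution and $$\rho_{A^n}\le\sum_{\mathbf n\in Y_n^d}f_q(n,d;\mathbf n)\,\mathrm{Tr}[P_{\mathbf n}\rho_{A^n}]\,\tau_{\mathbf n},\qquad \rho_{A^n}\le f_q(n,d)\sum_{\mathbf n\in Y_n^d}\mathrm{Tr}[P_{\mathbf n}\rho_{A^n}]\,\tau_{\mathbf n};$$ moreover $f_q(n,d;\mathbf n)\le f_q(n,d)$ for all $\mathbf n\in Y_n^d$, and, for fixed $d$, $f_q(n,d)=O\bigl(n^{(d^2-1)/2}\bigr)$ as $n\to\infty$. -/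

import Mathlib

open scoped MatrixOrder ComplexOrder

noncomputable section

namespace QDF

/-! ### The tensor power `(ℂ^d)^{⊗n}` and operators on it -/

/-- Labels of the product basis of `(ℂ^d)^{⊗n}`, where `ℂ^d` is the `d`-dimensional Hilbert space
`H_A` with its fixed orthonormal basis. -/
abbrev Idx (n d : ℕ) : Type := Fin n → Fin d

/-- Operators on `(ℂ^d)^{⊗n}`, as matrices in the product basis. -/
abbrev Op (n d : ℕ) : Type := Matrix (Idx n d) (Idx n d) ℂ

/-- The Hilbert space `(ℂ^d)^{⊗n}`, in coordinates with respect to the product basis. -/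
abbrev TensorSpace (n d : ℕ) : Type := EuclideanSpace ℂ (Idx n d)

/-- `σ^{⊗n}`. -/
def tensorPower (n : ℕ) {d : ℕ} (σ : Matrix (Fin d) (Fin d) ℂ) : Op n d :=
  Matrix.of fun a b => ∏ i, σ (a i) (b i)

/-- A density operator: positive semidefinite with trace one. -/
def IsDensity {ι : Type*} [Fintype ι] (ρ : Matrix ι ι ℂ) : Prop :=
  ρ.PosSemidef ∧ ρ.trace = 1

/-! ### Operators on `(ℂ^d)^{⊗n} ⊗ H_E`

`H_E` is an arbitrary complex Hilbert space.  As the first factor is finite dimensional, bounded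
operators on the tensor product are the matrices with entries in `B(H_E)`. -/

/-- Bounded operators on `(ℂ^d)^{⊗n} ⊗ H_E`. -/
abbrev OpE (n d : ℕ) (E : Type*) [NormedAddCommGroup E] [InnerProductSpace ℂ E] : Type _ :=
  Matrix (Idx n d) (Idx n d) (E →L[ℂ] E)

section SideSystem

variable {n d : ℕ} {E : Type*} [NormedAddCommGroup E] [InnerProductSpace ℂ E]

/-- A density operator on `(ℂ^d)^{⊗n} ⊗ H_E`: a positive operator whose trace, computed in a
product orthonormal basis, converges to one. -/
def IsDensityE (ρ : OpE n d E) : Prop :=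
  (∀ x : Idx n d → E, 0 ≤ ∑ a, ∑ b, inner ℂ (x a) (ρ a b (x b))) ∧
  ∃ (κ : Set E) (b : HilbertBasis κ ℂ E), HasSum (fun k => ∑ a, inner ℂ (b k) (ρ a a (b k))) 1

/-- `X ⊗ I_E`. -/
def extendE (E : Type*) [NormedAddCommGroup E] [InnerProductSpace ℂ E] (X : Op n d) :
    OpE n d E :=
  X.map (algebraMap ℂ (E →L[ℂ] E))

/-- `(Φ ⊗ Id_E)(ρ)`: since `ρ = ∑ a b, |a⟩⟨b| ⊗ ρ a b`, it is
`∑ a b, Φ(|a⟩⟨b|) ⊗ ρ a b`. -/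
def ampliate (Φ : Op n d →ₗ[ℂ] Op n d) (ρ : OpE n d E) : OpE n d E :=
  Matrix.of fun i j => ∑ a, ∑ b, Φ (Matrix.single a b 1) i j • ρ a b

end SideSystem

/-- Invariance under permutations of the `n` tensor factors, i.e. under conjugation with the
unitary `(W_π x) a = x (a ∘ π)` for every `π`; `R = ℂ` for operators on `A^n` and `R = B(H_E)` for
operators on `A^n E`. -/
def IsPermInvariant {n d : ℕ} {R : Type*} (ρ : Matrix (Idx n d) (Idx n d) R) : Prop :=
  ∀ π : Equiv.Perm (Fin n), (ρ.submatrix (fun a => a ∘ π) (fun a => a ∘ π)) = ρ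

section CPTP

open scoped Matrix.Norms.L2Operator

/-- Completely positive trace-preserving maps. -/
def IsCPTP {ι : Type*} [Fintype ι] [DecidableEq ι] (Φ : Matrix ι ι ℂ →ₗ[ℂ] Matrix ι ι ℂ) : Prop :=
  (∃ Ψ : CompletelyPositiveMap (Matrix ι ι ℂ) (Matrix ι ι ℂ), Ψ.toLinearMap = Φ) ∧
  ∀ X, (Φ X).trace = X.trace

end CPTP

/-- `Q` is the support projection of the positive operator `τ`: the least orthogonal projection
with `Tr[Q τ] = Tr[τ]`. -/
def IsSupportProjection {ι : Type*} [Fintype ι] [DecidableEq ι] (τ Q : Matrix ι ι ℂ) : Prop :=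
  IsLeast {Q' : Matrix ι ι ℂ | IsStarProjection Q' ∧ (Q' * τ).trace = τ.trace} Q

/-! ### The Haar average over the unitary group -/

instance unitaryGroup_compactSpace (d : ℕ) : CompactSpace (Matrix.unitaryGroup (Fin d) ℂ) := by
  refine isCompact_iff_compactSpace.mp ?_
  have hc : IsClosed {U : Matrix (Fin d) (Fin d) ℂ | U ∈ Matrix.unitaryGroup (Fin d) ℂ} := by
    simp only [Matrix.mem_unitaryGroup_iff]
    exact isClosed_eq (by fun_prop) continuous_const
  have hb : IsCompact (Set.univ.pi fun _ : Fin d => Set.univ.pi fun _ : Fin d =>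
      Metric.closedBall (0 : ℂ) 1) :=
    isCompact_univ_pi fun _ => isCompact_univ_pi fun _ => isCompact_closedBall 0 1
  refine IsCompact.of_isClosed_subset hb hc ?_
  intro U hU i _ j _
  simpa using entry_norm_bound_of_unitary hU i j

instance unitaryGroup_measurableSpace (d : ℕ) :
    MeasurableSpace (Matrix.unitaryGroup (Fin d) ℂ) := borel _

instance unitaryGroup_borelSpace (d : ℕ) : BorelSpace (Matrix.unitaryGroup (Fin d) ℂ) := ⟨rfl⟩

/-- The Haar probability measure on `U(d)`. -/
def haarU (d : ℕ) : MeasureTheory.Measure (Matrix.unitaryGroup (Fin d) ℂ) :=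
  MeasureTheory.Measure.haarMeasure ⊤

/-- `𝔼_{U ∼ Haar(d)} [(U diag(t) U†)^{⊗n}]`, the expectation being taken entrywise. -/
def haarIID (n : ℕ) {d : ℕ} (t : Fin d → ℝ) : Op n d :=
  Matrix.of fun a b => ∫ U : Matrix.unitaryGroup (Fin d) ℂ,
    tensorPower n ((U : Matrix (Fin d) (Fin d) ℂ) * Matrix.diagonal (fun i => (t i : ℂ)) *
      (U : Matrix (Fin d) (Fin d) ℂ).conjTranspose) a b ∂(haarU d)

/-! ### Young diagrams and the Schur–Weyl decomposition -/

/-- `Y_n^d`: Young diagrams with `n` boxes and at most `d` rows; `m.1 i` is the length of the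
`i`-th row. -/
abbrev YoungDiag (n d : ℕ) : Type := {m : Fin d → ℕ // Antitone m ∧ ∑ i, m i = n}

instance youngDiag_fintype (n d : ℕ) : Fintype (YoungDiag n d) := by
  classical
  exact Fintype.subtype ((Finset.piAntidiag Finset.univ n).filter Antitone) (by
    intro m
    simp [and_comm])

variable {n d : ℕ}

/-- The tableau of shape `m` in which the numbers `0, …, n - 1` are filled in row by row: it sends
a number to its box (row, column). -/
def box (m : YoungDiag n d) : Fin n ≃ (Σ i : Fin d, Fin (m.1 i)) :=
  (finSigmaFinEquiv.trans (finCongr m.2.2)).symm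

/-- The row in which `k` stands. -/
def rowOf (m : YoungDiag n d) (k : Fin n) : ℕ := (box m k).1

/-- The column in which `k` stands. -/
def colOf (m : YoungDiag n d) (k : Fin n) : ℕ := (box m k).2

/-- The group algebra `ℂ[S_n]`. -/
abbrev GroupAlg (n : ℕ) : Type := MonoidAlgebra ℂ (Equiv.Perm (Fin n))

open Classical in
/-- The Young symmetrizer: the sum over the row group times the signed sum over the column group. -/
def youngSymmetrizer (m : YoungDiag n d) : GroupAlg n :=
  (∑ p : Equiv.Perm (Fin n) with ∀ k, rowOf m (p k) = rowOf m k, MonoidAlgebra.of ℂ _ p) *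
  (∑ q : Equiv.Perm (Fin n) with ∀ k, colOf m (q k) = colOf m k,
    ((Equiv.Perm.sign q : ℤ) : ℂ) • MonoidAlgebra.of ℂ _ q)

/-- `V_m`, the irreducible representation (Specht module) of `S_n` labelled by `m`: the left ideal
of `ℂ[S_n]` generated by the Young symmetrizer. -/
abbrev Specht (m : YoungDiag n d) : Submodule (GroupAlg n) (GroupAlg n) :=
  Submodule.span (GroupAlg n) {youngSymmetrizer m}

/-- The action of `S_n` on `(ℂ^d)^{⊗n}` by permutation of the tensor factors. -/
def permRep (n d : ℕ) : Representation ℂ (Equiv.Perm (Fin n)) (TensorSpace n d) where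
  toFun π :=
    { toFun := fun x => WithLp.toLp 2 fun a => x (a ∘ π)
      map_add' := fun _ _ => rfl
      map_smul' := fun _ _ => rfl }
  map_one' := rfl
  map_mul' _ _ := rfl

/-- `U_m`, the irreducible representation (Weyl module) of `U(d)` labelled by `m`: the image of the
Young symmetrizer in `(ℂ^d)^{⊗n}`. -/
def weylModule (m : YoungDiag n d) : Submodule ℂ (TensorSpace n d) :=
  LinearMap.range ((permRep n d).asAlgebraHom (youngSymmetrizer m))

/-- `dim U_m`. -/
def dimU (m : YoungDiag n d) : ℕ := Module.finrank ℂ (weylModule m)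

/-- `dim V_m`. -/
def dimV (m : YoungDiag n d) : ℕ := Module.finrank ℂ (Specht m)

/-- The summand `U_m ⊗ V_m` of `(ℂ^d)^{⊗n}`: the isotypic component of `V_m`. -/
def isotypicSubspace (m : YoungDiag n d) : Submodule ℂ (TensorSpace n d) :=
  Submodule.map (permRep n d).asModuleEquiv.toLinearMap
    (Submodule.restrictScalars ℂ
      (isotypicComponent (GroupAlg n) (permRep n d).asModule (Specht m)))

/-- `P_m`, the orthogonal projection onto `U_m ⊗ V_m`. -/
def isoProj (m : YoungDiag n d) : Op n d :=
  (Matrix.toEuclideanCLM (𝕜 := ℂ) (n := Idx n d)).symm (isotypicSubspace m).starProjection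

/-- `Tr[P_m ρ]`. -/
def isoWeight (m : YoungDiag n d) (ρ : Op n d) : ℝ := ((isoProj m * ρ).trace).re

/-! ### Schur functions and the prefactors -/

/-- The alternant `det (x_i ^ e_j)` as a polynomial. -/
def alternant {d : ℕ} (e : Fin d → ℕ) : MvPolynomial (Fin d) ℝ :=
  (Matrix.of fun i j => (MvPolynomial.X i : MvPolynomial (Fin d) ℝ) ^ e j).det

open Polynomial in
/-- Reduction of `X ^ e_j` modulo `∏ (X - x_i)` exhibits the Vandermonde matrix as a left factor. -/
theorem det_pow_dvd {d : ℕ} {R : Type*} [CommRing R] (x : Fin d → R) (e : Fin d → ℕ) :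
    (Matrix.of fun i j : Fin d => x i ^ (d - 1 - (j : ℕ))).det ∣ (Matrix.of fun i j => x i ^ e j).det := by
  rcases subsingleton_or_nontrivial R with h | h
  · exact ⟨1, Subsingleton.elim _ _⟩
  set q : R[X] := ∏ i, (X - C (x i)) with hq
  have hm : q.Monic := monic_prod_of_monic _ _ fun i _ => monic_X_sub_C _
  have hdeg : q.natDegree = d := by simp [hq]
  set r : Fin d → R[X] := fun j => (X ^ e j) %ₘ q with hr
  have key : (Matrix.of fun i j => x i ^ e j) =
      (Matrix.of fun i j : Fin d => x i ^ (d - 1 - (j : ℕ))) *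
        Matrix.of fun k j : Fin d => (r j).coeff (d - 1 - (k : ℕ)) := by
    ext i j
    have hroot : q.eval (x i) = 0 := by
      rw [hq, eval_prod]
      exact Finset.prod_eq_zero (Finset.mem_univ i) (by simp)
    have h1 : (r j).eval (x i) = x i ^ e j := by
      have := congrArg (eval (x i)) (modByMonic_add_div (X ^ e j) q)
      simpa [hroot] using this
    have hd0 : 0 < d := i.pos
    have h2 : (r j).natDegree < d := by
      rw [← hdeg]
      exact natDegree_modByMonic_lt _ hm (by intro h1; rw [h1] at hdeg; simp at hdeg; omega)
    rw [Matrix.of_apply, ← h1, eval_eq_sum_range' h2, Matrix.mul_apply,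
      ← Finset.sum_range_reflect, Finset.sum_range]
    exact Finset.sum_congr rfl fun k _ => by simp [mul_comm]
  rw [key, Matrix.det_mul]
  exact dvd_mul_right _ _

/-- The Vandermonde determinant divides every alternant. -/
theorem alternant_dvd {d : ℕ} (e : Fin d → ℕ) :
    alternant (fun j : Fin d => d - 1 - (j : ℕ)) ∣ alternant e :=
  det_pow_dvd _ e

/-- The Schur polynomial of shape `m`: the polynomial quotient
`det (x_i ^ (m_j + d - j)) / det (x_i ^ (d - j))`, `1 ≤ i, j ≤ d` (below, `j` counts from zero). -/
def schurPoly {d : ℕ} (m : Fin d → ℕ) : MvPolynomial (Fin d) ℝ :=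
  Classical.choose (alternant_dvd fun j => m j + (d - 1 - (j : ℕ)))

/-- The Schur function `s_m(t)`; evaluating the polynomial covers points `t` with coinciding
coordinates, where the quotient of the values of the determinants is `0 / 0`. -/
def schur {d : ℕ} (m : Fin d → ℕ) (t : Fin d → ℝ) : ℝ := MvPolynomial.eval t (schurPoly m)

theorem schurPoly_spec {d : ℕ} (m : Fin d → ℕ) :
    alternant (fun j => m j + (d - 1 - (j : ℕ))) =
      alternant (fun j : Fin d => d - 1 - (j : ℕ)) * schurPoly m :=
  Classical.choose_spec (alternant_dvd fun j => m j + (d - 1 - (j : ℕ)))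

/-- At points with distinct coordinates, `s_m(t)` is the quotient of the two determinants. -/
theorem schur_eq_div {d : ℕ} (m : Fin d → ℕ) (t : Fin d → ℝ) (ht : Function.Injective t) :
    schur m t = (Matrix.of fun i j : Fin d => t i ^ (m j + (d - 1 - (j : ℕ)))).det /
      (Matrix.of fun i j : Fin d => t i ^ (d - 1 - (j : ℕ))).det := by
  have h : (Matrix.of fun i j : Fin d => t i ^ (d - 1 - (j : ℕ))).det ≠ 0 := by
    have h1 : (Matrix.of fun i j : Fin d => t i ^ (d - 1 - (j : ℕ))) =
        (Matrix.vandermonde t).submatrix id Fin.revPerm := by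
      ext i j
      simp [Matrix.vandermonde_apply, Fin.val_rev, Nat.sub_sub, add_comm]
    rw [h1, Matrix.det_permute']
    refine mul_ne_zero ?_ (Matrix.det_vandermonde_ne_zero_iff.mpr ht)
    rcases Int.units_eq_one_or (Equiv.Perm.sign (Fin.revPerm : Equiv.Perm (Fin d))) with h2 | h2 <;>
      simp [h2]
  have hev (e : Fin d → ℕ) : MvPolynomial.eval t (alternant e) =
      (Matrix.of fun i j : Fin d => t i ^ e j).det := by
    rw [alternant, RingHom.map_det]
    congr 1
    ext i j
    simp
  have := congrArg (MvPolynomial.eval t) (schurPoly_spec m)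
  rw [map_mul, hev, hev] at this
  rw [eq_div_iff h, this, mul_comm, schur]

/-- The point `m / n`. -/
def empirical (m : YoungDiag n d) : Fin d → ℝ := fun i => (m.1 i : ℝ) / n

/-- `f_q(n, d; m) = dim U_m / (s_m(m / n) dim V_m)`. -/
def fqDiag (m : YoungDiag n d) : ℝ := dimU m / (schur m.1 (empirical m) * dimV m)

/-- The Barnes G-function at an integer `k ≥ 2`. -/
def barnesG (k : ℕ) : ℕ := ∏ i ∈ Finset.range (k - 1), i.factorial

/-- `f_q(n, d)`. -/
def fq (n d : ℕ) : ℝ :=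
  ((n : ℝ) + d - 1) ^ (((d : ℝ) ^ 2 - 1) / 2) /
    (√(2 * Real.pi * ((d : ℝ) / Real.exp 2) ^ d) * barnesG (d + 1))

end QDF

end

/-! Channels. For every diagram `m` the normalized product row sum · column sum · row sum is a
self-adjoint primitive idempotent of `ℂ[S_n]`. It acts on the tensor space as an orthogonal
projection `weylProj m` onto a single copy of `U_m` inside `U_m ⊗ V_m`. The channel `S` averages
over permutations and then compresses each sector with `weylProj m`, weighted by `dimV m`; `R` is
the average over permutations. The Kraus operators of both come from the group algebra, so they
commute with every `isoProj m` and, whatever the side system, with every permutation-invariant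
state. This gives (i) by `ampliate_krausMap_conj`, and (ii) by `ampliate_krausMap_of_unital`,
because `R ∘ S` is unital (`twirl_schur_one`).

Operator inequalities. The Haar average commutes with all `V^{⊗n}`, hence with all
permutation-invariant operators (`comm_of_isPermInvariant`), and so is a scalar on the range of
`weylProj m` (`trace_smul_weylProj_mul`). A trace computation identifies the scalar as `s_m(m/n) /
dimU m`, whose inverse is exactly `fqDiag m * dimV m`. The compressed state has its support below
`weylProj m`, which yields (iii). For (b), a positive operator on the range of `weylProj m` is at
most its trace times the identity there; averaging over permutations turns this into a bound on the
whole sector, and the sectors add up to the identity (`sum_isoProj`).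

Characters. That traces against `weylProj m` are Schur polynomials is Frobenius' formula. The Specht
character and the coefficient of the dominant monomial of shape `m` in Vandermonde times power sums
both have squared norm `n!`, by idempotence and by Cauchy's identity respectively. Their inner
product is also `n!`, by a dominance argument on column-injective words; hence they are equal. The
dimension formulas of Weyl and Frobenius follow, and together with `prod_pow_le_schur` (a Schur
polynomial dominates its leading monomial) and Stirling's bounds they give `fqDiag m ≤ fq n d`. -/

noncomputable section
namespace QDF

/-! ### Primitive idempotents of a group algebra and their central idempotents -/

section GroupAlgebra

variable {G : Type*} [Group G] [Fintype G]

open MonoidAlgebra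

lemma coeff_mul_eq_sum (x y : MonoidAlgebra ℂ G) (g : G) :
    (x * y).coeff g = ∑ h, x.coeff h * y.coeff (h⁻¹ * g) := by
  rw [coeff_mul_apply_left, Finsupp.sum_fintype _ _ (by simp)]

lemma eq_sum_smul_single (x : MonoidAlgebra ℂ G) : x = ∑ g, x.coeff g • single g (1 : ℂ) := by
  classical
  ext g
  simp [coeff_sum]

lemma coeff_mul_one_comm (x y : MonoidAlgebra ℂ G) : (x * y).coeff 1 = (y * x).coeff 1 := by
  rw [coeff_mul_eq_sum, coeff_mul_eq_sum, ← Equiv.sum_comp (Equiv.inv G)]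
  exact Finset.sum_congr rfl fun g _ => by simp [mul_comm]

/-- The basis of the group algebra given by the group elements. -/
def groupBasis (G : Type*) [Group G] : Module.Basis G ℂ (MonoidAlgebra ℂ G) :=
  .ofRepr { toFun := coeff, invFun := ofCoeff, left_inv := fun _ => rfl, right_inv := fun _ => rfl,
            map_add' := fun _ _ => rfl, map_smul' := fun _ _ => rfl }

instance : Module.Finite ℂ (MonoidAlgebra ℂ G) := .of_basis (groupBasis G)

omit [Fintype G] in
lemma groupBasis_apply (g : G) : groupBasis G g = single g 1 := rfl

lemma trace_mulLeft (x : MonoidAlgebra ℂ G) :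
    LinearMap.trace ℂ _ (LinearMap.mulLeft ℂ x) = Fintype.card G * x.coeff 1 := by
  classical
  rw [LinearMap.trace_eq_matrix_trace ℂ (groupBasis G), Matrix.trace]
  have h (g : G) : (LinearMap.toMatrix (groupBasis G) (groupBasis G) (LinearMap.mulLeft ℂ x)).diag g
      = x.coeff 1 := by
    rw [Matrix.diag_apply, LinearMap.toMatrix_apply, groupBasis_apply]
    change (x * single g 1).coeff g = _
    simp
  rw [Finset.sum_congr rfl fun g _ => h g]
  simp

lemma trace_mulRight (x : MonoidAlgebra ℂ G) :
    LinearMap.trace ℂ _ (LinearMap.mulRight ℂ x) = Fintype.card G * x.coeff 1 := by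
  classical
  rw [LinearMap.trace_eq_matrix_trace ℂ (groupBasis G), Matrix.trace]
  have h (g : G) : (LinearMap.toMatrix (groupBasis G) (groupBasis G) (LinearMap.mulRight ℂ x)).diag g
      = x.coeff 1 := by
    rw [Matrix.diag_apply, LinearMap.toMatrix_apply, groupBasis_apply]
    change (single g 1 * x).coeff g = _
    simp
  rw [Finset.sum_congr rfl fun g _ => h g]
  simp

/-- The trace of an idempotent map is its rank, and left multiplication by `x` has trace `|G|` times
the coefficient at `1`. -/
lemma eq_zero_of_idempotent_of_coeff_one {x : MonoidAlgebra ℂ G} (hx : x * x = x)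
    (h1 : x.coeff 1 = 0) : x = 0 := by
  have hi : IsIdempotentElem (LinearMap.mulLeft ℂ x) := by
    refine LinearMap.ext fun y => ?_
    simp [← mul_assoc, hx]
  have h := (LinearMap.IsIdempotentElem.trace_eq_zero_iff hi).mp (by rw [trace_mulLeft, h1, mul_zero])
  simpa using LinearMap.congr_fun h 1

lemma coeff_one_eq_zero_of_nilpotent {x : MonoidAlgebra ℂ G} (hx : x * x = 0) : x.coeff 1 = 0 := by
  have hn : IsNilpotent (LinearMap.mulLeft ℂ x) := ⟨2, LinearMap.ext fun y => by simp [pow_two, ← mul_assoc, hx]⟩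
  have h := LinearMap.isNilpotent_trace_of_isNilpotent hn
  rw [isNilpotent_iff_eq_zero, trace_mulLeft] at h
  simpa [Fintype.card_ne_zero] using h

/-- The sum of all conjugates of an element of the group algebra. -/
def conjSum (x : MonoidAlgebra ℂ G) : MonoidAlgebra ℂ G :=
  ∑ h : G, single h 1 * x * single h⁻¹ 1

lemma coeff_conjSum (x : MonoidAlgebra ℂ G) (g : G) :
    (conjSum x).coeff g = ∑ h, x.coeff (h⁻¹ * g * h) := by
  simp [conjSum, coeff_sum, mul_assoc]

lemma conjSum_smul (a : ℂ) (x : MonoidAlgebra ℂ G) : conjSum (a • x) = a • conjSum x := by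
  simp [conjSum, Finset.smul_sum]

lemma conjSum_comm (x : MonoidAlgebra ℂ G) (y : MonoidAlgebra ℂ G) :
    conjSum x * y = y * conjSum x := by
  have key (g : G) : conjSum x * single g 1 = single g 1 * conjSum x := by
    rw [conjSum, Finset.sum_mul, Finset.mul_sum, ← Equiv.sum_comp (Equiv.mulLeft g)]
    refine Finset.sum_congr rfl fun h _ => ?_
    simp [← mul_assoc, single_mul_single]
    simp [mul_assoc, single_mul_single]
  rw [eq_sum_smul_single y, Finset.sum_mul, Finset.mul_sum]
  exact Finset.sum_congr rfl fun g _ => by rw [mul_smul_comm, key, smul_mul_assoc]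

/-- Each coefficient of `conjSum (x * y)` is the trace form, coefficient at `1`, of `x * y` times a
central class sum; the trace form is symmetric and the class sum can be moved past either factor. -/
lemma conjSum_mul_comm (x y : MonoidAlgebra ℂ G) : conjSum (x * y) = conjSum (y * x) := by
  ext g
  simp only [coeff_conjSum]
  have h (u v : MonoidAlgebra ℂ G) (k : G) : (u * v).coeff k = (single k⁻¹ 1 * u * v).coeff 1 := by
    rw [mul_assoc]; simp
  have h2 (u : MonoidAlgebra ℂ G) : ∑ k : G, (u * (single (k⁻¹ * g⁻¹ * k) 1)).coeff 1
      = (u * conjSum (single g⁻¹ 1)).coeff 1 := by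
    rw [← Finset.sum_apply', ← coeff_sum, ← Finset.mul_sum, conjSum,
      ← Equiv.sum_comp (Equiv.inv G)]
    simp [single_mul_single]
  have h3 (u v : MonoidAlgebra ℂ G) : ∑ k : G, (u * v).coeff (k⁻¹ * g * k) =
      (u * v * conjSum (single g⁻¹ 1)).coeff 1 := by
    rw [← h2]
    refine Finset.sum_congr rfl fun k _ => ?_
    rw [coeff_mul_single_apply, mul_one]
    congr 1
    group
  rw [h3, h3, mul_assoc, mul_assoc, coeff_mul_one_comm, mul_assoc, conjSum_comm]

/-- A primitive idempotent of the group algebra: a nonzero idempotent `e` with `e A e = ℂ e`. -/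
structure IsPrimitive (e : MonoidAlgebra ℂ G) : Prop where
  idem : e * e = e
  ne_zero : e ≠ 0
  corner : ∀ x, ∃ a : ℂ, e * x * e = a • e

/-- The central idempotent generated by a primitive idempotent. -/
def centralIdem (e : MonoidAlgebra ℂ G) : MonoidAlgebra ℂ G := e.coeff 1 • conjSum e

namespace IsPrimitive

variable {e : MonoidAlgebra ℂ G} (he : IsPrimitive e)

include he

lemma coeff_one_ne_zero : e.coeff 1 ≠ 0 := fun h =>
  he.ne_zero (eq_zero_of_idempotent_of_coeff_one he.idem h)

/-- The scalar by which `e * x * e` multiplies `e` is found by applying the symmetric trace form,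
coefficient at `1`, to both sides. -/
lemma corner_eq (x : MonoidAlgebra ℂ G) :
    e * x * e = ((x * e).coeff 1 / e.coeff 1) • e := by
  obtain ⟨a, ha⟩ := he.corner x
  have h : (x * e).coeff 1 = a * e.coeff 1 := by
    rw [← smul_eq_mul (a := a), ← coeff_smul_apply, ← ha, coeff_mul_one_comm (e * x) e, ← mul_assoc,
      he.idem, coeff_mul_one_comm]
  rw [ha, h, mul_div_cancel_right₀ _ he.coeff_one_ne_zero]

/-- In the sum of the `h e h⁻¹ e` the corner `e h⁻¹ e` collapses to a multiple of `e` given by the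
coefficient of `e` at `h`, so the sum reassembles a multiple of `e * e`. -/
lemma centralIdem_mul : centralIdem e * e = e := by
  have h1 : conjSum e * e = ∑ h : G, (e.coeff h / e.coeff 1) • (single h 1 * e) := by
    rw [conjSum, Finset.sum_mul]
    refine Finset.sum_congr rfl fun h _ => ?_
    rw [mul_assoc, mul_assoc, ← mul_assoc e, he.corner_eq, mul_smul_comm]
    simp
  have h2 : conjSum e * e = (e.coeff 1)⁻¹ • e := by
    have h3 : ∑ h : G, (e.coeff h / e.coeff 1) • (single h 1 * e)
        = (e.coeff 1)⁻¹ • ((∑ h : G, e.coeff h • single h 1) * e) := by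
      rw [Finset.sum_mul, Finset.smul_sum]
      exact Finset.sum_congr rfl fun h _ => by rw [smul_mul_assoc, smul_smul, div_eq_inv_mul]
    rw [h1, h3, ← eq_sum_smul_single, he.idem]
  rw [centralIdem, smul_mul_assoc, h2, smul_smul, mul_inv_cancel₀ he.coeff_one_ne_zero, one_smul]

omit he in
lemma centralIdem_comm (e y : MonoidAlgebra ℂ G) : centralIdem e * y = y * centralIdem e := by
  rw [centralIdem, smul_mul_assoc, conjSum_comm, mul_smul_comm]

/-- A central element that fixes `e` fixes all conjugates of `e`, and the central idempotent is a
combination of these. -/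
lemma centralIdem_idem : centralIdem e * centralIdem e = centralIdem e := by
  nth_rewrite 2 [centralIdem]
  rw [mul_smul_comm, conjSum, Finset.mul_sum, centralIdem, conjSum]
  congr 1
  refine Finset.sum_congr rfl fun h _ => ?_
  have := he.centralIdem_mul
  rw [centralIdem, conjSum] at this
  rw [← mul_assoc, ← mul_assoc, ← conjSum, ← centralIdem, centralIdem_comm, mul_assoc (single h 1),
    centralIdem, conjSum, this]

omit he in
lemma coeff_one_centralIdem :
    (centralIdem e).coeff 1 = Fintype.card G * e.coeff 1 ^ 2 := by
  rw [centralIdem, coeff_smul_apply, coeff_conjSum]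
  simp
  ring

/-- The character has squared norm `|G|`: it is a multiple of an idempotent, and the coefficients at
`1` are compared on both sides of `z * z = z`. -/
lemma sum_character_mul_inv :
    ∑ g, (conjSum e).coeff g * (conjSum e).coeff g⁻¹ = Fintype.card G := by
  have h1 : (conjSum e * conjSum e).coeff 1 = Fintype.card G := by
    have h2 : conjSum e = (e.coeff 1)⁻¹ • centralIdem e := by
      rw [centralIdem, smul_smul, inv_mul_cancel₀ he.coeff_one_ne_zero, one_smul]
    rw [h2, smul_mul_assoc, mul_smul_comm, he.centralIdem_idem, coeff_smul_apply, coeff_smul_apply,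
      coeff_one_centralIdem]
    have := he.coeff_one_ne_zero
    simp only [smul_eq_mul]
    field_simp
  rw [← h1, coeff_mul_eq_sum]
  simp

lemma finrank_span :
    (Module.finrank ℂ (Submodule.span (MonoidAlgebra ℂ G) {e}) : ℂ) = Fintype.card G * e.coeff 1 := by
  have hi : IsIdempotentElem (LinearMap.mulRight ℂ e) := by
    refine LinearMap.ext fun y => ?_
    simp [mul_assoc, he.idem]
  rw [← trace_mulRight, (LinearMap.IsIdempotentElem.isProj_range _ hi).trace]
  congr 1
  let f : Submodule.span (MonoidAlgebra ℂ G) {e} ≃ₗ[ℂ] (LinearMap.mulRight ℂ e).range :=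
    LinearEquiv.ofEq ((Submodule.span (MonoidAlgebra ℂ G) {e}).restrictScalars ℂ) _ (by
      ext x
      simp [Submodule.mem_span_singleton])
  exact f.finrank_eq

/-- A nonzero submodule contains some `y * e ≠ 0`. The central idempotent fixes it and expands it
into terms containing `e h⁻¹ y e`, multiples of `e` lying in the submodule. If `e` itself were not
there, all these multiples, and with them `y * e`, would vanish. -/
lemma isSimpleModule_span : IsSimpleModule (MonoidAlgebra ℂ G) (Submodule.span (MonoidAlgebra ℂ G) {e}) := by
  rw [isSimpleModule_iff_isAtom]
  refine ⟨by simpa using he.ne_zero, fun N hN => ?_⟩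
  by_contra hne
  refine hN.not_ge ?_
  rw [Submodule.span_singleton_le_iff_mem]
  obtain ⟨x, hxN, hx0⟩ := (Submodule.ne_bot_iff N).mp hne
  obtain ⟨y, rfl⟩ := Submodule.mem_span_singleton.mp (hN.le hxN)
  have hz : centralIdem e * (y * e) = y * e := by
    rw [← mul_assoc, centralIdem_comm, mul_assoc, he.centralIdem_mul]
  by_contra he'
  refine hx0 ?_
  rw [smul_eq_mul, ← hz, centralIdem, conjSum, smul_mul_assoc, Finset.sum_mul]
  refine smul_eq_zero_of_right _ (Finset.sum_eq_zero fun h _ => ?_)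
  have h1 : e * (single h⁻¹ 1 * (y * e)) ∈ N := N.smul_mem _ (N.smul_mem _ hxN)
  rw [← mul_assoc (single h⁻¹ 1), ← mul_assoc e, he.corner_eq] at h1
  have h2 : ((single h⁻¹ 1 * y * e).coeff 1 / e.coeff 1) = 0 := by
    by_contra h3
    refine he' ?_
    have := N.smul_mem (single 1 ((single h⁻¹ 1 * y * e).coeff 1 / e.coeff 1)⁻¹) h1
    rw [smul_eq_mul, mul_smul_comm, ← smul_mul_assoc, smul_single, smul_eq_mul, mul_inv_cancel₀ h3,
      ← one_def, one_mul] at this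
    exact this
  rw [mul_assoc, mul_assoc, ← mul_assoc (single h⁻¹ 1), ← mul_assoc e, he.corner_eq, h2]
  simp

/-- The vectors fixed by the central idempotent form a submodule containing every copy of `A e`.
Conversely a fixed vector is a combination of translates of vectors `e • w`, and each `e • w` lies
in the image of `A e` under `a ↦ a • w`, which is zero or a copy of `A e` by simplicity. -/
lemma mem_isotypicComponent_iff {M : Type*} [AddCommGroup M] [Module (MonoidAlgebra ℂ G) M] (v : M) :
    v ∈ isotypicComponent (MonoidAlgebra ℂ G) M (Submodule.span (MonoidAlgebra ℂ G) {e}) ↔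
      centralIdem e • v = v := by
  constructor
  · intro hv
    rw [isotypicComponent, Submodule.mem_sSup] at hv
    let N : Submodule (MonoidAlgebra ℂ G) M :=
      { carrier := {w | centralIdem e • w = w}
        add_mem' := fun {a b} ha hb => by
          change _ • (a + b) = a + b
          rw [smul_add, show _ • a = a from ha, show _ • b = b from hb]
        zero_mem' := smul_zero _
        smul_mem' := fun x a ha => by
          change _ • (x • a) = x • a
          rw [smul_smul, centralIdem_comm, mul_smul, show _ • a = a from ha] }
    refine hv N fun S ⟨f⟩ w hw => ?_
    change _ • w = w
    have h1 : centralIdem e • f ⟨w, hw⟩ = f ⟨w, hw⟩ := by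
      obtain ⟨y, hy⟩ := Submodule.mem_span_singleton.mp (f ⟨w, hw⟩).2
      ext1
      rw [Submodule.coe_smul, ← hy, smul_smul, centralIdem_comm, mul_smul, smul_eq_mul (centralIdem e),
        he.centralIdem_mul]
    rw [← map_smul] at h1
    exact congrArg Subtype.val (f.injective h1)
  · intro hv
    rw [← hv, centralIdem, conjSum, Finset.smul_sum, Finset.sum_smul]
    refine Submodule.sum_mem _ fun h _ => ?_
    rw [← smul_mul_assoc, ← smul_mul_assoc, mul_smul, mul_smul]
    refine Submodule.smul_mem _ _ ?_
    set w := single h⁻¹ (1 : ℂ) • v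
    have := he.isSimpleModule_span
    let F : Submodule.span (MonoidAlgebra ℂ G) {e} →ₗ[MonoidAlgebra ℂ G] M :=
      (LinearMap.toSpanSingleton _ M w).comp (Submodule.subtype _)
    have hmem : e • w ∈ LinearMap.range F := ⟨⟨e, Submodule.mem_span_singleton_self e⟩, rfl⟩
    rcases F.injective_or_eq_zero with hF | hF
    · exact (le_sSup (a := LinearMap.range F) ⟨(LinearEquiv.ofInjective F hF).symm⟩ :
        _ ≤ isotypicComponent _ _ _) hmem
    · rw [hF] at hmem
      have : e • w = 0 := by simpa using hmem
      rw [this]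
      exact Submodule.zero_mem _

end IsPrimitive

end GroupAlgebra
end QDF
end

noncomputable section
namespace QDF

/-! ### Tableau combinatorics: column-injective words and dominance -/

section Tableau

open MonoidAlgebra

variable {n d : ℕ} (m : YoungDiag n d)

/-- The row in which `k` stands, as an element of `Fin d`. -/
def rowIdx (k : Fin n) : Fin d := (box m k).1

lemma val_rowIdx (k : Fin n) : (rowIdx m k : ℕ) = rowOf m k := rfl

lemma colOf_lt (k : Fin n) : colOf m k < m.1 (rowIdx m k) := (box m k).2.2

lemma exists_box (i : Fin d) {c : ℕ} (hc : c < m.1 i) : ∃ k, rowIdx m k = i ∧ colOf m k = c := by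
  refine ⟨(box m).symm ⟨i, ⟨c, hc⟩⟩, ?_, ?_⟩
  · rw [rowIdx, Equiv.apply_symm_apply]
  · rw [colOf, Equiv.apply_symm_apply]

lemma eq_of_row_col {k l : Fin n} (hr : rowIdx m k = rowIdx m l) (hc : colOf m k = colOf m l) :
    k = l := by
  refine (box m).injective (Sigma.ext hr ?_)
  rw [Fin.heq_ext_iff (by rw [show (box m k).1 = (box m l).1 from hr])]
  exact hc

/-- The number of positions at which `y` takes the value `j`. -/
def content (y : Fin n → Fin d) (j : Fin d) : ℕ := (Finset.univ.filter fun k => y k = j).card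

lemma content_rowIdx (j : Fin d) : content (rowIdx m) j = m.1 j := by
  rw [content, ← Fintype.card_fin (m.1 j), ← Finset.card_univ]
  symm
  refine Finset.card_bij (fun c _ => (box m).symm ⟨j, c⟩) ?_ ?_ ?_
  · intro c _
    exact Finset.mem_filter.mpr ⟨Finset.mem_univ _, by rw [rowIdx, Equiv.apply_symm_apply]⟩
  · intro c _ c' _ h
    simpa using h
  · intro k hk
    have hk' : rowIdx m k = j := by simpa using hk
    subst hk'
    exact ⟨(box m k).2, Finset.mem_univ _, by simp [rowIdx]⟩

lemma card_lt_eq_sum_content (y : Fin n → Fin d) (i : ℕ) :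
    (Finset.univ.filter fun k => (y k : ℕ) < i).card
      = ∑ j ∈ Finset.univ.filter (fun j : Fin d => (j : ℕ) < i), content y j := by
  rw [Finset.card_eq_sum_card_fiberwise (f := y) (t := Finset.univ.filter (fun j : Fin d => (j : ℕ) < i))]
  · refine Finset.sum_congr rfl fun j hj => ?_
    rw [content, Finset.filter_filter]
    congr 1
    ext k
    simp only [Finset.mem_filter, Finset.mem_univ, true_and] at hj ⊢
    constructor
    · exact fun h => h.2
    · rintro rfl; exact ⟨hj, rfl⟩
  · intro k hk
    simpa using hk

/-- No value of `y` repeats within a column. -/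
def ColumnInjective (y : Fin n → Fin d) : Prop := ∀ k l, colOf m k = colOf m l → y k = y l → k = l

variable {m}

/-- Either the whole column lies in the first `i` rows, or it contains a box in each of those rows;
in the second case injectivity allows at most `i` entries below `i`. -/
lemma card_column_lt_le {y : Fin n → Fin d} (hy : ColumnInjective m y) (c i : ℕ) :
    (Finset.univ.filter fun k => (y k : ℕ) < i ∧ colOf m k = c).card
      ≤ (Finset.univ.filter fun k => rowOf m k < i ∧ colOf m k = c).card := by
  by_cases h : ∀ k, colOf m k = c → rowOf m k < i
  · refine Finset.card_le_card fun k hk => ?_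
    simp only [Finset.mem_filter, Finset.mem_univ, true_and] at hk ⊢
    exact ⟨h k hk.2, hk.2⟩
  · push Not at h
    obtain ⟨k₀, hk₀, hi⟩ := h
    have h1 : (Finset.univ.filter fun k => (y k : ℕ) < i ∧ colOf m k = c).card ≤ i := by
      rw [← Finset.card_range i]
      refine Finset.card_le_card_of_injOn (fun k => (y k : ℕ)) ?_ ?_
      · intro k hk; simpa using (Finset.mem_filter.mp hk).2.1
      · intro k hk l hl hkl
        have hk' := (Finset.mem_filter.mp hk).2
        have hl' := (Finset.mem_filter.mp hl).2
        exact hy k l (hk'.2.trans hl'.2.symm) (Fin.ext hkl)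
    refine h1.trans ?_
    have hid : i ≤ d := hi.trans (rowIdx m k₀).2.le
    have hbox (j : Fin i) : ∃ k, rowIdx m k = ⟨j, j.2.trans_le hid⟩ ∧ colOf m k = c := by
      refine exists_box m _ ?_
      rw [← hk₀]
      refine (colOf_lt m k₀).trans_le (m.2.1 ?_)
      rw [Fin.le_def]
      exact j.2.le.trans hi
    choose f hf using hbox
    have h2 := Finset.card_le_card_of_injOn (s := (Finset.univ : Finset (Fin i)))
      (t := Finset.univ.filter fun k => rowOf m k < i ∧ colOf m k = c) f (fun j _ => by
        simp only [Finset.coe_filter, Set.mem_ofPred_eq, Finset.mem_univ, true_and]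
        exact ⟨by rw [← val_rowIdx, (hf j).1]; exact j.2, (hf j).2⟩)
      (fun j _ j' _ h => by
        have := (hf j).1.symm.trans ((congrArg (rowIdx m) h).trans (hf j').1)
        exact Fin.ext (by simpa using this))
    simpa using h2

lemma card_eq_sum_columns (P : Fin n → Prop) [DecidablePred P] :
    (Finset.univ.filter P).card = ∑ c ∈ Finset.univ.image (colOf m),
      (Finset.univ.filter fun k => P k ∧ colOf m k = c).card := by
  rw [Finset.card_eq_sum_card_fiberwise (f := colOf m) (t := Finset.univ.image (colOf m))]
  · simp only [Finset.filter_filter]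
  · intro k _
    simp

/-- The content of a column-injective word is dominated by the shape; summing over columns reduces
this to `card_column_lt_le`. -/
lemma sum_content_le {y : Fin n → Fin d} (hy : ColumnInjective m y) (i : ℕ) :
    ∑ j ∈ Finset.univ.filter (fun j : Fin d => (j : ℕ) < i), content y j
      ≤ ∑ j ∈ Finset.univ.filter (fun j : Fin d => (j : ℕ) < i), m.1 j := by
  simp only [← content_rowIdx m]
  rw [← card_lt_eq_sum_content, ← card_lt_eq_sum_content, card_eq_sum_columns (m := m),
    card_eq_sum_columns (m := m)]
  exact Finset.sum_le_sum fun c _ => card_column_lt_le hy c i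

/-- When the contents agree, the columnwise inequalities have equal totals and so are all
equalities: each column carries the same values as its row indices. Differences of consecutive
counts isolate a single value. -/
lemma exists_row_eq {y : Fin n → Fin d} (hy : ColumnInjective m y) (hc : content y = m.1)
    (k : Fin n) : ∃ l, colOf m l = colOf m k ∧ rowIdx m l = y k := by
  have hlt (i : ℕ) : (Finset.univ.filter fun l => (y l : ℕ) < i ∧ colOf m l = colOf m k).card
      = (Finset.univ.filter fun l => rowOf m l < i ∧ colOf m l = colOf m k).card := by
    have h1 : ∑ c ∈ Finset.univ.image (colOf m),
        (Finset.univ.filter fun l => (y l : ℕ) < i ∧ colOf m l = c).card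
        = ∑ c ∈ Finset.univ.image (colOf m),
        (Finset.univ.filter fun l => rowOf m l < i ∧ colOf m l = c).card := by
      rw [← card_eq_sum_columns, ← card_eq_sum_columns, card_lt_eq_sum_content, hc]
      refine (Finset.sum_congr rfl fun j _ => (content_rowIdx m j).symm).trans ?_
      rw [← card_lt_eq_sum_content]
      rfl
    exact (Finset.sum_eq_sum_iff_of_le fun c _ => card_column_lt_le hy c i).mp h1 _
      (Finset.mem_image_of_mem _ (Finset.mem_univ k))
  have hsplit (f : Fin n → ℕ) (i : ℕ) :
      (Finset.univ.filter fun l => f l < i + 1 ∧ colOf m l = colOf m k).card =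
      (Finset.univ.filter fun l => f l < i ∧ colOf m l = colOf m k).card +
      (Finset.univ.filter fun l => f l = i ∧ colOf m l = colOf m k).card := by
    rw [← Finset.card_union_of_disjoint]
    · congr 1
      ext l
      simp only [Finset.mem_filter, Finset.mem_univ, true_and, Finset.mem_union]
      omega
    · rw [Finset.disjoint_filter]
      intro l _ h1 h2
      omega
  have heq := hlt (y k + 1)
  rw [hsplit (fun l => (y l : ℕ)), hsplit (fun l => rowOf m l), hlt] at heq
  have hpos : 0 < (Finset.univ.filter fun l => (y l : ℕ) = y k ∧ colOf m l = colOf m k).card :=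
    Finset.card_pos.mpr ⟨k, by simp⟩
  rw [Nat.add_left_cancel heq, Finset.card_pos] at hpos
  obtain ⟨l, hl⟩ := hpos
  simp only [Finset.mem_filter, Finset.mem_univ, true_and] at hl
  exact ⟨l, hl.2, Fin.ext hl.1⟩

variable (m) in
/-- The row group. -/
def rowGroup : Subgroup (Equiv.Perm (Fin n)) where
  carrier := {p | ∀ k, rowOf m (p k) = rowOf m k}
  mul_mem' := fun {a b} ha hb k => by rw [Equiv.Perm.mul_apply, ha, hb]
  one_mem' := fun _ => rfl
  inv_mem' := fun {a} ha k => by rw [← ha]; exact congrArg _ (a.apply_symm_apply k)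

variable (m) in
/-- The column group. -/
def colGroup : Subgroup (Equiv.Perm (Fin n)) where
  carrier := {p | ∀ k, colOf m (p k) = colOf m k}
  mul_mem' := fun {a b} ha hb k => by rw [Equiv.Perm.mul_apply, ha, hb]
  one_mem' := fun _ => rfl
  inv_mem' := fun {a} ha k => by rw [← ha]; exact congrArg _ (a.apply_symm_apply k)

lemma mem_rowGroup {p : Equiv.Perm (Fin n)} : p ∈ rowGroup m ↔ rowIdx m ∘ p = rowIdx m := by
  rw [funext_iff]
  exact forall_congr' fun k => Fin.ext_iff.symm

lemma eq_one_of_mem {p : Equiv.Perm (Fin n)} (hr : p ∈ rowGroup m) (hc : p ∈ colGroup m) : p = 1 :=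
  Equiv.ext fun k => eq_of_row_col m (congrFun (mem_rowGroup.mp hr) k) (hc k)

lemma exists_colGroup {y : Fin n → Fin d} (hy : ColumnInjective m y) (hc : content y = m.1) :
    ∃ q ∈ colGroup m, y = rowIdx m ∘ q := by
  choose f hf using exists_row_eq hy hc
  have hinj : Function.Injective f := fun k l h =>
    hy k l (by rw [← (hf k).1, ← (hf l).1, h]) (by rw [← (hf k).2, ← (hf l).2, h])
  refine ⟨Equiv.ofBijective f (Finite.injective_iff_bijective.mp hinj), fun k => (hf k).1, ?_⟩
  funext k
  exact (hf k).2.symm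

lemma content_comp (y : Fin n → Fin d) (g : Equiv.Perm (Fin n)) : content (y ∘ g) = content y := by
  funext j
  simp only [content, ← Fintype.card_subtype]
  exact Fintype.card_congr (g.subtypeEquiv fun k => by simp)

/-- A function whose content is `m + δ - σ δ` is column injective only for `σ = 1`. -/
lemma perm_eq_one_of_content {y : Fin n → Fin d} (hy : ColumnInjective m y) (σ : Equiv.Perm (Fin d))
    (hc : ∀ j, content y j + (d - 1 - (σ j : ℕ)) = m.1 j + (d - 1 - (j : ℕ))) : σ = 1 := by
  have key (i : ℕ) : ∀ j : Fin d, (j : ℕ) < i → σ j = j := by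
    induction i with
    | zero => intro j hj; omega
    | succ i ih =>
      intro j hj
      rcases Nat.lt_succ_iff_lt_or_eq.mp hj with h | h
      · exact ih j h
      -- Dominance for the first `i + 1` values, with the earlier ones cancelled by induction, gives
      -- `σ j ≤ j`; the smaller values are already taken.
      · have h1 := sum_content_le hy (i + 1)
        have h2 := Finset.sum_congr (s₁ := Finset.univ.filter (fun j : Fin d => (j : ℕ) < i + 1)) rfl
          fun j _ => hc j
        have h3 : Finset.univ.filter (fun j : Fin d => (j : ℕ) < i + 1)
            = insert j (Finset.univ.filter (fun j : Fin d => (j : ℕ) < i)) := by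
          ext l
          simp only [Finset.mem_filter, Finset.mem_univ, true_and, Finset.mem_insert, Fin.ext_iff]
          omega
        have h4 : ∑ l ∈ Finset.univ.filter (fun j : Fin d => (j : ℕ) < i), (d - 1 - (σ l : ℕ))
            = ∑ l ∈ Finset.univ.filter (fun j : Fin d => (j : ℕ) < i), (d - 1 - (l : ℕ)) :=
          Finset.sum_congr rfl fun l hl => by rw [ih l (by simpa using hl)]
        rw [Finset.sum_add_distrib, Finset.sum_add_distrib] at h2
        have h5 : ∑ l ∈ Finset.univ.filter (fun j : Fin d => (j : ℕ) < i + 1), (d - 1 - (l : ℕ))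
            ≤ ∑ l ∈ Finset.univ.filter (fun j : Fin d => (j : ℕ) < i + 1), (d - 1 - (σ l : ℕ)) := by
          omega
        have hnot : j ∉ Finset.univ.filter (fun j : Fin d => (j : ℕ) < i) := by
          simp [h]
        rw [h3, Finset.sum_insert hnot, Finset.sum_insert hnot, h4] at h5
        have h6 : (σ j : ℕ) ≤ j := by
          have := (σ j).2
          have := j.2
          omega
        rcases h6.lt_or_eq with h7 | h7
        · exact σ.injective (ih (σ j) (by omega))
        · exact Fin.ext h7
  exact Equiv.ext fun j => key d j j.2

end Tableau
end QDF
end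

noncomputable section
namespace QDF

/-! ### Young symmetrizers, their normalizations and the Specht character -/

section Symmetrizer

open MonoidAlgebra Equiv.Perm

variable {n d : ℕ} {m : YoungDiag n d}

/-- The sign of a permutation as a complex number. -/
def sgn (q : Equiv.Perm (Fin n)) : ℂ := ((Equiv.Perm.sign q : ℤ) : ℂ)

lemma sgn_mul (p q : Equiv.Perm (Fin n)) : sgn (p * q) = sgn p * sgn q := by simp [sgn]

lemma sgn_mul_self (p : Equiv.Perm (Fin n)) : sgn p * sgn p = 1 := by
  rw [← sgn_mul]
  rcases Int.units_eq_one_or (Equiv.Perm.sign p) with h | h <;> simp [sgn, h]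

lemma sgn_inv (p : Equiv.Perm (Fin n)) : sgn p⁻¹ = sgn p := by simp [sgn]

lemma sgn_one : sgn (1 : Equiv.Perm (Fin n)) = 1 := by simp [sgn]

lemma sgn_swap {k l : Fin n} (h : k ≠ l) : sgn (Equiv.swap k l) = -1 := by
  simp [sgn, Equiv.Perm.sign_swap h]

open Classical in
variable (m) in
/-- The elements of the row group. -/
def rowPerms : Finset (Equiv.Perm (Fin n)) := Finset.univ.filter (· ∈ rowGroup m)

open Classical in
variable (m) in
/-- The elements of the column group. -/
def colPerms : Finset (Equiv.Perm (Fin n)) := Finset.univ.filter (· ∈ colGroup m)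

lemma mem_rowPerms {p : Equiv.Perm (Fin n)} : p ∈ rowPerms m ↔ p ∈ rowGroup m := by
  simp [rowPerms]

lemma mem_colPerms {p : Equiv.Perm (Fin n)} : p ∈ colPerms m ↔ p ∈ colGroup m := by
  simp [colPerms]

variable (m) in
/-- The sum over the row group. -/
def rowSum : GroupAlg n := ∑ p ∈ rowPerms m, single p 1

variable (m) in
/-- The signed sum over the column group. -/
def colSum : GroupAlg n := ∑ q ∈ colPerms m, sgn q • single q 1

lemma youngSymmetrizer_eq : youngSymmetrizer m = rowSum m * colSum m := by
  simp only [youngSymmetrizer, rowSum, colSum, rowPerms, colPerms]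
  congr!

lemma sum_rowPerms_mul_right {M : Type*} [AddCommMonoid M] {p : Equiv.Perm (Fin n)}
    (hp : p ∈ rowGroup m) (f : Equiv.Perm (Fin n) → M) :
    ∑ x ∈ rowPerms m, f (x * p) = ∑ x ∈ rowPerms m, f x :=
  Finset.sum_equiv (Equiv.mulRight p)
    (fun x => by simp [mem_rowPerms, Subgroup.mul_mem_cancel_right _ hp]) (fun x _ => rfl)

lemma sum_rowPerms_inv {M : Type*} [AddCommMonoid M] (f : Equiv.Perm (Fin n) → M) :
    ∑ x ∈ rowPerms m, f x⁻¹ = ∑ x ∈ rowPerms m, f x :=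
  Finset.sum_equiv (Equiv.inv _) (fun x => by simp [mem_rowPerms]) (fun x _ => rfl)

lemma sum_colPerms_mul_left {M : Type*} [AddCommMonoid M] {p : Equiv.Perm (Fin n)}
    (hp : p ∈ colGroup m) (f : Equiv.Perm (Fin n) → M) :
    ∑ x ∈ colPerms m, f (p * x) = ∑ x ∈ colPerms m, f x :=
  Finset.sum_equiv (Equiv.mulLeft p)
    (fun x => by simp [mem_colPerms, Subgroup.mul_mem_cancel_left _ hp]) (fun x _ => rfl)

lemma sum_colPerms_mul_right {M : Type*} [AddCommMonoid M] {p : Equiv.Perm (Fin n)}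
    (hp : p ∈ colGroup m) (f : Equiv.Perm (Fin n) → M) :
    ∑ x ∈ colPerms m, f (x * p) = ∑ x ∈ colPerms m, f x :=
  Finset.sum_equiv (Equiv.mulRight p)
    (fun x => by simp [mem_colPerms, Subgroup.mul_mem_cancel_right _ hp]) (fun x _ => rfl)

lemma sum_colPerms_inv {M : Type*} [AddCommMonoid M] (f : Equiv.Perm (Fin n) → M) :
    ∑ x ∈ colPerms m, f x⁻¹ = ∑ x ∈ colPerms m, f x :=
  Finset.sum_equiv (Equiv.inv _) (fun x => by simp [mem_colPerms]) (fun x _ => rfl)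

lemma rowSum_mul_single {p : Equiv.Perm (Fin n)} (hp : p ∈ rowGroup m) :
    rowSum m * single p 1 = rowSum m := by
  rw [rowSum, Finset.sum_mul]
  simp only [single_mul_single, mul_one]
  exact sum_rowPerms_mul_right hp fun x => single x 1

lemma single_mul_colSum {q : Equiv.Perm (Fin n)} (hq : q ∈ colGroup m) :
    single q 1 * colSum m = sgn q • colSum m := by
  have h := sum_colPerms_mul_left hq fun x => sgn x • single x (1 : ℂ)
  rw [colSum, Finset.mul_sum]
  conv_rhs => rw [← h, Finset.smul_sum]
  refine Finset.sum_congr rfl fun x _ => ?_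
  rw [sgn_mul, smul_smul, ← mul_assoc, sgn_mul_self, one_mul, mul_smul_comm, single_mul_single,
    mul_one]

lemma rowSum_mul_rowSum : rowSum m * rowSum m = ((rowPerms m).card : ℂ) • rowSum m := by
  nth_rewrite 2 [rowSum]
  rw [Finset.mul_sum, Finset.sum_congr rfl fun p hp => rowSum_mul_single (mem_rowPerms.mp hp),
    Finset.sum_const, Nat.cast_smul_eq_nsmul]

lemma rowPerms_card_ne_zero : ((rowPerms m).card : ℂ) ≠ 0 :=
  Nat.cast_ne_zero.mpr (Finset.card_ne_zero_of_mem (mem_rowPerms.mpr (one_mem _)))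

/-- If the row filling moved by `g` is column injective, then `g` factors as a row permutation times
a column permutation and both are absorbed. Otherwise two boxes of one column are sent to one row;
the corresponding transposition is absorbed on the left with sign `+1` and on the right with sign
`-1`, so the product is zero. -/
lemma rowSum_single_colSum (g : Equiv.Perm (Fin n)) :
    ∃ a : ℂ, rowSum m * single g 1 * colSum m = a • youngSymmetrizer m := by
  by_cases h : ColumnInjective m (rowIdx m ∘ g)
  · obtain ⟨q, hq, hg⟩ := exists_colGroup h (by
      rw [content_comp]; exact funext (content_rowIdx m))
    have hp : g * q⁻¹ ∈ rowGroup m := by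
      rw [mem_rowGroup]
      funext k
      have := congrFun hg (q⁻¹ k)
      simp only [Function.comp_apply] at this
      rw [show q (q⁻¹ k) = k from q.apply_symm_apply k] at this
      exact this
    refine ⟨sgn q, ?_⟩
    have : single g (1 : ℂ) = single (g * q⁻¹) 1 * single q 1 := by simp [single_mul_single]
    rw [this, ← mul_assoc, rowSum_mul_single hp, mul_assoc, single_mul_colSum hq, mul_smul_comm,
      youngSymmetrizer_eq]
  · simp only [ColumnInjective, not_forall] at h
    obtain ⟨k, l, hc, hr, hkl⟩ := h
    refine ⟨0, ?_⟩
    have hp : Equiv.swap (g k) (g l) ∈ rowGroup m := by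
      rw [mem_rowGroup]
      funext x
      simp only [Function.comp_apply] at hr ⊢
      rcases Equiv.swap_apply_eq_iff.mp (rfl : Equiv.swap (g k) (g l) x = _) with _
      by_cases h1 : x = g k
      · rw [h1, Equiv.swap_apply_left, hr]
      · by_cases h2 : x = g l
        · rw [h2, Equiv.swap_apply_right, hr]
        · rw [Equiv.swap_apply_of_ne_of_ne h1 h2]
    have hq : Equiv.swap k l ∈ colGroup m := by
      intro x
      by_cases h1 : x = k
      · rw [h1, Equiv.swap_apply_left, hc]
      · by_cases h2 : x = l
        · rw [h2, Equiv.swap_apply_right, hc]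
        · rw [Equiv.swap_apply_of_ne_of_ne h1 h2]
    have hcomm : Equiv.swap (g k) (g l) * g = g * Equiv.swap k l := by
      rw [Equiv.mul_swap_eq_swap_mul]
    have h1 : rowSum m * single g 1 * colSum m = -(rowSum m * single g 1 * colSum m) := by
      nth_rewrite 1 [← rowSum_mul_single hp]
      rw [mul_assoc (rowSum m), single_mul_single, hcomm, one_mul, ← one_mul (1 : ℂ),
        ← single_mul_single, one_mul, ← mul_assoc, mul_assoc _ _ (colSum m), single_mul_colSum hq,
        sgn_swap hkl, neg_one_smul, mul_neg]
    rw [zero_smul]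
    have h2 : (2 : ℂ) • (rowSum m * single g 1 * colSum m) = 0 := by
      rw [two_smul]
      nth_rewrite 1 [h1]
      exact neg_add_cancel _
    exact (smul_eq_zero.mp h2).resolve_left two_ne_zero

lemma rowSum_mul_colSum (x : GroupAlg n) :
    ∃ a : ℂ, rowSum m * x * colSum m = a • youngSymmetrizer m := by
  choose a ha using rowSum_single_colSum (m := m)
  refine ⟨∑ g, x.coeff g * a g, ?_⟩
  rw [eq_sum_smul_single x, Finset.mul_sum, Finset.sum_mul, Finset.sum_smul]
  refine Finset.sum_congr rfl fun g _ => ?_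
  rw [mul_smul_comm, smul_mul_assoc, ha, smul_smul, ← eq_sum_smul_single]

/-- Only the trivial pair contributes, because the row and column groups intersect trivially. -/
lemma coeff_one_youngSymmetrizer : (youngSymmetrizer m).coeff 1 = 1 := by
  classical
  rw [youngSymmetrizer_eq, rowSum, colSum, Finset.sum_mul_sum, coeff_sum, Finset.sum_apply']
  simp only [mul_smul_comm, single_mul_single, coeff_sum, coeff_smul, coeff_single, one_mul,
    Finsupp.coe_finsetSum, Finset.sum_apply, Finsupp.smul_apply, Finsupp.single_apply]
  rw [Finset.sum_eq_single 1, Finset.sum_eq_single 1]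
  · simp [sgn_one]
  · intro q _ hq
    rw [one_mul, if_neg hq, smul_zero]
  · exact fun h => absurd (mem_colPerms.mpr (one_mem _)) h
  · intro p hp hp1
    refine Finset.sum_eq_zero fun q hq => ?_
    rw [if_neg, smul_zero]
    intro h
    refine hp1 (eq_one_of_mem (mem_rowPerms.mp hp) ?_)
    rw [eq_inv_of_mul_eq_one_left h]
    exact inv_mem (mem_colPerms.mp hq)
  · exact fun h => absurd (mem_rowPerms.mpr (one_mem _)) h

variable (m) in
/-- The scalar `κ` with `c * c = κ c`. -/
def kappa : ℂ := (youngSymmetrizer m * youngSymmetrizer m).coeff 1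

lemma youngSymmetrizer_mul_self :
    youngSymmetrizer m * youngSymmetrizer m = kappa m • youngSymmetrizer m := by
  obtain ⟨a, ha⟩ := rowSum_mul_colSum (m := m) (colSum m * rowSum m)
  have h : youngSymmetrizer m * youngSymmetrizer m = a • youngSymmetrizer m := by
    rw [← ha, youngSymmetrizer_eq]; simp only [mul_assoc]
  rw [kappa, h, coeff_smul_apply, coeff_one_youngSymmetrizer, smul_eq_mul, mul_one]

/-- Otherwise the symmetrizer would square to zero and its coefficient at `1` would vanish with the
trace of left multiplication. -/
lemma kappa_ne_zero : kappa m ≠ 0 := by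
  intro h
  have h1 := youngSymmetrizer_mul_self (m := m)
  rw [h, zero_smul] at h1
  have := coeff_one_eq_zero_of_nilpotent h1
  rw [coeff_one_youngSymmetrizer] at this
  exact one_ne_zero this

variable (m) in
/-- The normalized Young symmetrizer. -/
def youngIdem : GroupAlg n := (kappa m)⁻¹ • youngSymmetrizer m

lemma coeff_one_youngIdem : (youngIdem m).coeff 1 = (kappa m)⁻¹ := by
  rw [youngIdem, coeff_smul_apply, coeff_one_youngSymmetrizer, smul_eq_mul, mul_one]

lemma youngIdem_isPrimitive : IsPrimitive (youngIdem m) where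
  idem := by
    rw [youngIdem, smul_mul_smul_comm, youngSymmetrizer_mul_self, smul_smul, mul_assoc,
      inv_mul_cancel₀ kappa_ne_zero, mul_one]
  ne_zero := by
    intro h
    have := coeff_one_youngIdem (m := m)
    rw [h] at this
    exact inv_ne_zero kappa_ne_zero this.symm
  corner := fun x => by
    obtain ⟨a, ha⟩ := rowSum_mul_colSum (m := m) (colSum m * x * rowSum m)
    refine ⟨(kappa m)⁻¹ * a, ?_⟩
    have h : youngSymmetrizer m * x * youngSymmetrizer m = a • youngSymmetrizer m := by
      rw [← ha, youngSymmetrizer_eq]; simp only [mul_assoc]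
    simp only [youngIdem, smul_mul_assoc, mul_smul_comm, h, smul_smul]
    congr 1
    ring

variable (m) in
/-- The normalized element `r q r`: a self-adjoint variant of the Young symmetrizer. -/
def youngProj : GroupAlg n := (kappa m * (rowPerms m).card)⁻¹ • (rowSum m * colSum m * rowSum m)

/-- By cyclicity the two row sums can be brought together, where they give `|R|` times one row sum.
The self-adjoint idempotent thus has the same character and the same central idempotent as the Young
idempotent. -/
lemma conjSum_youngProj : conjSum (youngProj m) = conjSum (youngIdem m) := by
  rw [youngProj, youngIdem, conjSum_smul, conjSum_smul, conjSum_mul_comm, ← mul_assoc,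
    rowSum_mul_rowSum, smul_mul_assoc, conjSum_smul, smul_smul, youngSymmetrizer_eq]
  congr 1
  have := rowPerms_card_ne_zero (m := m)
  have := kappa_ne_zero (m := m)
  field_simp

lemma youngProj_isPrimitive : IsPrimitive (youngProj m) where
  idem := by
    have h : rowSum m * colSum m * rowSum m * (rowSum m * colSum m * rowSum m)
        = (kappa m * (rowPerms m).card) • (rowSum m * colSum m * rowSum m) := by
      have h1 : rowSum m * colSum m * rowSum m * (rowSum m * colSum m * rowSum m)
          = rowSum m * colSum m * (rowSum m * rowSum m) * colSum m * rowSum m := by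
        simp only [mul_assoc]
      have h2 : rowSum m * colSum m * (rowSum m) * colSum m * rowSum m
          = youngSymmetrizer m * youngSymmetrizer m * rowSum m := by
        rw [youngSymmetrizer_eq]; simp only [mul_assoc]
      rw [h1, rowSum_mul_rowSum, mul_smul_comm, smul_mul_assoc, smul_mul_assoc, h2,
        youngSymmetrizer_mul_self, smul_mul_assoc, smul_smul, mul_comm, youngSymmetrizer_eq]
    have := rowPerms_card_ne_zero (m := m)
    have := kappa_ne_zero (m := m)
    rw [youngProj, smul_mul_smul_comm, h, smul_smul]
    congr 1
    field_simp
  ne_zero := by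
    intro h
    have h1 := conjSum_youngProj (m := m)
    have h2 := (youngIdem_isPrimitive (m := m)).centralIdem_mul
    rw [centralIdem, ← h1, h] at h2
    refine (youngIdem_isPrimitive (m := m)).ne_zero ?_
    rw [← h2]
    simp [conjSum]
  corner := fun x => by
    obtain ⟨a, ha⟩ := rowSum_mul_colSum (m := m) (colSum m * (rowSum m * x * rowSum m))
    refine ⟨(kappa m * (rowPerms m).card)⁻¹ * a, ?_⟩
    have h : (rowSum m * colSum m * rowSum m) * x * (rowSum m * colSum m * rowSum m)
        = a • (rowSum m * colSum m * rowSum m) := by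
      rw [← youngSymmetrizer_eq (m := m), ← smul_mul_assoc, ← ha, youngSymmetrizer_eq]
      simp only [mul_assoc]
    rw [youngProj]
    simp only [smul_mul_assoc, mul_smul_comm, h, smul_smul]
    congr 1
    ring

lemma coeff_one_youngProj : (youngProj m).coeff 1 = (youngIdem m).coeff 1 := by
  have h := congrArg (fun x : GroupAlg n => x.coeff 1) (conjSum_youngProj (m := m))
  simp only [coeff_conjSum, mul_one, inv_mul_cancel, Finset.sum_const, Finset.card_univ,
    nsmul_eq_mul] at h
  exact mul_left_cancel₀ (Nat.cast_ne_zero.mpr Fintype.card_ne_zero) h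

lemma centralIdem_youngProj : centralIdem (youngProj m) = centralIdem (youngIdem m) := by
  rw [centralIdem, centralIdem, conjSum_youngProj, coeff_one_youngProj]

lemma specht_eq_span : Specht m = Submodule.span (GroupAlg n) {youngIdem m} := by
  refine le_antisymm ?_ ?_
  · rw [Submodule.span_singleton_le_iff_mem, Submodule.mem_span_singleton]
    exact ⟨single 1 (kappa m), by
      rw [youngIdem, smul_eq_mul, mul_smul_comm, ← smul_mul_assoc, smul_single, smul_eq_mul,
        inv_mul_cancel₀ kappa_ne_zero, ← MonoidAlgebra.one_def, one_mul]⟩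
  · rw [Submodule.span_singleton_le_iff_mem, Submodule.mem_span_singleton]
    exact ⟨single 1 (kappa m)⁻¹, by
      rw [youngIdem, smul_eq_mul]; ext g; simp⟩

lemma dimV_eq : (dimV m : ℂ) = (n.factorial : ℂ) * (youngIdem m).coeff 1 := by
  rw [dimV, specht_eq_span, youngIdem_isPrimitive.finrank_span, Fintype.card_perm, Fintype.card_fin]

lemma dimV_pos : 0 < dimV m := by
  rw [Nat.pos_iff_ne_zero]
  intro h
  have h1 := dimV_eq (m := m)
  rw [h, Nat.cast_zero, eq_comm, mul_eq_zero] at h1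
  exact h1.elim (by exact_mod_cast n.factorial_ne_zero) youngIdem_isPrimitive.coeff_one_ne_zero

lemma inv_kappa_eq : (kappa m)⁻¹ = (dimV m : ℂ) / n.factorial := by
  rw [dimV_eq, coeff_one_youngIdem, mul_div_cancel_left₀]
  exact_mod_cast n.factorial_ne_zero

lemma star_coeff_youngSymmetrizer (g : Equiv.Perm (Fin n)) :
    star ((youngSymmetrizer m).coeff g) = (youngSymmetrizer m).coeff g := by
  classical
  rw [youngSymmetrizer_eq, rowSum, colSum, Finset.sum_mul_sum, coeff_sum, Finset.sum_apply', star_sum]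
  refine Finset.sum_congr rfl fun p _ => ?_
  rw [coeff_sum, Finset.sum_apply', star_sum]
  refine Finset.sum_congr rfl fun q _ => ?_
  rw [mul_smul_comm, single_mul_single, coeff_smul_apply, coeff_single, Finsupp.single_apply]
  split_ifs <;> simp [sgn]

lemma star_coeff_youngIdem (g : Equiv.Perm (Fin n)) :
    star ((youngIdem m).coeff g) = (youngIdem m).coeff g := by
  rw [youngIdem, coeff_smul_apply, smul_eq_mul, star_mul', star_coeff_youngSymmetrizer, inv_kappa_eq]
  simp

variable (m) in
/-- The (real) coefficients of the normalized Young symmetrizer. -/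
def idemCoeff (g : Equiv.Perm (Fin n)) : ℝ := ((youngIdem m).coeff g).re

lemma ofReal_idemCoeff (g : Equiv.Perm (Fin n)) :
    ((idemCoeff m g : ℝ) : ℂ) = (youngIdem m).coeff g :=
  Complex.conj_eq_iff_re.mp (star_coeff_youngIdem g)

variable (m) in
/-- The character of the Specht module. -/
def character (g : Equiv.Perm (Fin n)) : ℝ := ∑ h, idemCoeff m (h⁻¹ * g * h)

lemma ofReal_character (g : Equiv.Perm (Fin n)) :
    ((character m g : ℝ) : ℂ) = (conjSum (youngIdem m)).coeff g := by
  rw [character, coeff_conjSum]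
  push_cast
  simp only [ofReal_idemCoeff]

lemma character_conj (g h : Equiv.Perm (Fin n)) : character m (h⁻¹ * g * h) = character m g := by
  rw [character, character,
    ← Equiv.sum_comp (Equiv.mulLeft h) fun k => idemCoeff m (k⁻¹ * g * k)]
  refine Finset.sum_congr rfl fun k _ => ?_
  simp [mul_assoc]

/-- A permutation and its inverse have the same cycle type. -/
lemma character_inv (g : Equiv.Perm (Fin n)) : character m g⁻¹ = character m g := by
  have h : IsConj g g⁻¹ := by
    rw [Equiv.Perm.isConj_iff_cycleType_eq, Equiv.Perm.cycleType_inv]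
  obtain ⟨k, hk⟩ := isConj_iff.mp h
  rw [← hk]
  simpa using character_conj (m := m) g k⁻¹

lemma sum_character_sq : ∑ g, character m g ^ 2 = (n.factorial : ℝ) := by
  have h := (youngIdem_isPrimitive (m := m)).sum_character_mul_inv
  rw [Fintype.card_perm, Fintype.card_fin] at h
  have h2 : ((∑ g, character m g ^ 2 : ℝ) : ℂ) = ((n.factorial : ℝ) : ℂ) := by
    push_cast
    rw [← h]
    refine Finset.sum_congr rfl fun g _ => ?_
    rw [← ofReal_character, ← ofReal_character, character_inv, pow_two]
  exact_mod_cast h2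

lemma character_one : character m 1 = dimV m := by
  have h : ((character m 1 : ℝ) : ℂ) = dimV m := by
    rw [ofReal_character, coeff_conjSum, dimV_eq]
    simp [Fintype.card_perm]
  exact_mod_cast h

end Symmetrizer
end QDF
end

noncomputable section
namespace QDF

/-! ### Weight multiplicities of the Young idempotent -/

section Weights

open MonoidAlgebra Classical

variable {n d : ℕ} {m : YoungDiag n d}

/-- The linear extension of a function on the symmetric group to the group algebra. -/
def pairing (φ : Equiv.Perm (Fin n) → ℂ) : GroupAlg n →ₗ[ℂ] ℂ where
  toFun x := ∑ g, x.coeff g * φ g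
  map_add' x y := by simp [add_mul, Finset.sum_add_distrib]
  map_smul' a x := by simp [Finset.mul_sum, mul_assoc]

lemma pairing_apply (φ : Equiv.Perm (Fin n) → ℂ) (x : GroupAlg n) :
    pairing φ x = ∑ g, x.coeff g * φ g := rfl

lemma pairing_single (φ : Equiv.Perm (Fin n) → ℂ) (g : Equiv.Perm (Fin n)) :
    pairing φ (single g 1) = φ g := by
  simp [pairing_apply, Finsupp.single_apply]

lemma pairing_youngSymmetrizer (φ : Equiv.Perm (Fin n) → ℂ) :
    pairing φ (youngSymmetrizer m) = ∑ p ∈ rowPerms m, ∑ q ∈ colPerms m, sgn q * φ (p * q) := by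
  rw [youngSymmetrizer_eq, rowSum, colSum, Finset.sum_mul_sum, map_sum]
  refine Finset.sum_congr rfl fun p _ => ?_
  rw [map_sum]
  refine Finset.sum_congr rfl fun q _ => ?_
  rw [mul_smul_comm, single_mul_single, map_smul, mul_one, pairing_single, smul_eq_mul]

/-- The number of words of content `μ` fixed by `g`. -/
def fixedCount (d : ℕ) (μ : Fin d → ℕ) (g : Equiv.Perm (Fin n)) : ℕ :=
  (Finset.univ.filter fun a : Idx n d => a ∘ g = a ∧ content a = μ).card

variable (m) in
/-- The contribution of one word to the trace of the Young symmetrizer. -/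
def wordTrace (a : Idx n d) : ℂ :=
  ∑ p ∈ rowPerms m, ∑ q ∈ colPerms m, sgn q * if a ∘ (p * q) = a then 1 else 0

lemma pairing_fixedCount (μ : Fin d → ℕ) :
    pairing (fun g => (fixedCount d μ g : ℂ)) (youngSymmetrizer m)
      = ∑ a ∈ Finset.univ.filter (fun a : Idx n d => content a = μ), wordTrace m a := by
  rw [pairing_youngSymmetrizer]
  simp only [wordTrace]
  conv_rhs => rw [Finset.sum_comm]
  refine Finset.sum_congr rfl fun p _ => ?_
  conv_rhs => rw [Finset.sum_comm]
  refine Finset.sum_congr rfl fun q _ => ?_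
  rw [← Finset.mul_sum, ← Finset.sum_filter, Finset.sum_const, fixedCount, Finset.filter_filter,
    nsmul_eq_mul, mul_one]
  congr 3
  ext a
  simp only [Finset.mem_filter, Finset.mem_univ, true_and, and_comm]

/-- A transposition within a column that fixes the word reverses the sign of the sum. -/
lemma wordTrace_eq_zero {a : Idx n d} (ha : ¬ ColumnInjective m a) : wordTrace m a = 0 := by
  simp only [ColumnInjective, not_forall] at ha
  obtain ⟨k, l, hc, hr, hkl⟩ := ha
  have hs : a ∘ Equiv.swap k l = a := by
    funext x
    by_cases h1 : x = k
    · simp [h1, hr]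
    · by_cases h2 : x = l
      · simp [h2, hr]
      · simp [Equiv.swap_apply_of_ne_of_ne h1 h2]
  have hq : Equiv.swap k l ∈ colGroup m := by
    intro x
    by_cases h1 : x = k
    · rw [h1, Equiv.swap_apply_left, hc]
    · by_cases h2 : x = l
      · rw [h2, Equiv.swap_apply_right, hc]
      · rw [Equiv.swap_apply_of_ne_of_ne h1 h2]
  refine Finset.sum_eq_zero fun p _ => ?_
  refine self_eq_neg.mp ?_
  conv_lhs => rw [← sum_colPerms_mul_right hq]
  rw [← Finset.sum_neg_distrib]
  refine Finset.sum_congr rfl fun q _ => ?_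
  rw [sgn_mul, sgn_swap hkl, ← mul_assoc]
  have h : a ∘ (p * q * Equiv.swap k l : Equiv.Perm (Fin n)) = a ↔ a ∘ (p * q : Equiv.Perm (Fin n)) = a := by
    rw [Equiv.Perm.coe_mul (p * q), ← Function.comp_assoc]
    constructor
    · intro h
      have h3 := congrArg (fun f => f ∘ Equiv.swap k l) h
      simp only [Function.comp_assoc] at h3
      rw [show (Equiv.swap k l : Fin n → Fin n) ∘ Equiv.swap k l = id by ext x; simp] at h3
      rw [hs] at h3
      exact h3
    · intro h
      rw [h, hs]
  simp only [h]
  ring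

/-- The word is fixed exactly when `q' * p * q` is a row permutation, and then a unique `p'` in the
row group inverts it. This form matches the expansion of column · row · column · row. -/
lemma wordTrace_row {q' : Equiv.Perm (Fin n)} (hq' : q' ∈ colGroup m) :
    wordTrace m (rowIdx m ∘ q') = ∑ p ∈ rowPerms m, ∑ q ∈ colPerms m, ∑ p' ∈ rowPerms m,
      sgn q' * sgn q * if q' * p * q * p' = 1 then 1 else 0 := by
  rw [wordTrace]
  refine Finset.sum_congr rfl fun p _ => ?_
  rw [← sum_colPerms_mul_right hq']
  refine Finset.sum_congr rfl fun q _ => ?_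
  rw [← Finset.mul_sum, sgn_mul, mul_comm (sgn q)]
  congr 1
  have h : (rowIdx m ∘ q') ∘ (p * (q * q') : Equiv.Perm (Fin n)) = rowIdx m ∘ q' ↔
      q' * p * q ∈ rowGroup m := by
    rw [mem_rowGroup]
    have h1 : (rowIdx m ∘ q') ∘ (p * (q * q') : Equiv.Perm (Fin n))
        = (rowIdx m ∘ (q' * p * q : Equiv.Perm (Fin n))) ∘ q' := rfl
    rw [h1]
    exact q'.surjective.right_cancellable
  by_cases h2 : q' * p * q ∈ rowGroup m
  · rw [if_pos (h.mpr h2), Finset.sum_eq_single (q' * p * q)⁻¹]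
    · simp
    · intro p' _ hp'
      rw [if_neg]
      intro h3
      exact hp' (eq_inv_of_mul_eq_one_right h3)
    · intro h3
      exact absurd (mem_rowPerms.mpr (inv_mem h2)) h3
  · rw [if_neg (h.not.mpr h2)]
    symm
    refine Finset.sum_eq_zero fun p' hp' => ?_
    rw [if_neg]
    intro h3
    refine h2 ?_
    rw [eq_inv_of_mul_eq_one_left h3]
    exact inv_mem (mem_rowPerms.mp hp')

/-- Only words `rowIdx m ∘ q'` with `q'` in the column group contribute. Their contributions add up
to the coefficient at `1` of column · row · column · row, which equals `kappa m` by cyclicity. -/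
lemma pairing_fixedCount_self :
    pairing (fun g => (fixedCount d m.1 g : ℂ)) (youngSymmetrizer m) = kappa m := by
  have himg : ∑ a ∈ Finset.univ.filter (fun a : Idx n d => content a = m.1), wordTrace m a
      = ∑ q' ∈ colPerms m, wordTrace m (rowIdx m ∘ q') := by
    rw [← Finset.sum_image (s := colPerms m) (g := fun q' => rowIdx m ∘ q')]
    · symm
      refine Finset.sum_subset ?_ ?_
      · intro a ha
        obtain ⟨q', _, rfl⟩ := Finset.mem_image.mp ha
        simp only [Finset.mem_filter, Finset.mem_univ, true_and]
        rw [content_comp]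
        exact funext (content_rowIdx m)
      · intro a ha hna
        refine wordTrace_eq_zero fun hci => hna ?_
        obtain ⟨q', hq', rfl⟩ := exists_colGroup hci (by simpa using ha)
        exact Finset.mem_image.mpr ⟨q', mem_colPerms.mpr hq', rfl⟩
    · intro q₁ h₁ q₂ h₂ h
      refine Equiv.ext fun k => eq_of_row_col m (congrFun h k) ?_
      rw [mem_colPerms.mp h₁ k, mem_colPerms.mp h₂ k]
  have hk : kappa m = (colSum m * rowSum m * colSum m * rowSum m).coeff 1 := by
    rw [kappa, youngSymmetrizer_eq, coeff_mul_one_comm (colSum m * rowSum m * colSum m)]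
    simp only [mul_assoc]
  have hexp : colSum m * rowSum m * colSum m * rowSum m = ∑ q' ∈ colPerms m, ∑ p ∈ rowPerms m,
      ∑ q ∈ colPerms m, ∑ p' ∈ rowPerms m, (sgn q' * sgn q) • single (q' * p * q * p') (1 : ℂ) := by
    rw [mul_assoc, mul_assoc]
    simp only [rowSum, colSum, Finset.sum_mul]
    simp only [Finset.mul_sum, smul_mul_assoc, mul_smul_comm, single_mul_single, mul_one, smul_smul,
      ← mul_assoc]
    simp only [mul_comm]
  rw [pairing_fixedCount, himg, hk, hexp]
  simp only [coeff_sum, Finset.sum_apply', coeff_smul_apply, coeff_single, Finsupp.single_apply]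
  refine Finset.sum_congr rfl fun q' hq' => ?_
  rw [wordTrace_row (mem_colPerms.mp hq')]
  simp

lemma sum_idemCoeff_mul (φ : Equiv.Perm (Fin n) → ℝ) :
    ((∑ g, idemCoeff m g * φ g : ℝ) : ℂ)
      = (kappa m)⁻¹ * pairing (fun g => (φ g : ℂ)) (youngSymmetrizer m) := by
  rw [← smul_eq_mul, ← map_smul, ← youngIdem, pairing_apply]
  push_cast
  simp only [ofReal_idemCoeff]

/-- The multiplicity of the highest weight is one. -/
lemma sum_idemCoeff_fixedCount_self : ∑ g, idemCoeff m g * fixedCount d m.1 g = 1 := by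
  have h := sum_idemCoeff_mul (m := m) fun g => (fixedCount d m.1 g : ℝ)
  simp only [Complex.ofReal_natCast] at h
  rw [pairing_fixedCount_self, inv_mul_cancel₀ kappa_ne_zero] at h
  exact_mod_cast h

/-- A column-injective word of this content would force `σ = 1`. This kills all terms but one when
the Vandermonde determinant is expanded in `sum_frobenius_mul_idemCoeff`. -/
lemma sum_idemCoeff_fixedCount_eq_zero {μ : Fin d → ℕ} {σ : Equiv.Perm (Fin d)} (hσ : σ ≠ 1)
    (hμ : ∀ j, μ j + (d - 1 - (σ j : ℕ)) = m.1 j + (d - 1 - (j : ℕ))) :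
    ∑ g, idemCoeff m g * fixedCount d μ g = 0 := by
  have h := sum_idemCoeff_mul (m := m) fun g => (fixedCount d μ g : ℝ)
  simp only [Complex.ofReal_natCast] at h
  have h0 : ∑ a ∈ Finset.univ.filter (fun a : Idx n d => content a = μ), wordTrace m a = 0 := by
    refine Finset.sum_eq_zero fun a ha => ?_
    refine wordTrace_eq_zero fun hci => hσ (perm_eq_one_of_content hci σ ?_)
    simp only [Finset.mem_filter, Finset.mem_univ, true_and] at ha
    rw [ha]
    exact hμ
  rw [pairing_fixedCount, h0, mul_zero] at h
  exact_mod_cast h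

end Weights
end QDF
end

noncomputable section
namespace QDF

/-! ### Cauchy's determinant and Cauchy's identity -/

section Cauchy

variable {d : ℕ} {R : Type*} [CommRing R]

/-- The alternant `det (x_i ^ e_j)`. -/
def detPow (x : Fin d → R) (e : Fin d → ℕ) : R := (Matrix.of fun i j => x i ^ e j).det

/-- The staircase `d - 1, …, 1, 0`. -/
def stair (d : ℕ) (j : Fin d) : ℕ := d - 1 - (j : ℕ)

lemma detPow_stair (x : Fin d → R) :
    detPow x (stair d) = ∏ i, ∏ j ∈ Finset.Ioi i, (x i - x j) := by
  have h := Matrix.det_projVandermonde (fun _ => (1 : R)) x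
  simp only [one_mul] at h
  rw [← h, detPow]
  congr 1
  ext i j
  rw [Matrix.of_apply, Matrix.projVandermonde_apply, one_pow, one_mul, stair, Fin.val_rev]
  congr 1
  omega

/-- The homogeneous form in `a` and `b` matters: the inner sums depend on `y` alone, so two
specializations of `(a, b)` share one coefficient matrix. -/
lemma prod_sub_eq_sum_powersetCard {ι : Type*} [DecidableEq ι] (s : Finset ι) (a b : R) (y : ι → R) :
    ∏ l ∈ s, (a - b * y l) = ∑ k ∈ Finset.range (s.card + 1), a ^ k * b ^ (s.card - k) *
      ∑ A ∈ s.powersetCard k, ∏ l ∈ s \ A, -y l := by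
  have h : ∏ l ∈ s, (a - b * y l) = ∏ l ∈ s, (a + b * -y l) :=
    Finset.prod_congr rfl fun l _ => by ring
  rw [h, Finset.prod_add, Finset.sum_powerset]
  refine Finset.sum_congr rfl fun k _ => ?_
  rw [Finset.mul_sum]
  refine Finset.sum_congr rfl fun A hA => ?_
  rw [Finset.mem_powersetCard] at hA
  rw [Finset.prod_const, hA.2, Finset.prod_mul_distrib, Finset.prod_const,
    Finset.card_sdiff_of_subset hA.1, hA.2, mul_assoc]

lemma prod_erase_sub_eq (y : Fin d → R) :
    ∏ i, ∏ l ∈ Finset.univ.erase i, (y i - y l)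
      = (∏ i, ∏ j ∈ Finset.Ioi i, (y j - y i)) * ∏ i, ∏ j ∈ Finset.Ioi i, (y i - y j) := by
  have h (i : Fin d) : ∏ l ∈ Finset.univ.erase i, (y i - y l)
      = (∏ l ∈ Finset.Iio i, (y i - y l)) * ∏ l ∈ Finset.Ioi i, (y i - y l) := by
    rw [← Finset.prod_union]
    · congr 1
      ext l
      simp only [Finset.mem_erase, Finset.mem_univ, and_true, Finset.mem_union, Finset.mem_Iio,
        Finset.mem_Ioi]
      exact lt_or_lt_iff_ne.symm
    · rw [Finset.disjoint_left]
      intro l h1 h2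
      rw [Finset.mem_Iio] at h1
      rw [Finset.mem_Ioi] at h2
      exact lt_asymm h1 h2
  rw [Finset.prod_congr rfl fun i _ => h i, Finset.prod_mul_distrib]
  congr 1
  exact Finset.prod_comm' (by simp)

/-- Cauchy's determinant, with denominators cleared. -/
lemma cauchy_det [IsDomain R] (x y : Fin d → R) (hy : Function.Injective y) :
    (Matrix.of fun i j => ∏ l ∈ Finset.univ.erase j, (1 - x i * y l)).det
      = detPow x (stair d) * detPow y (stair d) := by
  set E : Matrix (Fin d) (Fin d) R := Matrix.of fun k j =>
    ∑ A ∈ (Finset.univ.erase j).powersetCard k, ∏ l ∈ Finset.univ.erase j \ A, -y l with hE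
  have key (a b : Fin d → R) :
      (Matrix.of fun i j => ∏ l ∈ Finset.univ.erase j, (a i - b i * y l))
        = (Matrix.of fun i k : Fin d => a i ^ (k : ℕ) * b i ^ stair d k) * E := by
    ext i j
    have hd : 0 < d := i.pos
    have hcard : (Finset.univ.erase j).card = d - 1 := by
      rw [Finset.card_erase_of_mem (Finset.mem_univ _), Finset.card_univ, Fintype.card_fin]
    rw [Matrix.of_apply, prod_sub_eq_sum_powersetCard, hcard, Matrix.mul_apply,
      Nat.sub_add_cancel hd, Finset.sum_range]
    rfl
  -- `E` depends on `y` only. The pair `(1, x)` gives the wanted determinant, while the pair `(y,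
  -- 1)` makes the left side diagonal and thereby evaluates `E.det`.
  have h1 := congrArg Matrix.det (key (fun _ => 1) x)
  have h2 := congrArg Matrix.det (key y (fun _ => 1))
  rw [Matrix.det_mul] at h1 h2
  simp only [one_pow, one_mul, mul_one] at h1 h2
  have h3 : (Matrix.of fun i j => ∏ l ∈ Finset.univ.erase j, (y i - y l))
      = Matrix.diagonal fun i => ∏ l ∈ Finset.univ.erase i, (y i - y l) := by
    ext i j
    rw [Matrix.of_apply]
    by_cases hij : i = j
    · rw [hij, Matrix.diagonal_apply_eq]
    · rw [Matrix.diagonal_apply_ne _ hij]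
      exact Finset.prod_eq_zero (Finset.mem_erase.mpr ⟨hij, Finset.mem_univ _⟩) (sub_self _)
  have h4 := Matrix.det_vandermonde y
  rw [h3, Matrix.det_diagonal, prod_erase_sub_eq, ← h4, ← detPow_stair] at h2
  have h5 : (Matrix.vandermonde y).det ≠ 0 := Matrix.det_vandermonde_ne_zero_iff.mpr hy
  have h6 : detPow y (stair d) = E.det := mul_left_cancel₀ h5 h2
  rw [h1, h6]
  rfl

/-- The complete homogeneous symmetric polynomial, evaluated at `v`. -/
def hsum {ι : Type*} [Fintype ι] [DecidableEq ι] (v : ι → R) (n : ℕ) : R :=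
  ∑ k ∈ Finset.piAntidiag Finset.univ n, ∏ i, v i ^ k i

open PowerSeries in
lemma coeff_prod_geom {ι : Type*} [Fintype ι] [DecidableEq ι] (v : ι → R) (n : ℕ) :
    coeff n (∏ i, (mk fun k => v i ^ k : PowerSeries R)) = hsum v n := by
  rw [coeff_prod, hsum]
  refine Finset.sum_bij (fun k _ => (k : ι → ℕ)) ?_ ?_ ?_ ?_
  · intro k hk
    rw [Finset.mem_finsuppAntidiag] at hk
    simpa using hk.1
  · intro k _ k' _ h
    exact DFunLike.coe_injective h
  · intro k hk
    refine ⟨Finsupp.equivFunOnFinite.symm k, ?_, rfl⟩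
    rw [Finset.mem_finsuppAntidiag]
    exact ⟨by simpa using hk, Finset.subset_univ _⟩
  · intro k _
    exact Finset.prod_congr rfl fun i _ => by rw [coeff_mk]

open PowerSeries in
lemma geom_mul_one_sub (a : R) :
    (mk fun k => a ^ k : PowerSeries R) * (1 - C a * X) = 1 := by
  ext k
  rw [mul_sub, mul_one, map_sub, ← mul_assoc, mul_right_comm]
  cases k with
  | zero => simp
  | succ k => simp [coeff_one, pow_succ, mul_comm]

open PowerSeries in
/-- The Cauchy identity in degree `n`. -/
lemma cauchy_identity [IsDomain R] (x y : Fin d → R) (hy : Function.Injective y) (n : ℕ) :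
    hsum (fun p : Fin d × Fin d => x p.1 * y p.2) n * (detPow x (stair d) * detPow y (stair d))
      = ∑ k ∈ Finset.piAntidiag Finset.univ (n + ∑ j, stair d j),
          (∏ i, x i ^ k i) * detPow y k := by
  set G : Matrix (Fin d) (Fin d) (PowerSeries R) :=
    Matrix.of fun i j => mk fun k => (x i * y j) ^ k with hG
  have hinv (i j : Fin d) : G i j * (1 - C (x i) * X * C (y j)) = 1 := by
    have := geom_mul_one_sub (x i * y j)
    rw [map_mul, mul_right_comm] at this
    exact this
  have h1 := cauchy_det (fun i => C (x i) * X) (fun j => C (y j))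
    (fun a b h => hy (C_injective h))
  -- Attaching the series variable to `x` lets coefficient extraction select one degree; the price
  -- is a shift by the degree of the Vandermonde determinant.
  have h2 : detPow (fun i => C (x i) * X) (stair d)
      = X ^ (∑ j, stair d j) * C (detPow x (stair d)) := by
    rw [detPow, detPow, RingHom.map_det, ← Finset.prod_pow_eq_pow_sum, ← Matrix.det_mul_row]
    congr 1
    ext1 i j
    simp [mul_pow, mul_comm]
  have h3 : detPow (fun j => C (y j)) (stair d) = C (detPow y (stair d)) := by
    rw [detPow, detPow, RingHom.map_det]
    congr 1
    ext1 i j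
    simp
  have h4 : (∏ i, ∏ l, (1 - C (x i) * X * C (y l))) * G.det
      = (Matrix.of fun i j => ∏ l ∈ Finset.univ.erase j, (1 - C (x i) * X * C (y l))).det := by
    rw [← Matrix.det_mul_column]
    congr 1
    ext1 i j
    rw [Matrix.of_apply, Matrix.of_apply, ← Finset.mul_prod_erase _ _ (Finset.mem_univ j),
      mul_right_comm, mul_comm _ (G i j), hinv, one_mul]
  have h5 : (∏ p : Fin d × Fin d, (mk fun k => (x p.1 * y p.2) ^ k : PowerSeries R))
      * ∏ i, ∏ l, (1 - C (x i) * X * C (y l)) = 1 := by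
    rw [← Fintype.prod_prod_type' (f := fun i l => (1 - C (x i) * X * C (y l))),
      ← Finset.prod_mul_distrib]
    exact Finset.prod_eq_one fun p _ => hinv p.1 p.2
  have h6 : (∏ p : Fin d × Fin d, (mk fun k => (x p.1 * y p.2) ^ k : PowerSeries R))
      * (C (detPow x (stair d) * detPow y (stair d)) * X ^ (∑ j, stair d j)) = G.det := by
    rw [map_mul, mul_right_comm (C _), mul_comm (C _), ← h2, ← h3, ← h1, ← h4, ← mul_assoc, h5,
      one_mul]
  have h7 := congrArg (coeff (n + ∑ j, stair d j)) h6
  rw [← mul_assoc, coeff_mul_X_pow, coeff_mul_C, coeff_prod_geom] at h7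
  rw [h7, ← Matrix.det_transpose, Matrix.det_apply, map_sum]
  -- Leibniz expansion of the determinant of geometric series: for each exponent vector of `x`, the
  -- signed sum over `σ` is an alternant in `y`.
  have h8 (σ : Equiv.Perm (Fin d)) : coeff (n + ∑ j, stair d j)
      (Equiv.Perm.sign σ • ∏ i, G.transpose (σ i) i)
      = ∑ k ∈ Finset.piAntidiag Finset.univ (n + ∑ j, stair d j),
          Equiv.Perm.sign σ • ((∏ i, x i ^ k i) * ∏ i, y (σ i) ^ k i) := by
    have : coeff (n + ∑ j, stair d j) (∏ i, G.transpose (σ i) i)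
        = hsum (fun i => x i * y (σ i)) (n + ∑ j, stair d j) := by
      rw [← coeff_prod_geom]
      rfl
    rw [Units.smul_def, map_zsmul, this, hsum, Finset.smul_sum]
    simp only [mul_pow, Finset.prod_mul_distrib, Units.smul_def]
  rw [Finset.sum_congr rfl fun σ _ => h8 σ, Finset.sum_comm]
  refine Finset.sum_congr rfl fun k _ => ?_
  rw [detPow, Matrix.det_apply, Finset.mul_sum]
  refine Finset.sum_congr rfl fun σ _ => ?_
  simp only [Units.smul_def, zsmul_eq_mul, Matrix.of_apply]
  ring

end Cauchy

/-! ### Averaging products of permutation traces -/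

section PermTrace

open Classical

variable {n d : ℕ} {R : Type*} [CommRing R]

/-- The trace of the permutation `g` times `diag(x)^{⊗n}` on the tensor power. -/
def permTrace (g : Equiv.Perm (Fin n)) (x : Fin d → R) : R :=
  ∑ a ∈ Finset.univ.filter (fun a : Idx n d => a ∘ g = a), ∏ i, x (a i)

/-- The power of a sum of variables is expanded once over words and once by the multinomial theorem;
the coefficients of one monomial are compared. -/
lemma card_filter_content {ι : Type*} [Fintype ι] [DecidableEq ι] {k : ι → ℕ}
    (hk : k ∈ Finset.piAntidiag Finset.univ n) :
    (Finset.univ.filter fun w : Fin n → ι => (fun i => (Finset.univ.filter fun a => w a = i).card) = k).card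
      * ∏ i, (k i).factorial = n.factorial := by
  have h := Finset.sum_pow_eq_sum_piAntidiag Finset.univ (fun i : ι => (MvPolynomial.X i : MvPolynomial ι ℕ)) n
  have hmon (k : ι → ℕ) : ∏ i, (MvPolynomial.X i : MvPolynomial ι ℕ) ^ k i
      = MvPolynomial.monomial (Finsupp.equivFunOnFinite.symm k) 1 := by
    rw [MvPolynomial.monomial_eq, Finsupp.prod_fintype _ _ (by simp)]
    simp
  have hleft : (∑ i : ι, (MvPolynomial.X i : MvPolynomial ι ℕ)) ^ n = ∑ w : Fin n → ι,
      ∏ i, (MvPolynomial.X i : MvPolynomial ι ℕ) ^ (Finset.univ.filter fun a => w a = i).card := by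
    rw [Fintype.sum_pow]
    refine Finset.sum_congr rfl fun w _ => ?_
    rw [← Finset.prod_fiberwise' Finset.univ w]
    simp
  rw [hleft] at h
  have h2 := congrArg (MvPolynomial.coeff (Finsupp.equivFunOnFinite.symm k)) h
  simp only [hmon, MvPolynomial.coeff_sum, MvPolynomial.coeff_monomial,
    EmbeddingLike.apply_eq_iff_eq, ← map_natCast (MvPolynomial.C : ℕ →+* MvPolynomial ι ℕ),
    MvPolynomial.coeff_C_mul] at h2
  simp only [mul_ite, mul_one, mul_zero, Finset.sum_ite_eq', hk, if_true, Finset.sum_boole,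
    Nat.cast_id] at h2
  rw [h2]
  have h3 := Nat.multinomial_spec Finset.univ k
  rw [mul_comm] at h3
  rw [h3]
  congr 1
  simpa using hk

lemma card_stabilizer {ι : Type*} [Fintype ι] [DecidableEq ι] (w : Fin n → ι) :
    (Finset.univ.filter fun g : Equiv.Perm (Fin n) => w ∘ g = w).card
      = ∏ i, (Finset.univ.filter fun a => w a = i).card.factorial := by
  have h := DomMulAct.stabilizer_card w
  rw [Fintype.card_subtype] at h
  simp only [Fintype.card_subtype] at h
  convert h

/-- A pair of words is one word in the alphabet of pairs. After exchanging the sums, the stabilizer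
of a word has order the product of the factorials of its content, and multiplying by the number of
words with that content always gives `n!`. -/
lemma sum_permTrace_mul (x y : Fin d → R) :
    ∑ g : Equiv.Perm (Fin n), permTrace g x * permTrace g y
      = (n.factorial : R) * hsum (fun p : Fin d × Fin d => x p.1 * y p.2) n := by
  have h1 (g : Equiv.Perm (Fin n)) : permTrace g x * permTrace g y
      = ∑ w : Fin n → Fin d × Fin d, if w ∘ g = w then ∏ i, (x (w i).1 * y (w i).2) else 0 := by
    rw [permTrace, permTrace, Finset.sum_mul_sum, Finset.sum_filter]
    simp only [Finset.sum_filter, ← Finset.prod_mul_distrib]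
    rw [← Equiv.sum_comp (Equiv.arrowProdEquivProdArrow (Fin n) (fun _ => Fin d) (fun _ => Fin d)).symm,
      Fintype.sum_prod_type]
    refine Finset.sum_congr rfl fun a _ => ?_
    by_cases ha : a ∘ g = a
    · rw [if_pos ha]
      refine Finset.sum_congr rfl fun b _ => ?_
      congr 1
      refine propext ⟨fun hb => funext fun i => Prod.ext (congrFun ha i) (congrFun hb i), fun h => ?_⟩
      exact funext fun i => congrArg Prod.snd (congrFun h i)
    · rw [if_neg ha]
      symm
      refine Finset.sum_eq_zero fun b _ => if_neg fun h => ha ?_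
      exact funext fun i => congrArg Prod.fst (congrFun h i)
  have h2 (w : Fin n → Fin d × Fin d) :
      ∑ g : Equiv.Perm (Fin n), (if w ∘ g = w then ∏ i, (x (w i).1 * y (w i).2) else 0)
      = ∏ p, (((Finset.univ.filter fun a => w a = p).card.factorial : R) *
          (x p.1 * y p.2) ^ (Finset.univ.filter fun a => w a = p).card) := by
    rw [← Finset.sum_filter, Finset.sum_const, card_stabilizer, nsmul_eq_mul, Nat.cast_prod]
    conv_rhs => rw [Finset.prod_mul_distrib]
    congr 1
    rw [← Finset.prod_fiberwise' Finset.univ w (fun p => x p.1 * y p.2)]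
    simp
  rw [Finset.sum_congr rfl fun g _ => h1 g, Finset.sum_comm, Finset.sum_congr rfl fun w _ => h2 w, hsum,
    Finset.mul_sum, ← Finset.sum_fiberwise_of_maps_to
      (g := fun (w : Fin n → Fin d × Fin d) p => (Finset.univ.filter fun a => w a = p).card)
      (t := Finset.piAntidiag Finset.univ n)]
  · refine Finset.sum_congr rfl fun k hk => ?_
    rw [← card_filter_content hk]
    have h3 : ∀ w ∈ Finset.univ.filter (fun w : Fin n → Fin d × Fin d =>
        (fun p => (Finset.univ.filter fun a => w a = p).card) = k),
        ∏ p, (((Finset.univ.filter fun a => w a = p).card.factorial : R) *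
          (x p.1 * y p.2) ^ (Finset.univ.filter fun a => w a = p).card)
        = (∏ p, ((k p).factorial : R)) * ∏ p, (x p.1 * y p.2) ^ k p := by
      intro w hw
      have hw' := (Finset.mem_filter.mp hw).2
      rw [Finset.prod_mul_distrib, ← hw']
    rw [Finset.sum_congr rfl h3, Finset.sum_const, nsmul_eq_mul]
    push_cast
    ring
  · intro w _
    simp only [Finset.mem_piAntidiag, Finset.mem_univ, implies_true, and_true]
    rw [← Finset.card_eq_sum_card_fiberwise (f := w) (by simp)]
    simp

end PermTrace
end QDF
end

noncomputable section
namespace QDF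

/-! ### Frobenius' character formula -/

section Characters

open MvPolynomial Classical

variable {n d : ℕ} {m : YoungDiag n d}

/-- Exponent vectors as finitely supported functions. -/
abbrev expo (e : Fin d → ℕ) : Fin d →₀ ℕ := Finsupp.equivFunOnFinite.symm e

lemma expo_inj {e f : Fin d → ℕ} : expo e = expo f ↔ e = f := EmbeddingLike.apply_eq_iff_eq _

variable (m) in
/-- The shifted row lengths `m_j + d - j`. -/
def shifted (j : Fin d) : ℕ := m.1 j + stair d j

lemma stair_strictAnti : StrictAnti (stair d) := fun i j h => by
  have _hj := j.2
  have _hi := i.2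
  have : (i : ℕ) < j := h
  simp only [stair]
  omega

lemma shifted_strictAnti : StrictAnti (shifted m) := fun _ _ h =>
  add_lt_add_of_le_of_lt (m.2.1 h.le) (stair_strictAnti h)

lemma sum_shifted : ∑ j, shifted m j = n + ∑ j, stair d j := by
  simp only [shifted, Finset.sum_add_distrib, m.2.2]

lemma alternant_eq_detPow (e : Fin d → ℕ) : alternant e = detPow X e := rfl

lemma prod_X_pow_eq (e : Fin d → ℕ) {R : Type*} [CommSemiring R] :
    ∏ i, (X i : MvPolynomial (Fin d) R) ^ e i = monomial (expo e) 1 := by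
  rw [monomial_eq, Finsupp.prod_fintype _ _ (by simp)]
  simp

lemma alternant_eq_sum (e : Fin d → ℕ) :
    alternant e = ∑ σ : Equiv.Perm (Fin d), C ((Equiv.Perm.sign σ : ℤ) : ℝ) * monomial (expo (e ∘ σ)) 1 := by
  rw [alternant, ← Matrix.det_transpose, Matrix.det_apply]
  refine Finset.sum_congr rfl fun σ _ => ?_
  rw [Units.smul_def, zsmul_eq_mul, ← prod_X_pow_eq]
  congr 1

lemma coeff_alternant (e f : Fin d → ℕ) :
    coeff (expo f) (alternant e) =
      ∑ σ : Equiv.Perm (Fin d), if e ∘ σ = f then ((Equiv.Perm.sign σ : ℤ) : ℝ) else 0 := by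
  rw [alternant_eq_sum, coeff_sum]
  refine Finset.sum_congr rfl fun σ _ => ?_
  rw [coeff_C_mul, coeff_monomial]
  simp only [expo_inj, mul_ite, mul_one, mul_zero]

lemma eq_one_of_strictAnti {e f : Fin d → ℕ} (he : StrictAnti e) (hf : StrictAnti f)
    {σ : Equiv.Perm (Fin d)} (h : e ∘ σ = f) : σ = 1 := by
  have hσ : StrictMono σ := fun i j hij => by
    have h1 := hf hij
    rw [← h] at h1
    exact he.lt_iff_gt.mp h1
  have := (StrictMono.range_inj hσ strictMono_id).mp (by simp)
  exact Equiv.ext fun i => congrFun this i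

lemma shifted_injective {m' : YoungDiag n d} (h : shifted m = shifted m') : m = m' := by
  ext j
  have := congrFun h j
  simpa [shifted] using this

/-- An alternant contains exactly one monomial with strictly decreasing exponents, so these
monomials separate the shapes. -/
lemma coeff_alternant_shifted (m m' : YoungDiag n d) :
    coeff (expo (shifted m')) (alternant (shifted m)) = if m = m' then 1 else 0 := by
  rw [coeff_alternant, Finset.sum_eq_single 1]
  · by_cases h : m = m'
    · subst h; simp
    · rw [if_neg h, if_neg fun h1 => h (shifted_injective (by simpa using h1))]
  · intro σ _ hσ
    exact if_neg fun h => hσ (eq_one_of_strictAnti shifted_strictAnti shifted_strictAnti h)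
  · simp

lemma alternant_stair_ne_zero : alternant (stair d) ≠ 0 := by
  rw [alternant_eq_detPow, detPow_stair]
  refine Finset.prod_ne_zero_iff.mpr fun i _ => Finset.prod_ne_zero_iff.mpr fun j hj => ?_
  rw [sub_ne_zero]
  exact fun h => (Finset.mem_Ioi.mp hj).ne (X_injective h)

/-- The power sum of cycle type `g` times the Vandermonde determinant. -/
def altTrace (d : ℕ) (g : Equiv.Perm (Fin n)) : MvPolynomial (Fin d) ℝ :=
  alternant (stair d) * permTrace g X

variable (m) in
/-- The coefficient of the alternant of shape `m` in `altTrace`. -/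
def frobenius (g : Equiv.Perm (Fin n)) : ℝ := coeff (expo (shifted m)) (altTrace d g)

lemma permTrace_map {R S : Type*} [CommRing R] [CommRing S] (f : R →+* S) (g : Equiv.Perm (Fin n))
    (x : Fin d → R) : f (permTrace g x) = permTrace g (f ∘ x) := by
  simp [permTrace, map_sum, map_prod]

lemma detPow_map {R S : Type*} [CommRing R] [CommRing S] (f : R →+* S) (x : Fin d → R)
    (e : Fin d → ℕ) : f (detPow x e) = detPow (f ∘ x) e := by
  rw [detPow, detPow, RingHom.map_det]
  congr 1
  ext i j
  simp

/-- Cauchy's identity in two sets of variables, with `x` placed in the coefficient ring so that the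
coefficient at `shifted m` is taken in `y` only. On the right just the rearrangements of `shifted m`
survive, and they rebuild the alternant in `x`. -/
lemma sum_frobenius_mul_altTrace :
    ∑ g, C (frobenius m g) * altTrace d g = (n.factorial : MvPolynomial (Fin d) ℝ) * alternant (shifted m) := by
  set c : ℝ →+* MvPolynomial (Fin d) ℝ := C
  set x : Fin d → MvPolynomial (Fin d) (MvPolynomial (Fin d) ℝ) := fun i => C (X i) with hx
  set y : Fin d → MvPolynomial (Fin d) (MvPolynomial (Fin d) ℝ) := fun i => X i with hy
  have hpx (g : Equiv.Perm (Fin n)) : C (altTrace d g) = detPow x (stair d) * permTrace g x := by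
    rw [altTrace, map_mul, alternant_eq_detPow, detPow_map, permTrace_map]
    rfl
  have hay (e : Fin d → ℕ) : map c (alternant e) = detPow y e := by
    rw [alternant_eq_detPow, detPow_map]
    congr 1
    funext i
    exact map_X c i
  have hpy (g : Equiv.Perm (Fin n)) : map c (altTrace d g) = detPow y (stair d) * permTrace g y := by
    rw [altTrace, map_mul, hay, permTrace_map]
    congr 2
    funext i
    exact map_X c i
  have h1 : ∑ g : Equiv.Perm (Fin n), C (altTrace d g) * map c (altTrace d g)
      = (n.factorial : MvPolynomial (Fin d) (MvPolynomial (Fin d) ℝ)) *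
        ∑ k ∈ Finset.piAntidiag Finset.univ (n + ∑ j, stair d j),
          C (∏ i, (X i : MvPolynomial (Fin d) ℝ) ^ k i) * map c (alternant k) := by
    have h2 : ∑ k ∈ Finset.piAntidiag Finset.univ (n + ∑ j, stair d j),
          C (∏ i, (X i : MvPolynomial (Fin d) ℝ) ^ k i) * map c (alternant k)
        = ∑ k ∈ Finset.piAntidiag Finset.univ (n + ∑ j, stair d j),
          (∏ i, x i ^ k i) * detPow y k :=
      Finset.sum_congr rfl fun k _ => by rw [hay]; simp [hx]
    rw [h2, ← cauchy_identity x y X_injective, ← mul_assoc, ← sum_permTrace_mul, Finset.sum_mul]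
    refine Finset.sum_congr rfl fun g _ => ?_
    rw [hpx, hpy]
    ring
  have h3 := congrArg (coeff (expo (shifted m))) h1
  rw [coeff_sum, ← map_natCast (C : MvPolynomial (Fin d) ℝ →+* _), coeff_C_mul, coeff_sum] at h3
  simp only [coeff_C_mul, coeff_map] at h3
  have h4 : ∑ k ∈ Finset.piAntidiag Finset.univ (n + ∑ j, stair d j),
      (∏ i, (X i : MvPolynomial (Fin d) ℝ) ^ k i) * c (coeff (expo (shifted m)) (alternant k))
      = alternant (shifted m) := by
    simp only [coeff_alternant, map_sum, Finset.mul_sum]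
    rw [Finset.sum_comm, alternant_eq_sum, ← Equiv.sum_comp (Equiv.inv _)]
    refine Finset.sum_congr rfl fun σ _ => ?_
    rw [Finset.sum_eq_single (shifted m ∘ σ)]
    · rw [prod_X_pow_eq, if_pos, mul_comm]
      · simp [c]
      · funext i; simp
    · intro k _ hk
      rw [if_neg, map_zero, mul_zero]
      intro h
      refine hk ?_
      rw [← h]
      funext i
      simp
    · intro h
      refine absurd ?_ h
      simp only [Finset.mem_piAntidiag, Finset.mem_univ, implies_true, and_true]
      rw [← sum_shifted (m := m)]
      exact Equiv.sum_comp σ _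
  rw [h4] at h3
  rw [← h3]
  exact Finset.sum_congr rfl fun g _ => mul_comm _ _

/-- The orthogonality relations: a second coefficient extraction, now in the remaining variables. -/
lemma sum_frobenius_mul (m m' : YoungDiag n d) :
    ∑ g, frobenius m g * frobenius m' g = if m = m' then (n.factorial : ℝ) else 0 := by
  have h := congrArg (coeff (expo (shifted m'))) (sum_frobenius_mul_altTrace (m := m))
  rw [coeff_sum, ← map_natCast (C : ℝ →+* _), coeff_C_mul, coeff_alternant_shifted] at h
  simp only [coeff_C_mul, mul_ite, mul_one, mul_zero] at h
  exact h

lemma permTrace_X (g : Equiv.Perm (Fin n)) (μ : Fin d → ℕ) :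
    coeff (expo μ) (permTrace g X : MvPolynomial (Fin d) ℝ) = fixedCount d μ g := by
  have h (a : Idx n d) : ∏ i, (X (a i) : MvPolynomial (Fin d) ℝ) = monomial (expo (content a)) 1 := by
    rw [← prod_X_pow_eq, ← Finset.prod_fiberwise' Finset.univ a]
    simp [content]
  simp only [permTrace, h, coeff_sum, coeff_monomial, expo_inj]
  rw [Finset.sum_boole, Finset.filter_filter, fixedCount]

lemma frobenius_eq_sum (g : Equiv.Perm (Fin n)) : frobenius m g = ∑ σ : Equiv.Perm (Fin d),
    ((Equiv.Perm.sign σ : ℤ) : ℝ) * if expo (stair d ∘ σ) ≤ expo (shifted m)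
      then (fixedCount d (fun j => shifted m j - stair d (σ j)) g : ℝ) else 0 := by
  rw [frobenius, altTrace, alternant_eq_sum, Finset.sum_mul, coeff_sum]
  refine Finset.sum_congr rfl fun σ _ => ?_
  rw [mul_assoc, coeff_C_mul, coeff_monomial_mul', one_mul, ← permTrace_X]
  congr 3
  ext j
  simp

/-- Expanding the Vandermonde determinant, dominance kills every `σ ≠ 1`, and the remaining term is
the multiplicity one of the highest weight. -/
lemma sum_frobenius_mul_idemCoeff : ∑ g, frobenius m g * idemCoeff m g = 1 := by
  have h2 : ∑ g, frobenius m g * idemCoeff m g = ∑ σ : Equiv.Perm (Fin d),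
      ((Equiv.Perm.sign σ : ℤ) : ℝ) * if expo (stair d ∘ σ) ≤ expo (shifted m)
        then ∑ g, idemCoeff m g * (fixedCount d (fun j => shifted m j - stair d (σ j)) g : ℝ) else 0 := by
    simp only [frobenius_eq_sum, Finset.sum_mul]
    rw [Finset.sum_comm]
    refine Finset.sum_congr rfl fun σ _ => ?_
    split_ifs
    · rw [Finset.mul_sum]
      exact Finset.sum_congr rfl fun g _ => by ring
    · simp
  rw [h2, Finset.sum_eq_single 1]
  · have h3 : (fun j => shifted m j - stair d ((1 : Equiv.Perm (Fin d)) j)) = m.1 := by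
      funext j
      simp [shifted]
    rw [h3, sum_idemCoeff_fixedCount_self, if_pos]
    · simp
    · intro j
      simp [shifted]
  · intro σ _ hσ
    split_ifs with h4
    · rw [sum_idemCoeff_fixedCount_eq_zero hσ, mul_zero]
      intro j
      exact Nat.sub_add_cancel (h4 j)
    · exact mul_zero _
  · simp

lemma permTrace_conj {R : Type*} [CommRing R] (g h : Equiv.Perm (Fin n)) (x : Fin d → R) :
    permTrace (h⁻¹ * g * h) x = permTrace g x := by
  rw [permTrace, permTrace]
  refine Finset.sum_nbij' (fun a => a ∘ h.symm) (fun a => a ∘ h) ?_ ?_ ?_ ?_ ?_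
  · intro a ha
    have ha' := (Finset.mem_filter.mp ha).2
    refine Finset.mem_filter.mpr ⟨Finset.mem_univ _, ?_⟩
    funext k
    have h3 := congrFun ha' (h.symm k)
    simp only [Function.comp_apply, Equiv.Perm.mul_apply, Equiv.apply_symm_apply] at h3 ⊢
    exact h3
  · intro a ha
    have ha' := (Finset.mem_filter.mp ha).2
    refine Finset.mem_filter.mpr ⟨Finset.mem_univ _, ?_⟩
    funext k
    have h3 := congrFun ha' (h k)
    simp only [Function.comp_apply, Equiv.Perm.mul_apply] at h3 ⊢
    rw [← h3]
    exact congrArg a (h.apply_symm_apply _)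
  · intro a _
    funext k
    simp
  · intro a _
    funext k
    simp
  · intro a _
    exact (Equiv.prod_comp h.symm fun i => x (a i)).symm

/-- Against a class function each of the `n!` conjugates of the Young idempotent contributes the
same amount. -/
lemma sum_character_mul {M : Type*} [AddCommGroup M] [Module ℝ M] (f : Equiv.Perm (Fin n) → M)
    (hf : ∀ g h, f (h⁻¹ * g * h) = f g) :
    ∑ g, character m g • f g = (n.factorial : ℝ) • ∑ g, idemCoeff m g • f g := by
  simp only [character, Finset.sum_smul]
  rw [Finset.sum_comm]
  have h (h : Equiv.Perm (Fin n)) : ∑ g, idemCoeff m (h⁻¹ * g * h) • f g = ∑ g, idemCoeff m g • f g := by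
    rw [← Equiv.sum_comp (MulAut.conj h⁻¹).toEquiv fun g => idemCoeff m g • f g]
    refine Finset.sum_congr rfl fun g _ => ?_
    simp only [MulEquiv.toEquiv_eq_coe, EquivLike.coe_coe, MulAut.conj_apply, inv_inv, hf]
  rw [Finset.sum_congr rfl fun k _ => h k, Finset.sum_const, Finset.card_univ, Fintype.card_perm,
    Fintype.card_fin, Nat.cast_smul_eq_nsmul]

lemma altTrace_conj (g h : Equiv.Perm (Fin n)) : altTrace d (h⁻¹ * g * h) = altTrace d g := by
  rw [altTrace, altTrace, permTrace_conj]

/-- Frobenius' character formula. -/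
theorem frobenius_eq_character (g : Equiv.Perm (Fin n)) : frobenius m g = character m g := by
  have h1 : ∑ g, character m g * frobenius m g = n.factorial := by
    have := sum_character_mul (m := m) (frobenius m) (fun g h => by rw [frobenius, frobenius, altTrace_conj])
    simp only [smul_eq_mul] at this
    -- The inner product equals both squared norms, so the squared distance computed next is zero.
    rw [this, Finset.sum_congr rfl fun g _ => mul_comm _ _, sum_frobenius_mul_idemCoeff, mul_one]
  have h2 : ∑ g, (frobenius m g - character m g) ^ 2 = 0 := by
    have h3 (g : Equiv.Perm (Fin n)) : (frobenius m g - character m g) ^ 2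
        = frobenius m g * frobenius m g - 2 * (character m g * frobenius m g) + character m g ^ 2 := by
      ring
    rw [Finset.sum_congr rfl fun g _ => h3 g, Finset.sum_add_distrib, Finset.sum_sub_distrib,
      ← Finset.mul_sum, h1, sum_frobenius_mul, if_pos rfl, sum_character_sq]
    ring
  have h3 := (Finset.sum_eq_zero_iff_of_nonneg fun g _ => sq_nonneg _).mp h2 g (Finset.mem_univ g)
  exact sub_eq_zero.mp (pow_eq_zero_iff two_ne_zero |>.mp h3)

/-- The character of the Weyl module is the Schur polynomial. -/
theorem schurPoly_eq : schurPoly m.1 = ∑ g, C (idemCoeff m g) * permTrace g X := by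
  refine mul_left_cancel₀ (alternant_stair_ne_zero (d := d)) ?_
  have h1 := sum_frobenius_mul_altTrace (m := m)
  have h2 := sum_character_mul (m := m) (altTrace d) (fun g h => altTrace_conj g h)
  simp only [frobenius_eq_character] at h1
  simp only [smul_eq_C_mul, map_natCast] at h2
  rw [h1] at h2
  have h3 := mul_left_cancel₀ (Nat.cast_ne_zero.mpr n.factorial_ne_zero) h2
  have h4 : alternant (stair d) * schurPoly m.1 = alternant (shifted m) := (schurPoly_spec m.1).symm
  rw [h4, h3, Finset.mul_sum]
  refine Finset.sum_congr rfl fun g _ => ?_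
  rw [altTrace]
  ring

theorem schur_eq (t : Fin d → ℝ) : schur m.1 t = ∑ g, idemCoeff m g * permTrace g t := by
  rw [schur, schurPoly_eq, map_sum]
  refine Finset.sum_congr rfl fun g _ => ?_
  rw [map_mul, eval_C, permTrace_map]
  congr 2
  funext i
  simp

end Characters
end QDF
end

noncomputable section
namespace QDF

/-! ### Power sums expanded in Schur polynomials -/

section Expansion

open MvPolynomial Classical

variable {n d : ℕ} {m : YoungDiag n d}

lemma rename_detPow_X (σ : Equiv.Perm (Fin d)) (e : Fin d → ℕ) :
    rename σ (alternant e) = C ((Equiv.Perm.sign σ : ℤ) : ℝ) * alternant e := by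
  have h1 : rename σ (alternant e) = detPow (fun i => X (σ i)) e := by
    rw [alternant_eq_detPow]
    have := detPow_map (rename σ : MvPolynomial (Fin d) ℝ →ₐ[ℝ] _).toRingHom X e
    refine this.trans ?_
    congr 1
    funext i
    simp
  have h2 := Matrix.det_permute σ (Matrix.of fun i j => (X i : MvPolynomial (Fin d) ℝ) ^ e j)
  rw [h1, alternant, map_intCast]
  exact h2

lemma rename_permTrace (σ : Equiv.Perm (Fin d)) (g : Equiv.Perm (Fin n)) :
    rename σ (permTrace g X : MvPolynomial (Fin d) ℝ) = permTrace g X := by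
  have := permTrace_map (rename σ : MvPolynomial (Fin d) ℝ →ₐ[ℝ] _).toRingHom g X
  refine this.trans ?_
  rw [permTrace, permTrace]
  refine Finset.sum_nbij' (fun a => σ ∘ a) (fun a => σ.symm ∘ a) ?_ ?_ ?_ ?_ ?_
  · intro a ha
    have ha' := (Finset.mem_filter.mp ha).2
    refine Finset.mem_filter.mpr ⟨Finset.mem_univ _, ?_⟩
    rw [Function.comp_assoc, ha']
  · intro a ha
    have ha' := (Finset.mem_filter.mp ha).2
    refine Finset.mem_filter.mpr ⟨Finset.mem_univ _, ?_⟩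
    rw [Function.comp_assoc, ha']
  · intro a _
    funext k
    simp
  · intro a _
    funext k
    simp
  · intro a _
    simp

/-- An antisymmetric polynomial with no coefficient at a strictly decreasing exponent vanishes. -/
lemma eq_zero_of_antisymm {P : MvPolynomial (Fin d) ℝ}
    (hP : ∀ σ : Equiv.Perm (Fin d), rename σ P = C ((Equiv.Perm.sign σ : ℤ) : ℝ) * P)
    (h0 : ∀ e : Fin d → ℕ, StrictAnti e → coeff (expo e) P = 0) : P = 0 := by
  have key (σ : Equiv.Perm (Fin d)) (e : Fin d → ℕ) :
      coeff (expo (e ∘ σ)) P = ((Equiv.Perm.sign σ : ℤ) : ℝ) * coeff (expo e) P := by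
    rw [← coeff_C_mul, ← hP, ← coeff_rename_mapDomain σ σ.injective P]
    congr 1
    ext i
    obtain ⟨j, rfl⟩ := σ.surjective i
    rw [Finsupp.mapDomain_apply σ.injective]
    simp
  ext e
  obtain ⟨e, rfl⟩ := Finsupp.equivFunOnFinite.symm.surjective e
  rw [coeff_zero]
  -- Distinct exponents can be sorted into decreasing order at the cost of a sign. A repeated
  -- exponent is fixed by a transposition, so its coefficient equals its own negative.
  by_cases hinj : Function.Injective e
  · have hmono : StrictMono (e ∘ Tuple.sort e) :=
      (Tuple.monotone_sort e).strictMono_of_injective (hinj.comp (Tuple.sort e).injective)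
    have hanti : StrictAnti (e ∘ (Tuple.sort e * Fin.revPerm : Equiv.Perm (Fin d))) :=
      fun i j hij => hmono (Fin.rev_lt_rev.mpr hij)
    have h1 := h0 _ hanti
    rw [key] at h1
    refine (mul_eq_zero.mp h1).resolve_left ?_
    rcases Int.units_eq_one_or (Equiv.Perm.sign (Tuple.sort e * Fin.revPerm)) with h | h <;> simp [h]
  · simp only [Function.Injective, not_forall] at hinj
    obtain ⟨i, j, he, hij⟩ := hinj
    have h1 := key (Equiv.swap i j) e
    have h2 : e ∘ Equiv.swap i j = e := by
      funext x
      by_cases h1 : x = i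
      · simp [h1, he]
      · by_cases h2 : x = j
        · simp [h2, he]
        · simp [Equiv.swap_apply_of_ne_of_ne h1 h2]
    rw [h2, Equiv.Perm.sign_swap hij] at h1
    simp only [Units.val_neg, Units.val_one, Int.cast_neg, Int.cast_one] at h1
    change coeff (expo e) P = 0
    linarith

lemma isHomogeneous_alternant (e : Fin d → ℕ) : (alternant e).IsHomogeneous (∑ j, e j) := by
  rw [alternant_eq_sum]
  refine IsHomogeneous.sum _ _ _ fun σ _ => ?_
  rw [← zero_add (∑ j, e j)]
  refine (isHomogeneous_C _ _).mul (isHomogeneous_monomial _ ?_)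
  rw [Finsupp.degree_eq_sum]
  exact Equiv.sum_comp σ e

lemma isHomogeneous_permTrace (g : Equiv.Perm (Fin n)) :
    (permTrace g X : MvPolynomial (Fin d) ℝ).IsHomogeneous n := by
  refine IsHomogeneous.sum _ _ _ fun a _ => ?_
  have := IsHomogeneous.prod Finset.univ (fun i => (X (a i) : MvPolynomial (Fin d) ℝ)) (fun _ => 1)
    (fun i _ => isHomogeneous_X _ _)
  simpa using this

/-- Strict decrease forces `e` to dominate the staircase and to drop by at least one per step, so
subtracting the staircase leaves a partition. -/
lemma exists_shifted {e : Fin d → ℕ} (he : StrictAnti e) (hs : ∑ j, e j = n + ∑ j, stair d j) :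
    ∃ m : YoungDiag n d, e = shifted m := by
  have hge (k : ℕ) : ∀ j : Fin d, d - 1 - (j : ℕ) = k → k ≤ e j := by
    induction k with
    | zero => intro j _; exact Nat.zero_le _
    | succ k ih =>
      intro j hj
      have hlt : (j : ℕ) + 1 < d := by omega
      have h1 := ih ⟨j + 1, hlt⟩ (by simp only; omega)
      have h2 : e ⟨j + 1, hlt⟩ < e j := he (by rw [Fin.lt_def]; simp)
      omega
  have hst (j : Fin d) : stair d j ≤ e j := hge _ j rfl
  have hstep (k : ℕ) : ∀ i j : Fin d, (i : ℕ) + k = j → e j + k ≤ e i := by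
    induction k with
    | zero =>
      intro i j h
      rw [show i = j from Fin.ext h]
      exact le_rfl
    | succ k ih =>
      intro i j h
      have hlt : (i : ℕ) + 1 < d := by have := j.2; omega
      have h1 := ih ⟨i + 1, hlt⟩ j (by simp only; omega)
      have h2 : e ⟨i + 1, hlt⟩ < e i := he (by rw [Fin.lt_def]; simp)
      omega
  refine ⟨⟨fun j => e j - stair d j, fun i j hij => ?_, ?_⟩, ?_⟩
  · have h1 := hstep (j - i) i j (by have : (i : ℕ) ≤ j := hij; omega)
    have h2 := hst j
    have hij' : (i : ℕ) ≤ j := hij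
    have hj := j.2
    simp only [stair] at h2 ⊢
    omega
  · have h1 : ∑ j, (e j - stair d j) + ∑ j, stair d j = n + ∑ j, stair d j := by
      rw [← hs, ← Finset.sum_add_distrib]
      exact Finset.sum_congr rfl fun j _ => Nat.sub_add_cancel (hst j)
    exact Nat.add_right_cancel h1
  · funext j
    exact (Nat.sub_add_cancel (hst j)).symm

/-- The expansion of a product of power sums in alternants. -/
theorem altTrace_eq (g : Equiv.Perm (Fin n)) :
    altTrace d g = ∑ m : YoungDiag n d, C (character m g) * alternant (shifted m) := by
  rw [← sub_eq_zero]
  refine eq_zero_of_antisymm (fun σ => ?_) fun e he => ?_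
  · simp only [altTrace, map_sub, map_mul, map_sum, rename_detPow_X, rename_permTrace, rename_C,
      mul_sub, Finset.mul_sum]
    congr 1
    · ring
    · exact Finset.sum_congr rfl fun m _ => by ring
  · rw [coeff_sub, coeff_sum]
    simp only [coeff_C_mul]
    -- In the right degree the exponent is a shifted diagram and its coefficient is Frobenius'
    -- formula; in any other degree homogeneity makes both sides vanish.
    by_cases hs : ∑ j, e j = n + ∑ j, stair d j
    · obtain ⟨m, rfl⟩ := exists_shifted he hs
      simp only [coeff_alternant_shifted, mul_ite, mul_one, mul_zero, Finset.sum_ite_eq',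
        Finset.mem_univ, if_true]
      rw [← frobenius_eq_character, frobenius, sub_self]
    · have hdeg : (expo e).degree = ∑ j, e j := by
        rw [Finsupp.degree_eq_sum]
        rfl
      have h1 : (altTrace d g).IsHomogeneous (n + ∑ j, stair d j) := by
        rw [add_comm]
        exact (isHomogeneous_alternant _).mul (isHomogeneous_permTrace g)
      rw [h1.coeff_eq_zero (by rw [hdeg]; exact hs), zero_sub, neg_eq_zero]
      refine Finset.sum_eq_zero fun m _ => ?_
      rw [(isHomogeneous_alternant (shifted m)).coeff_eq_zero (by rw [hdeg, sum_shifted]; exact hs),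
        mul_zero]

theorem permTrace_eq (g : Equiv.Perm (Fin n)) (t : Fin d → ℝ) :
    permTrace g t = ∑ m : YoungDiag n d, character m g * schur m.1 t := by
  have h1 : (permTrace g X : MvPolynomial (Fin d) ℝ)
      = ∑ m : YoungDiag n d, C (character m g) * schurPoly m.1 := by
    refine mul_left_cancel₀ (alternant_stair_ne_zero (d := d)) ?_
    rw [← altTrace, altTrace_eq, Finset.mul_sum]
    refine Finset.sum_congr rfl fun m _ => ?_
    have h4 : alternant (stair d) * schurPoly m.1 = alternant (shifted m) := (schurPoly_spec m.1).symm
    rw [← h4]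
    ring
  have h2 := congrArg (eval t) h1
  rw [permTrace_map, map_sum] at h2
  simp only [map_mul, eval_C] at h2
  rw [show (eval t : MvPolynomial (Fin d) ℝ →+* ℝ) ∘ X = t from funext fun i => eval_X i] at h2
  exact h2

end Expansion
end QDF
end

noncomputable section
namespace QDF

/-! ### Dimension formulas of Weyl and Frobenius -/

section Dimensions

open Classical

variable {n d : ℕ} {m : YoungDiag n d}

lemma detPow_mul_schur (t : Fin d → ℝ) :
    detPow t (stair d) * schur m.1 t = detPow t (shifted m) := by
  have h (e : Fin d → ℕ) : MvPolynomial.eval t (alternant e) = detPow t e := by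
    rw [alternant_eq_detPow, detPow_map]
    congr 1
    funext i
    simp
  have h1 := congrArg (MvPolynomial.eval t) (schurPoly_spec m.1)
  rw [map_mul] at h1
  exact ((congrArg (· * schur m.1 t) (h (stair d))).symm.trans h1.symm).trans (h (shifted m))

/-- On a geometric progression the alternant is a transposed Vandermonde determinant in the `q ^ e
j`, so it factors for every exponent vector. -/
lemma detPow_geom (q : ℝ) (e : Fin d → ℕ) :
    detPow (fun i : Fin d => q ^ (i : ℕ)) e = ∏ i, ∏ j ∈ Finset.Ioi i, (q ^ e j - q ^ e i) := by
  rw [← Matrix.det_vandermonde fun i => q ^ e i, ← Matrix.det_transpose, detPow]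
  congr 1
  ext i j
  simp [Matrix.vandermonde_apply, ← pow_mul, mul_comm]

lemma tendsto_prod_slope (e : Fin d → ℕ) :
    Filter.Tendsto (fun q : ℝ => ∏ i, ∏ j ∈ Finset.Ioi i, ((q ^ e j - q ^ e i) / (q - 1)))
      (nhdsWithin 1 {1}ᶜ) (nhds (∏ i, ∏ j ∈ Finset.Ioi i, ((e j : ℝ) - e i))) := by
  refine tendsto_finsetProd _ fun i _ => tendsto_finsetProd _ fun j _ => ?_
  have h : HasDerivAt (fun q : ℝ => q ^ e j - q ^ e i) ((e j : ℝ) - e i) 1 := by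
    have := (hasDerivAt_pow (e j) (1 : ℝ)).sub (hasDerivAt_pow (e i) (1 : ℝ))
    simpa using! this
  refine (hasDerivAt_iff_tendsto_slope.mp h).congr fun q => ?_
  rw [slope_def_field]
  simp

/-- At `t = (1, …, 1)` both alternants vanish. They are divided by the same power of `q - 1` on a
geometric progression, and `q → 1` is taken with the Schur polynomial continuous. -/
lemma prod_stair_mul_schur_one :
    (∏ i, ∏ j ∈ Finset.Ioi i, ((stair d j : ℝ) - stair d i)) * schur m.1 (fun _ => 1)
      = ∏ i, ∏ j ∈ Finset.Ioi i, ((shifted m j : ℝ) - shifted m i) := by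
  have hcont : Continuous fun q : ℝ => schur m.1 fun i : Fin d => q ^ (i : ℕ) := by
    simp only [schur]
    exact (MvPolynomial.continuous_eval _).comp (by fun_prop)
  have h1 : Filter.Tendsto (fun q : ℝ => schur m.1 fun i : Fin d => q ^ (i : ℕ))
      (nhdsWithin 1 {1}ᶜ) (nhds (schur m.1 fun _ => 1)) := by
    have := (hcont.tendsto 1).mono_left (nhdsWithin_le_nhds (s := {1}ᶜ))
    simpa using this
  refine tendsto_nhds_unique ((tendsto_prod_slope (stair d)).mul h1) ?_
  refine (tendsto_prod_slope (shifted m)).congr fun q => ?_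
  simp only [Finset.prod_div_distrib]
  rw [← detPow_geom, ← detPow_geom, ← detPow_mul_schur]
  ring

lemma prod_stair_sub (hd : 0 < d) :
    ∏ i, ∏ j ∈ Finset.Ioi i, ((stair d i : ℝ) - stair d j) = barnesG (d + 1) := by
  obtain ⟨k, rfl⟩ := Nat.exists_eq_succ_of_ne_zero hd.ne'
  have h := Matrix.det_vandermonde_id_eq_superFactorial (R := ℝ) k
  rw [Matrix.det_vandermonde] at h
  rw [barnesG, Nat.add_sub_cancel, Nat.prod_range_succ_factorial, ← h]
  refine Finset.prod_congr rfl fun i _ => Finset.prod_congr rfl fun j _ => ?_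
  have e (a : Fin k.succ) : ((k.succ - 1 - (a : ℕ) : ℕ) : ℝ) = k - a := by
    rw [Nat.succ_sub_one, Nat.cast_sub (Nat.lt_succ_iff.mp a.2)]
  simp only [stair, e]
  ring

lemma prod_neg_sub (e : Fin d → ℕ) :
    ∏ i, ∏ j ∈ Finset.Ioi i, ((e j : ℝ) - e i)
      = (∏ i : Fin d, ∏ _j ∈ Finset.Ioi i, (-1 : ℝ)) * ∏ i, ∏ j ∈ Finset.Ioi i, ((e i : ℝ) - e j) := by
  simp only [← Finset.prod_mul_distrib]
  exact Finset.prod_congr rfl fun i _ => Finset.prod_congr rfl fun j _ => by ring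

/-- Weyl's dimension formula. -/
theorem schur_one_mul_barnesG (hd : 0 < d) :
    schur m.1 (fun _ => 1) * barnesG (d + 1)
      = ∏ i, ∏ j ∈ Finset.Ioi i, ((shifted m i : ℝ) - shifted m j) := by
  have h := prod_stair_mul_schur_one (m := m)
  rw [prod_neg_sub, prod_neg_sub (shifted m), prod_stair_sub hd, mul_assoc] at h
  rw [mul_comm]
  refine mul_left_cancel₀ ?_ h
  exact Finset.prod_ne_zero_iff.mpr fun i _ => Finset.prod_ne_zero_iff.mpr fun j _ => by norm_num

lemma fixedCount_one_mul {μ : Fin d → ℕ} (hμ : ∑ j, μ j = n) :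
    fixedCount d μ (1 : Equiv.Perm (Fin n)) * ∏ j, (μ j).factorial = n.factorial := by
  rw [← card_filter_content (n := n) (k := μ) (by simpa using hμ), fixedCount]
  congr 2
  ext a
  simp only [Finset.mem_filter, Finset.mem_univ, true_and, Equiv.Perm.coe_one, Function.comp_id]
  constructor
  · exact fun h => by rw [← h]; rfl
  · exact fun h => by rw [← h]; rfl

lemma frobenius_one : frobenius m 1 = ∑ σ : Equiv.Perm (Fin d),
      ((Equiv.Perm.sign σ : ℤ) : ℝ) * if expo (stair d ∘ σ) ≤ expo (shifted m)
        then (fixedCount d (fun j => shifted m j - stair d (σ j)) (1 : Equiv.Perm (Fin n)) : ℝ) else 0 :=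
  frobenius_eq_sum 1

/-- The falling factorials are monic of degrees `0, …, d - 1`, so they may replace the powers in a
Vandermonde determinant. The reversals act on rows and columns alike and cost no sign. -/
lemma det_descFactorial (l : Fin d → ℕ) :
    (Matrix.of fun i j : Fin d => ((l j).descFactorial (stair d i) : ℝ)).det
      = ∏ i, ∏ j ∈ Finset.Ioi i, ((l i : ℝ) - l j) := by
  have h1 := Matrix.det_eval_matrixOfPolynomials_eq_det_vandermonde
    (fun i : Fin d => (l (Fin.rev i) : ℝ)) (fun j => descPochhammer ℝ j)
    (fun j => descPochhammer_natDegree ℝ j) (fun j => monic_descPochhammer ℝ j)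
  have hrev (i : Fin d) : stair d (Fin.rev i) = i := by
    simp only [stair, Fin.val_rev]
    omega
  have hrev' (i : Fin d) : stair d i = Fin.rev i := by
    simp only [stair, Fin.val_rev]
    omega
  have h2 : (Matrix.vandermonde fun i : Fin d => (l (Fin.rev i) : ℝ)).det
      = detPow (fun i => (l i : ℝ)) (stair d) := by
    rw [detPow, ← Matrix.det_submatrix_equiv_self Fin.revPerm]
    congr 1
    ext i j
    simp [Matrix.vandermonde_apply, hrev']
  rw [← detPow_stair, ← h2, h1, ← Matrix.det_transpose, ← Matrix.det_submatrix_equiv_self Fin.revPerm]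
  congr 1
  ext i j
  simp [descPochhammer_eval_eq_descFactorial, hrev]

/-- The hook length formula, in Frobenius' form. -/
theorem dimV_mul_prod_factorial :
    (dimV m : ℝ) * ∏ j, ((shifted m j).factorial : ℝ)
      = n.factorial * ∏ i, ∏ j ∈ Finset.Ioi i, ((shifted m i : ℝ) - shifted m j) := by
  rw [← character_one, ← frobenius_eq_character, frobenius_one, ← det_descFactorial, Matrix.det_apply,
    Finset.sum_mul, Finset.mul_sum]
  refine Finset.sum_congr rfl fun σ _ => ?_
  rw [Units.smul_def, zsmul_eq_mul, mul_assoc, mul_left_comm (n.factorial : ℝ)]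
  congr 1
  split_ifs with h
  · have hle (j : Fin d) : stair d (σ j) ≤ shifted m j := h j
    have h1 : ∑ j, (shifted m j - stair d (σ j)) = n := by
      have h2 : ∑ j, (shifted m j - stair d (σ j)) + ∑ j, stair d (σ j) = n + ∑ j, stair d (σ j) := by
        rw [← Finset.sum_add_distrib, Equiv.sum_comp σ (stair d), ← sum_shifted (m := m)]
        exact Finset.sum_congr rfl fun j _ => Nat.sub_add_cancel (hle j)
      exact Nat.add_right_cancel h2
    have h3 : ∏ j, ((shifted m j).factorial : ℝ)
        = (∏ j, ((shifted m j - stair d (σ j)).factorial : ℝ)) *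
          ∏ j, ((shifted m j).descFactorial (stair d (σ j)) : ℝ) := by
      rw [← Finset.prod_mul_distrib]
      refine Finset.prod_congr rfl fun j _ => ?_
      rw [← Nat.cast_mul, Nat.factorial_mul_descFactorial (hle j)]
    rw [h3, ← mul_assoc]
    have h4 := fixedCount_one_mul h1
    have h5 : (fixedCount d (fun j => shifted m j - stair d (σ j)) (1 : Equiv.Perm (Fin n)) : ℝ)
        * ∏ j, ((shifted m j - stair d (σ j)).factorial : ℝ) = n.factorial := by
      exact_mod_cast h4
    rw [h5]
    rfl
  -- For such `σ` the Frobenius sum has no term, and the determinant term contains a falling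
  -- factorial that vanishes.
  · have : ∃ j, shifted m j < stair d (σ j) := by
      by_contra hcon
      push Not at hcon
      exact h fun j => hcon j
    obtain ⟨j, hj⟩ := this
    rw [zero_mul, eq_comm, mul_eq_zero]
    refine Or.inr (Finset.prod_eq_zero (Finset.mem_univ j) ?_)
    rw [Matrix.of_apply, Nat.descFactorial_eq_zero_iff_lt.mpr hj, Nat.cast_zero]

/-- The product of the differences of shifted row lengths occurs in both dimension formulas and
cancels. -/
lemma schur_one_div_dimV (hd : 0 < d) :
    schur m.1 (fun _ => 1) / dimV m
      = (∏ j, ((shifted m j).factorial : ℝ)) / (n.factorial * barnesG (d + 1)) := by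
  have h1 := schur_one_mul_barnesG (m := m) hd
  have h2 := dimV_mul_prod_factorial (m := m)
  have h3 : (dimV m : ℝ) ≠ 0 := Nat.cast_ne_zero.mpr dimV_pos.ne'
  have h4 : (barnesG (d + 1) : ℝ) ≠ 0 :=
    Nat.cast_ne_zero.mpr (Finset.prod_ne_zero_iff.mpr fun i _ => i.factorial_ne_zero)
  have h5 : (n.factorial : ℝ) ≠ 0 := Nat.cast_ne_zero.mpr n.factorial_ne_zero
  rw [div_eq_div_iff h3 (mul_ne_zero h5 h4), mul_comm _ (dimV m : ℝ), h2, ← h1]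
  ring

end Dimensions

/-! ### Stirling estimates for the prefactor -/

section Prefactor

variable {n d : ℕ} {m : YoungDiag n d}

lemma factorial_add_le (a k N : ℕ) (h : a + k ≤ N) : (a + k).factorial ≤ a.factorial * N ^ k := by
  induction k with
  | zero => simp
  | succ k ih =>
    rw [← add_assoc, Nat.factorial_succ, pow_succ, ← mul_assoc, mul_comm]
    exact Nat.mul_le_mul (ih (by omega)) (by omega)

/-- The Stirling sequence decreases from its value `e / √2` at `1`; this is that inequality squared.
-/
lemma factorial_sq_le {k : ℕ} (hk : k ≠ 0) :
    ((k.factorial : ℝ) * Real.exp k / (k : ℝ) ^ k) ^ 2 ≤ Real.exp 2 * k := by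
  obtain ⟨j, rfl⟩ := Nat.exists_eq_succ_of_ne_zero hk
  have h : Stirling.stirlingSeq (j + 1) ≤ Real.exp 1 / √2 := by
    rw [← Stirling.stirlingSeq_one]
    exact Stirling.stirlingSeq'_antitone (Nat.zero_le j)
  rw [Stirling.stirlingSeq] at h
  set x : ℝ := ((j + 1 : ℕ) : ℝ) with hx
  have hx0 : 0 < x := by positivity
  have h0 : 0 ≤ ((j + 1).factorial : ℝ) / (√(2 * x) * (x / Real.exp 1) ^ (j + 1)) := by positivity
  have h2 := pow_le_pow_left₀ h0 h 2
  have e1 : Real.exp x = Real.exp 1 ^ (j + 1) := by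
    rw [← Real.exp_nat_mul, mul_one]
  have e2 : Real.exp 2 = Real.exp 1 ^ 2 := by
    rw [← Real.exp_nat_mul, mul_one, Nat.cast_ofNat]
  rw [div_pow, mul_pow, Real.sq_sqrt (by positivity), div_pow _ √2, Real.sq_sqrt (by norm_num),
    div_le_div_iff₀ (by positivity) (by norm_num), div_pow] at h2
  rw [Nat.succ_eq_add_one, e1, e2, div_pow, mul_pow, div_le_iff₀ (by positivity)]
  have hE : 0 < (Real.exp 1 ^ (j + 1)) ^ 2 := by positivity
  have h3 : Real.exp 1 ^ 2 * (2 * x * ((x ^ (j + 1) / Real.exp 1 ^ (j + 1)) ^ 2))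
      = 2 * ((Real.exp 1 ^ 2 * x * (x ^ (j + 1)) ^ 2) / (Real.exp 1 ^ (j + 1)) ^ 2) := by
    field_simp
  rw [h3, mul_comm, mul_le_mul_iff_right₀ (by norm_num), le_div_iff₀ hE] at h2
  exact h2

lemma prod_le_arith_mean_pow (x : Fin d → ℝ) (hx : ∀ i, 0 ≤ x i) (hd : 0 < d) :
    ∏ i, x i ≤ ((∑ i, x i) / d) ^ d := by
  have hd' : (0 : ℝ) < d := Nat.cast_pos.mpr hd
  have h := Real.geom_mean_le_arith_mean Finset.univ (fun _ => (1 : ℝ)) x (fun _ _ => zero_le_one)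
    (by simpa using hd) (fun i _ => hx i)
  simp only [Real.rpow_one, Finset.sum_const, Finset.card_univ, Fintype.card_fin, nsmul_eq_mul,
    mul_one, one_mul] at h
  have hp : 0 ≤ ∏ i, x i := Finset.prod_nonneg fun i _ => hx i
  have h2 := pow_le_pow_left₀ (Real.rpow_nonneg hp _) h d
  rwa [Real.rpow_inv_natCast_pow hp hd.ne'] at h2

lemma sum_stair (hd : 0 < d) : 2 * ∑ j, stair d j + d = d ^ 2 := by
  have h : ∑ j : Fin d, stair d j = ∑ j ∈ Finset.range d, j := by
    rw [← Finset.sum_range_reflect, Finset.sum_range]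
    rfl
  have h2 := Finset.sum_range_id_mul_two d
  obtain ⟨k, rfl⟩ := Nat.exists_eq_succ_of_ne_zero hd.ne'
  rw [h, mul_comm, h2, Nat.succ_sub_one, Nat.succ_eq_add_one]
  ring

/-- The product of the Stirling defects of the rows. -/
lemma prod_stirling_sq_le (hd : 0 < d) (hn : 0 < n) :
    (∏ j, ((m.1 j).factorial : ℝ) * Real.exp (m.1 j) / (m.1 j : ℝ) ^ m.1 j) ^ 2
      ≤ n * ((n : ℝ) + d - 1) ^ (d - 1) * Real.exp 2 ^ d / (d : ℝ) ^ d := by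
  classical
  -- An empty row contributes exactly `1 = e² · e⁻² · 1`. It enters the mean inequality with `1` in
  -- place of its length, and its spare factor `e⁻²` is kept for later; `z < d` because `n > 0`.
  set z := (Finset.univ.filter fun j => m.1 j = 0).card with hz
  have hzd : z + 1 ≤ d := by
    have hlt : z < (Finset.univ : Finset (Fin d)).card := by
      refine Finset.card_lt_card ⟨Finset.subset_univ _, fun h => ?_⟩
      have h0 : ∑ j, m.1 j = 0 := Finset.sum_eq_zero fun j hj => (Finset.mem_filter.mp (h hj)).2
      rw [m.2.2] at h0
      omega
    simpa using hlt
  have hle (j : Fin d) : (((m.1 j).factorial : ℝ) * Real.exp (m.1 j) / (m.1 j : ℝ) ^ m.1 j) ^ 2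
      ≤ Real.exp 2 * (if m.1 j = 0 then (Real.exp 2)⁻¹ else 1) * (m.1 j + if m.1 j = 0 then 1 else 0) := by
    by_cases h : m.1 j = 0
    · rw [h]
      have := Real.exp_ne_zero 2
      simp [this]
    · rw [if_neg h, if_neg h, mul_one, add_zero]
      exact factorial_sq_le h
  have hx : ∏ j, ((m.1 j : ℝ) + if m.1 j = 0 then 1 else 0) ≤ (((n : ℝ) + z) / d) ^ d := by
    have hs : ∑ j, ((m.1 j : ℝ) + if m.1 j = 0 then 1 else 0) = n + z := by
      rw [Finset.sum_add_distrib, Finset.sum_boole, ← Nat.cast_sum, m.2.2]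
    rw [← hs]
    exact prod_le_arith_mean_pow _ (fun j => by positivity) hd
  have hn1 : (1 : ℝ) ≤ n := Nat.one_le_cast.mpr hn
  have hz1 : (z : ℝ) + 1 ≤ d := by exact_mod_cast hzd
  have hz0 : (0 : ℝ) ≤ z := Nat.cast_nonneg z
  -- The saved factors `e⁻²` pay for replacing one factor `n + z` by `n`; the other `d - 1` factors
  -- are at most `n + d - 1`.
  have hexp : (n : ℝ) + z ≤ n * Real.exp 2 ^ z := by
    have h1 : (z : ℝ) + 1 ≤ Real.exp 2 ^ z := by
      rw [← Real.exp_nat_mul]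
      refine (Real.add_one_le_exp (z : ℝ)).trans (Real.exp_le_exp.mpr (by linarith))
    nlinarith
  have hpow : ((n : ℝ) + z) ^ d ≤ n * Real.exp 2 ^ z * ((n : ℝ) + d - 1) ^ (d - 1) := by
    obtain ⟨k, rfl⟩ := Nat.exists_eq_succ_of_ne_zero hd.ne'
    rw [Nat.succ_eq_add_one, pow_succ', Nat.add_sub_cancel]
    refine mul_le_mul hexp (pow_le_pow_left₀ (by positivity) (by linarith) _) (by positivity)
      (by positivity)
  rw [← Finset.prod_pow]
  refine (Finset.prod_le_prod (fun j _ => sq_nonneg _) fun j _ => hle j).trans ?_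
  rw [Finset.prod_mul_distrib, Finset.prod_mul_distrib, Finset.prod_const, Finset.prod_ite,
    Finset.prod_const, Finset.prod_const_one, mul_one, Finset.card_univ, Fintype.card_fin, ← hz]
  calc Real.exp 2 ^ d * (Real.exp 2)⁻¹ ^ z * ∏ j, ((m.1 j : ℝ) + if m.1 j = 0 then 1 else 0)
      ≤ Real.exp 2 ^ d * (Real.exp 2)⁻¹ ^ z * (((n : ℝ) + z) / d) ^ d := by gcongr
    _ ≤ Real.exp 2 ^ d * (Real.exp 2)⁻¹ ^ z *
        (n * Real.exp 2 ^ z * ((n : ℝ) + d - 1) ^ (d - 1) / (d : ℝ) ^ d) := by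
        rw [div_pow]
        gcongr
    _ = _ := by
        rw [inv_pow]
        have := (Real.exp_pos 2).ne'
        field_simp

/-- Shifting a row by the staircase costs at most that many factors `N = n + d - 1`. The row
factorials are bounded above and `n!` below by Stirling, and the factor `√n` cancels between them.
-/
lemma prefactor_le (hd : 0 < d) (hn : 0 < n) :
    (∏ j, ((shifted m j).factorial : ℝ)) / (n.factorial * barnesG (d + 1))
      / ∏ j, ((m.1 j : ℝ) / n) ^ m.1 j ≤ fq n d := by
  set N : ℝ := (n : ℝ) + d - 1 with hN
  have hn0 : (0 : ℝ) < n := Nat.cast_pos.mpr hn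
  have hd1 : (1 : ℝ) ≤ d := Nat.one_le_cast.mpr hd
  have hN0 : 0 < N := by linarith
  have hB : (0 : ℝ) < barnesG (d + 1) := Nat.cast_pos.mpr
    (Finset.prod_pos fun i _ => i.factorial_pos)
  set T := ∑ j, stair d j with hT
  set P := ∏ j, ((m.1 j).factorial : ℝ) * Real.exp (m.1 j) / (m.1 j : ℝ) ^ m.1 j with hP
  have hPle : P ≤ √(n * N ^ (d - 1) * Real.exp 2 ^ d / (d : ℝ) ^ d) :=
    Real.le_sqrt_of_sq_le (prod_stirling_sq_le hd hn)
  have hP0 : 0 ≤ P := Finset.prod_nonneg fun j _ => by positivity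
  have hmm (j : Fin d) : (0 : ℝ) < (m.1 j : ℝ) ^ m.1 j := by
    rcases Nat.eq_zero_or_pos (m.1 j) with h | h
    · rw [h]; simp
    · positivity
  have h1 : ∏ j, ((shifted m j).factorial : ℝ) ≤ (∏ j, ((m.1 j).factorial : ℝ)) * N ^ T := by
    rw [hT, ← Finset.prod_pow_eq_pow_sum, ← Finset.prod_mul_distrib]
    refine Finset.prod_le_prod (fun j _ => by positivity) fun j _ => ?_
    have hm : m.1 j ≤ n :=
      (Finset.single_le_sum (f := m.1) (fun _ _ => Nat.zero_le _) (Finset.mem_univ j)).trans_eq m.2.2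
    have := factorial_add_le (m.1 j) (stair d j) (n + d - 1) (by
      simp only [stair]
      omega)
    have hcast : ((n + d - 1 : ℕ) : ℝ) = N := by
      rw [Nat.cast_sub (by omega)]
      push_cast
      rfl
    rw [← hcast]
    exact_mod_cast this
  have hfac : √(2 * Real.pi * n) * n ^ n ≤ n.factorial * Real.exp n := by
    have := Stirling.le_factorial_stirling n
    rw [div_pow, ← Real.exp_nat_mul, mul_one, ← mul_div_assoc, div_le_iff₀ (Real.exp_pos _)] at this
    exact this
  have hs0 : 0 < √(2 * Real.pi * n) := by positivity
  have hlhs : (∏ j, ((shifted m j).factorial : ℝ)) / (n.factorial * barnesG (d + 1))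
      / ∏ j, ((m.1 j : ℝ) / n) ^ m.1 j ≤ N ^ T * P / (√(2 * Real.pi * n) * barnesG (d + 1)) := by
    have hprod : ∏ j, ((m.1 j : ℝ) / n) ^ m.1 j = (∏ j, (m.1 j : ℝ) ^ m.1 j) / (n : ℝ) ^ n := by
      simp only [div_pow]
      rw [Finset.prod_div_distrib, Finset.prod_pow_eq_pow_sum, m.2.2]
    have hPe : P = (∏ j, ((m.1 j).factorial : ℝ)) * Real.exp n / ∏ j, (m.1 j : ℝ) ^ m.1 j := by
      rw [hP, Finset.prod_div_distrib, Finset.prod_mul_distrib, ← Real.exp_sum, ← Nat.cast_sum, m.2.2]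
    have hM : 0 < ∏ j, (m.1 j : ℝ) ^ m.1 j := Finset.prod_pos fun j _ => hmm j
    have hnf : (0 : ℝ) < n.factorial := Nat.cast_pos.mpr n.factorial_pos
    have hM1 : (0 : ℝ) ≤ ∏ j, ((m.1 j).factorial : ℝ) := by positivity
    rw [hprod, hPe]
    calc (∏ j, ((shifted m j).factorial : ℝ)) / (n.factorial * barnesG (d + 1))
          / ((∏ j, (m.1 j : ℝ) ^ m.1 j) / (n : ℝ) ^ n)
        = (∏ j, ((shifted m j).factorial : ℝ)) * (n : ℝ) ^ n /
          (n.factorial * barnesG (d + 1) * ∏ j, (m.1 j : ℝ) ^ m.1 j) := by field_simp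
      _ ≤ ((∏ j, ((m.1 j).factorial : ℝ)) * N ^ T) * (n.factorial * Real.exp n / √(2 * Real.pi * n)) /
          (n.factorial * barnesG (d + 1) * ∏ j, (m.1 j : ℝ) ^ m.1 j) := by
          gcongr
          rw [le_div_iff₀ hs0, mul_comm]
          exact hfac
      _ = _ := by field_simp
  refine hlhs.trans ?_
  have hsq : √((n : ℝ) * N ^ (d - 1) * Real.exp 2 ^ d / (d : ℝ) ^ d)
      = √(n : ℝ) * N ^ (((d : ℝ) - 1) / 2) / √(((d : ℝ) / Real.exp 2) ^ d) := by
    have : (n : ℝ) * N ^ (d - 1) * Real.exp 2 ^ d / (d : ℝ) ^ d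
        = n * N ^ (d - 1) / ((d : ℝ) / Real.exp 2) ^ d := by
      rw [div_pow]
      have := (Real.exp_pos 2).ne'
      field_simp
    rw [this, Real.sqrt_div (by positivity), Real.sqrt_mul hn0.le]
    congr 2
    rw [Real.sqrt_eq_rpow, ← Real.rpow_natCast, ← Real.rpow_mul hN0.le, Nat.cast_sub hd]
    congr 1
    push_cast
    ring
  -- The staircase accounts for `d(d-1)/2` and the row factorials for `(d-1)/2`.
  have hexp : N ^ (((d : ℝ) ^ 2 - 1) / 2) = N ^ T * N ^ (((d : ℝ) - 1) / 2) := by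
    rw [← Real.rpow_natCast N T, ← Real.rpow_add hN0]
    congr 1
    have := sum_stair hd
    rw [← hT] at this
    have h2 : 2 * (T : ℝ) + d = (d : ℝ) ^ 2 := by exact_mod_cast this
    linarith
  have hq : 0 < √(((d : ℝ) / Real.exp 2) ^ d) := by positivity
  have hs2 : √(2 * Real.pi * n) = √(2 * Real.pi) * √n := Real.sqrt_mul (by positivity) _
  have hs3 : √(2 * Real.pi * ((d : ℝ) / Real.exp 2) ^ d)
      = √(2 * Real.pi) * √(((d : ℝ) / Real.exp 2) ^ d) := Real.sqrt_mul (by positivity) _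
  have hsn : 0 < √(n : ℝ) := Real.sqrt_pos.mpr hn0
  have hspi : 0 < √(2 * Real.pi) := by positivity
  calc N ^ T * P / (√(2 * Real.pi * n) * barnesG (d + 1))
      ≤ N ^ T * (√(n : ℝ) * N ^ (((d : ℝ) - 1) / 2) / √(((d : ℝ) / Real.exp 2) ^ d))
          / (√(2 * Real.pi * n) * barnesG (d + 1)) := by
        rw [← hsq]
        gcongr
    _ = fq n d := by
        rw [fq, ← hN, hexp, hs2, hs3]
        field_simp

lemma fq_isBigO (hd : 0 < d) : (fun n : ℕ => fq n d) =O[Filter.atTop]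
      (fun n : ℕ => (n : ℝ) ^ (((d : ℝ) ^ 2 - 1) / 2)) := by
  set c : ℝ := √(2 * Real.pi * ((d : ℝ) / Real.exp 2) ^ d) * barnesG (d + 1) with hc
  set α : ℝ := ((d : ℝ) ^ 2 - 1) / 2 with hα
  have hd1 : (1 : ℝ) ≤ d := Nat.one_le_cast.mpr hd
  have hα0 : 0 ≤ α := by
    rw [hα]
    nlinarith
  have hc0 : 0 ≤ c := by positivity
  refine Asymptotics.IsBigO.of_bound ((d : ℝ) ^ α / c) ?_
  filter_upwards [Filter.eventually_ge_atTop 1] with n hn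
  have hn1 : (1 : ℝ) ≤ n := Nat.one_le_cast.mpr hn
  have hN : 0 ≤ (n : ℝ) + d - 1 := by linarith
  rw [fq, ← hc, ← hα, Real.norm_of_nonneg (by positivity), Real.norm_of_nonneg (by positivity),
    div_mul_eq_mul_div, ← Real.mul_rpow (by positivity) (by positivity)]
  gcongr
  nlinarith

end Prefactor
end QDF
end

/-! ### The group algebra on tensor space: isotypic projections and traces -/

noncomputable section
namespace QDF
open MonoidAlgebra

variable {n d : ℕ} {m : YoungDiag n d}

/-- The matrix of the operator permuting the tensor factors. -/
def permMat (d : ℕ) (π : Equiv.Perm (Fin n)) : Op n d :=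
  Matrix.of fun a b => if a ∘ π = b then 1 else 0

lemma permMat_mul_apply (π : Equiv.Perm (Fin n)) (X : Op n d) (a b : Idx n d) :
    (permMat d π * X) a b = X (a ∘ π) b := by
  simp [Matrix.mul_apply, permMat]

lemma mul_permMat_apply (π : Equiv.Perm (Fin n)) (X : Op n d) (a b : Idx n d) :
    (X * permMat d π) a b = X a (b ∘ ⇑π⁻¹) := by
  have h (c : Idx n d) : c ∘ π = b ↔ c = b ∘ ⇑π⁻¹ := by
    constructor
    · rintro rfl; funext i; simp
    · rintro rfl; funext i; simp
  simp [Matrix.mul_apply, permMat, h]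

lemma permMat_one : permMat d (1 : Equiv.Perm (Fin n)) = 1 := by
  ext a b
  simp [permMat, Matrix.one_apply]

lemma permMat_mul (π σ : Equiv.Perm (Fin n)) : permMat d (π * σ) = permMat d π * permMat d σ := by
  ext a b
  rw [permMat_mul_apply]
  rfl

lemma permMat_conjTranspose (π : Equiv.Perm (Fin n)) :
    (permMat d π).conjTranspose = permMat d π⁻¹ := by
  ext a b
  have h : b ∘ π = a ↔ a ∘ ⇑π⁻¹ = b := by
    constructor
    · rintro rfl; funext i; simp
    · rintro rfl; funext i; simp
  simp [permMat, Matrix.conjTranspose_apply, h, apply_ite]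

lemma permMat_conj_apply (π : Equiv.Perm (Fin n)) (X : Op n d) :
    permMat d π * X * permMat d π⁻¹ = X.submatrix (fun a => a ∘ π) (fun a => a ∘ π) := by
  ext a b
  rw [mul_permMat_apply, permMat_mul_apply, inv_inv, Matrix.submatrix_apply]

lemma permMat_inv_mul (π : Equiv.Perm (Fin n)) : permMat d π⁻¹ * permMat d π = 1 := by
  rw [← permMat_mul, inv_mul_cancel, permMat_one]

lemma permMat_mul_inv (π : Equiv.Perm (Fin n)) : permMat d π * permMat d π⁻¹ = 1 := by
  rw [← permMat_mul, mul_inv_cancel, permMat_one]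

lemma isPermInvariant_iff {X : Op n d} :
    IsPermInvariant X ↔ ∀ π, permMat d π * X = X * permMat d π := by
  refine forall_congr' fun π => ?_
  rw [← permMat_conj_apply]
  constructor
  · intro h
    conv_rhs => rw [← h]
    rw [Matrix.mul_assoc _ (permMat d π⁻¹), permMat_inv_mul, Matrix.mul_one]
  · intro h
    rw [h, Matrix.mul_assoc, permMat_mul_inv, Matrix.mul_one]

/-- The group algebra acting by matrices on the tensor space. -/
def toOp (n d : ℕ) : GroupAlg n →ₐ[ℂ] Op n d :=
  MonoidAlgebra.lift ℂ (Op n d) (Equiv.Perm (Fin n))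
    { toFun := permMat d
      map_one' := permMat_one
      map_mul' := permMat_mul }

lemma toOp_single (π : Equiv.Perm (Fin n)) (a : ℂ) : toOp n d (single π a) = a • permMat d π :=
  MonoidAlgebra.lift_single _ _ _

lemma toOp_eq_sum (x : GroupAlg n) : toOp n d x = ∑ g, x.coeff g • permMat d g := by
  conv_lhs => rw [eq_sum_smul_single x]
  simp [toOp_single]

lemma toEuclideanCLM_permMat (π : Equiv.Perm (Fin n)) (v : TensorSpace n d) :
    Matrix.toEuclideanCLM (𝕜 := ℂ) (permMat d π) v = permRep n d π v := by
  obtain ⟨v, rfl⟩ : ∃ w : Idx n d → ℂ, v = WithLp.toLp 2 w := ⟨v.ofLp, rfl⟩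
  rw [Matrix.toEuclideanCLM_toLp]
  ext a
  have h : (permRep n d π (WithLp.toLp 2 v)) a = v (a ∘ π) := rfl
  rw [h]
  simp [permMat, Matrix.mulVec, dotProduct]

lemma toEuclideanCLM_toOp (x : GroupAlg n) (v : TensorSpace n d) :
    Matrix.toEuclideanCLM (𝕜 := ℂ) (toOp n d x) v = (permRep n d).asAlgebraHom x v := by
  rw [toOp_eq_sum]
  conv_rhs => rw [eq_sum_smul_single x]
  simp [Representation.asAlgebraHom_single, toEuclideanCLM_permMat, LinearMap.sum_apply]

lemma toOp_comm {X : Op n d} (hX : IsPermInvariant X) (x : GroupAlg n) :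
    toOp n d x * X = X * toOp n d x := by
  simp only [toOp_eq_sum, Finset.sum_mul, Finset.mul_sum, Matrix.smul_mul, Matrix.mul_smul,
    isPermInvariant_iff.mp hX]

lemma toOp_rowSum_isHermitian : (toOp n d (rowSum m)).IsHermitian := by
  rw [Matrix.IsHermitian, rowSum, map_sum, Matrix.conjTranspose_sum]
  simp only [toOp_single, one_smul, permMat_conjTranspose]
  exact sum_rowPerms_inv fun g => permMat d g

lemma star_sgn (q : Equiv.Perm (Fin n)) : star (sgn q) = sgn q := by simp [sgn]

lemma toOp_colSum_isHermitian : (toOp n d (colSum m)).IsHermitian := by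
  rw [Matrix.IsHermitian, colSum, map_sum, Matrix.conjTranspose_sum]
  simp only [map_smul, toOp_single, one_smul, Matrix.conjTranspose_smul, permMat_conjTranspose,
    star_sgn]
  rw [← sum_colPerms_inv fun g => sgn g • permMat d g]
  simp only [sgn_inv]

variable (m) in
/-- The operator by which the self-adjoint Young idempotent acts; its range is a copy of `U_m`. -/
def weylProj : Op n d := toOp n d (youngProj m)

lemma star_kappa_inv : star (kappa m)⁻¹ = (kappa m)⁻¹ := by
  rw [inv_kappa_eq]
  simp

lemma weylProj_isHermitian : (weylProj m).IsHermitian := by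
  rw [Matrix.IsHermitian, weylProj, youngProj, map_smul, Matrix.conjTranspose_smul, map_mul, map_mul,
    Matrix.conjTranspose_mul, Matrix.conjTranspose_mul, toOp_rowSum_isHermitian.eq,
    toOp_colSum_isHermitian.eq, Matrix.mul_assoc, mul_inv, star_mul', star_kappa_inv]
  simp

lemma weylProj_mul_self : weylProj m * weylProj m = weylProj m := by
  rw [weylProj, ← map_mul, youngProj_isPrimitive.idem]

variable (m) in
/-- The central idempotent of the group algebra belonging to `m`. -/
def isoIdem : GroupAlg n := centralIdem (youngProj m)

lemma coeff_one_youngProj_eq : (youngProj m).coeff 1 = (dimV m : ℂ) / n.factorial := by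
  rw [coeff_one_youngProj, coeff_one_youngIdem, inv_kappa_eq]

lemma toOp_isoIdem : toOp n d (isoIdem m) =
    ((dimV m : ℂ) / n.factorial) • ∑ h, permMat d h * weylProj m * permMat d h⁻¹ := by
  rw [isoIdem, centralIdem, coeff_one_youngProj_eq, map_smul, conjSum, map_sum]
  simp only [map_mul, toOp_single, one_smul, weylProj]

lemma toOp_isoIdem_isHermitian : (toOp n d (isoIdem m)).IsHermitian := by
  rw [Matrix.IsHermitian, toOp_isoIdem, Matrix.conjTranspose_smul, Matrix.conjTranspose_sum]
  simp only [Matrix.conjTranspose_mul, permMat_conjTranspose, inv_inv, weylProj_isHermitian.eq,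
    Matrix.mul_assoc]
  simp

lemma isoIdem_mul_self : isoIdem m * isoIdem m = isoIdem m :=
  youngProj_isPrimitive.centralIdem_idem

lemma isStarProjection_of_isHermitian {ι : Type*} [Fintype ι] {Q : Matrix ι ι ℂ}
    (h : Q.IsHermitian) (h' : Q * Q = Q) : IsStarProjection Q :=
  ⟨h', h⟩

/-- The central idempotent acts as a self-adjoint idempotent, being a real multiple of a sum of
unitary conjugates of `weylProj m`, and its fixed vectors are the isotypic component. -/
theorem isoProj_eq : isoProj m = toOp n d (isoIdem m) := by
  rw [isoProj, StarAlgEquiv.symm_apply_eq]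
  have hs : IsStarProjection (Matrix.toEuclideanCLM (𝕜 := ℂ) (toOp n d (isoIdem m))) := by
    have := isStarProjection_of_isHermitian (toOp_isoIdem_isHermitian (m := m) (d := d))
      (by rw [← map_mul, isoIdem_mul_self])
    refine ⟨?_, ?_⟩
    · rw [IsIdempotentElem, ← map_mul, this.1]
    · rw [IsSelfAdjoint, ← map_star, this.2]
  obtain ⟨_, h⟩ := isStarProjection_iff_eq_starProjection_range.mp hs
  have hr : isotypicSubspace m = LinearMap.range (Matrix.toEuclideanCLM (𝕜 := ℂ) (toOp n d (isoIdem m))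
      : TensorSpace n d →ₗ[ℂ] TensorSpace n d) := by
    ext v
    rw [LinearMap.mem_range]
    have hmem : v ∈ isotypicSubspace m ↔
        (permRep n d).asModuleEquiv.symm v ∈
          isotypicComponent (GroupAlg n) (permRep n d).asModule (Specht m) := by
      rw [isotypicSubspace, Submodule.mem_map]
      constructor
      · rintro ⟨y, hy, rfl⟩
        simpa using hy
      · intro hv
        exact ⟨_, hv, by simp⟩
    have hz : (centralIdem (youngIdem m) • (permRep n d).asModuleEquiv.symm v
        = (permRep n d).asModuleEquiv.symm v) ↔
        Matrix.toEuclideanCLM (𝕜 := ℂ) (toOp n d (isoIdem m)) v = v := by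
      rw [← (permRep n d).asModuleEquiv.injective.eq_iff, Representation.asModuleEquiv_map_smul,
        LinearEquiv.apply_symm_apply, toEuclideanCLM_toOp, isoIdem, centralIdem_youngProj]
    rw [hmem, specht_eq_span, youngIdem_isPrimitive.mem_isotypicComponent_iff, hz]
    constructor
    · intro hv
      exact ⟨v, hv⟩
    · rintro ⟨w, rfl⟩
      have := congrArg (fun f => f w) hs.1.eq
      exact this
  rw [h]
  congr 1

lemma isoProj_isHermitian : (isoProj m).IsHermitian := isoProj_eq (m := m) ▸ toOp_isoIdem_isHermitian

lemma isoProj_mul_self : isoProj m * isoProj m = isoProj m := by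
  rw [isoProj_eq, ← map_mul, isoIdem_mul_self]

lemma isoProj_mul_toOp (x : GroupAlg n) : isoProj m * toOp n d x = toOp n d x * isoProj m := by
  rw [isoProj_eq, ← map_mul, ← map_mul, isoIdem, IsPrimitive.centralIdem_comm]

lemma isoProj_isPermInvariant : IsPermInvariant (isoProj m) := by
  rw [isPermInvariant_iff]
  intro π
  have := isoProj_mul_toOp (m := m) (single π 1)
  rw [toOp_single, one_smul] at this
  exact this.symm

lemma isoProj_mul_weylProj : isoProj m * weylProj m = weylProj m := by
  rw [isoProj_eq, weylProj, ← map_mul, isoIdem, youngProj_isPrimitive.centralIdem_mul]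

lemma weylProj_mul_isoProj : weylProj m * isoProj m = weylProj m := by
  rw [weylProj, ← isoProj_mul_toOp, ← weylProj, isoProj_mul_weylProj]

lemma coeff_isoIdem (g : Equiv.Perm (Fin n)) :
    (isoIdem m).coeff g = ((dimV m : ℂ) / n.factorial) * character m g := by
  rw [isoIdem, centralIdem, coeff_one_youngProj_eq, conjSum_youngProj, ofReal_character]
  rfl

/-- The product of two commuting idempotents is idempotent, so it suffices that its coefficient at
`1` vanishes; that coefficient is a multiple of the inner product of two characters. -/
lemma isoIdem_mul_isoIdem {m' : YoungDiag n d} (h : m ≠ m') : isoIdem m * isoIdem m' = 0 := by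
  refine eq_zero_of_idempotent_of_coeff_one ?_ ?_
  · have hc : isoIdem m' * isoIdem m = isoIdem m * isoIdem m' := IsPrimitive.centralIdem_comm _ _
    calc isoIdem m * isoIdem m' * (isoIdem m * isoIdem m')
        = isoIdem m * (isoIdem m' * isoIdem m) * isoIdem m' := by simp only [mul_assoc]
      _ = (isoIdem m * isoIdem m) * (isoIdem m' * isoIdem m') := by rw [hc]; simp only [mul_assoc]
      _ = _ := by rw [isoIdem_mul_self, isoIdem_mul_self]
  · rw [coeff_mul_eq_sum]
    simp only [mul_one, coeff_isoIdem, character_inv]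
    have := sum_frobenius_mul m m'
    simp only [frobenius_eq_character, if_neg h] at this
    have h2 : ∑ g, (character m g : ℂ) * character m' g = 0 := by exact_mod_cast this
    calc _ = ((dimV m : ℂ) / n.factorial) * ((dimV m' : ℂ) / n.factorial) *
          ∑ g, (character m g : ℂ) * character m' g := by
            rw [Finset.mul_sum]
            exact Finset.sum_congr rfl fun g _ => by ring
      _ = 0 := by rw [h2, mul_zero]

lemma isoProj_mul_isoProj {m' : YoungDiag n d} (h : m ≠ m') : isoProj m * isoProj m' = 0 := by
  rw [isoProj_eq, isoProj_eq, ← map_mul, isoIdem_mul_isoIdem h, map_zero]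

/-- An invariant operator commutes with permutations, so each conjugate of `x` has the same trace
against it. Such traces depend on `x` only through `conjSum x`. -/
lemma trace_toOp_conjSum {Z : Op n d} (hZ : IsPermInvariant Z) (x : GroupAlg n) :
    (toOp n d (conjSum x) * Z).trace = n.factorial * (toOp n d x * Z).trace := by
  have h (g : Equiv.Perm (Fin n)) :
      (toOp n d (single g 1 * x * single g⁻¹ 1) * Z).trace = (toOp n d x * Z).trace := by
    rw [map_mul, map_mul, toOp_single, toOp_single, one_smul, one_smul, Matrix.mul_assoc,
      isPermInvariant_iff.mp hZ, ← Matrix.mul_assoc, Matrix.trace_mul_comm, Matrix.mul_assoc (permMat d g),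
      ← Matrix.mul_assoc, permMat_inv_mul, Matrix.one_mul]
  rw [conjSum, map_sum, Finset.sum_mul, Matrix.trace_sum, Finset.sum_congr rfl fun g _ => h g]
  simp [Fintype.card_perm]

lemma trace_weylProj_mul {Z : Op n d} (hZ : IsPermInvariant Z) :
    (weylProj m * Z).trace = (toOp n d (youngIdem m) * Z).trace := by
  have h := trace_toOp_conjSum hZ (youngProj m)
  rw [conjSum_youngProj, trace_toOp_conjSum hZ] at h
  exact (mul_left_cancel₀ (Nat.cast_ne_zero.mpr n.factorial_ne_zero) h).symm

lemma trace_isoProj_mul {Z : Op n d} (hZ : IsPermInvariant Z) :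
    (isoProj m * Z).trace = dimV m * (weylProj m * Z).trace := by
  have : (n.factorial : ℂ) ≠ 0 := Nat.cast_ne_zero.mpr n.factorial_ne_zero
  rw [isoProj_eq, isoIdem, centralIdem, coeff_one_youngProj_eq, map_smul, Matrix.smul_mul,
    Matrix.trace_smul, trace_toOp_conjSum hZ, weylProj, smul_eq_mul]
  field_simp

lemma trace_permMat_diagonal (f : Idx n d → ℂ) (g : Equiv.Perm (Fin n)) :
    (permMat d g * Matrix.diagonal f).trace = ∑ a with a ∘ g = a, f a := by
  classical
  simp only [Matrix.trace, Matrix.diag_apply, permMat_mul_apply, Matrix.diagonal_apply]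
  rw [Finset.sum_filter]
  refine Finset.sum_congr rfl fun a _ => ?_
  split_ifs with h
  · rw [h]
  · rfl

lemma diagonal_isPermInvariant {f : Idx n d → ℂ} (hf : ∀ (π : Equiv.Perm (Fin n)) a, f (a ∘ π) = f a) :
    IsPermInvariant (Matrix.diagonal f : Op n d) := by
  intro π
  ext a b
  have : a ∘ π = b ∘ π ↔ a = b := π.surjective.injective_comp_right.eq_iff
  simp only [Matrix.submatrix_apply, Matrix.diagonal_apply, this, hf]

lemma tensorPower_diagonal (t : Fin d → ℂ) :
    tensorPower n (Matrix.diagonal t) = Matrix.diagonal fun a : Idx n d => ∏ i, t (a i) := by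
  ext a b
  simp only [tensorPower, Matrix.of_apply, Matrix.diagonal_apply]
  split_ifs with h
  · subst h; simp
  · obtain ⟨i, hi⟩ := Function.ne_iff.mp h
    exact Finset.prod_eq_zero (Finset.mem_univ i) (if_neg hi)

lemma tensorPower_isPermInvariant (M : Matrix (Fin d) (Fin d) ℂ) :
    IsPermInvariant (tensorPower n M) := by
  intro π
  ext a b
  simp only [Matrix.submatrix_apply, tensorPower, Matrix.of_apply, Function.comp_apply]
  exact Equiv.prod_comp π fun i => M (a i) (b i)

lemma trace_weylProj_diagonal (t : Fin d → ℝ) :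
    (weylProj m * tensorPower n (Matrix.diagonal fun i => (t i : ℂ))).trace = schur m.1 t := by
  rw [trace_weylProj_mul (tensorPower_isPermInvariant _), toOp_eq_sum, Finset.sum_mul,
    Matrix.trace_sum, schur_eq, tensorPower_diagonal]
  push_cast
  refine Finset.sum_congr rfl fun g _ => ?_
  rw [Matrix.smul_mul, Matrix.trace_smul, trace_permMat_diagonal, ofReal_idemCoeff, smul_eq_mul,
    permTrace]
  push_cast
  rfl

lemma tensorPower_one : tensorPower n (1 : Matrix (Fin d) (Fin d) ℂ) = 1 := by
  rw [← Matrix.diagonal_one, tensorPower_diagonal]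
  simp

lemma trace_weylProj_schur : (weylProj m).trace = schur m.1 (fun _ => 1) := by
  have := trace_weylProj_diagonal (m := m) fun _ => 1
  rw [Complex.ofReal_one, Matrix.diagonal_one, tensorPower_one, Matrix.mul_one] at this
  exact this

lemma one_isPermInvariant : IsPermInvariant (1 : Op n d) := by
  rw [isPermInvariant_iff]; simp

/-- `weylModule m` is the range of the Young idempotent, which need not be self-adjoint; its trace
is still its rank and agrees with that of `weylProj m`. -/
lemma trace_weylProj : (weylProj m).trace = dimU m := by
  have h1 := trace_weylProj_mul (m := m) one_isPermInvariant
  rw [Matrix.mul_one, Matrix.mul_one] at h1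
  set f : TensorSpace n d →ₗ[ℂ] TensorSpace n d := (permRep n d).asAlgebraHom (youngIdem m) with hf
  have hfm : f = Matrix.toEuclideanLin (toOp n d (youngIdem m)) := by
    ext1 v
    rw [hf, ← toEuclideanCLM_toOp, ← Matrix.coe_toEuclideanCLM_eq_toEuclideanLin]
    rfl
  have hi : IsIdempotentElem f := by
    rw [IsIdempotentElem, hf, ← map_mul, youngIdem_isPrimitive.idem]
  have ht := (LinearMap.IsIdempotentElem.isProj_range f hi).trace
  have hr : LinearMap.range f = weylModule m := by
    rw [weylModule, hf, youngIdem, map_smul]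
    exact LinearMap.range_smul _ _ (inv_ne_zero kappa_ne_zero)
  rw [hr] at ht
  rw [h1, dimU, ← ht, hfm, Matrix.toEuclideanLin_eq_toLin_orthonormal, Matrix.trace_toLin_eq]

theorem dimU_eq : (dimU m : ℝ) = schur m.1 (fun _ => 1) := by
  have h1 := trace_weylProj (m := m)
  rw [trace_weylProj_schur] at h1
  exact_mod_cast h1.symm

/-- The complement is an orthogonal projection, so it vanishes once its trace does. The trace
identity is the expansion of the power sum of the identity permutation at `t = (1, …, 1)`. -/
theorem sum_isoProj : ∑ m : YoungDiag n d, isoProj m = 1 := by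
  set Q : Op n d := 1 - ∑ m : YoungDiag n d, isoProj m with hQ
  have hsq : (∑ m : YoungDiag n d, isoProj m) * (∑ m : YoungDiag n d, isoProj m)
      = ∑ m : YoungDiag n d, isoProj m := by
    classical
    rw [Finset.sum_mul_sum]
    refine Finset.sum_congr rfl fun m _ => ?_
    rw [Finset.sum_eq_single m (fun m' _ h => isoProj_mul_isoProj h.symm) (by simp),
      isoProj_mul_self]
  have hherm : Q.IsHermitian :=
    Matrix.isHermitian_one.sub (by
      rw [Matrix.IsHermitian, Matrix.conjTranspose_sum]
      exact Finset.sum_congr rfl fun m _ => isoProj_isHermitian)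
  have hQQ : Q * Q = Q := by
    rw [hQ, sub_mul, mul_sub, mul_sub, hsq]
    simp
  have hpos : Q.PosSemidef := by
    have := Matrix.posSemidef_conjTranspose_mul_self Q
    rwa [hherm.eq, hQQ] at this
  have htr : Q.trace = 0 := by
    have h1 (m : YoungDiag n d) : (isoProj m).trace = (dimV m : ℂ) * schur m.1 (fun _ => 1) := by
      have := trace_isoProj_mul (m := m) one_isPermInvariant
      rwa [Matrix.mul_one, Matrix.mul_one, trace_weylProj_schur] at this
    have h2 := permTrace_eq (n := n) (d := d) 1 fun _ => 1
    have h3 : permTrace (1 : Equiv.Perm (Fin n)) (fun _ : Fin d => (1 : ℝ))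
        = Fintype.card (Idx n d) := by
      simp [permTrace]
    rw [h3] at h2
    simp only [character_one] at h2
    rw [hQ, Matrix.trace_sub, Matrix.trace_one, Matrix.trace_sum, Finset.sum_congr rfl fun m _ => h1 m,
      sub_eq_zero]
    exact_mod_cast h2
  have := hpos.trace_eq_zero_iff.mp htr
  exact (sub_eq_zero.mp (hQ ▸ this)).symm

lemma weylProj_posSemidef : (weylProj m).PosSemidef := by
  have := Matrix.posSemidef_conjTranspose_mul_self (weylProj m)
  rwa [weylProj_isHermitian.eq, weylProj_mul_self] at this

lemma content_comp_perm (a : Idx n d) (π : Equiv.Perm (Fin n)) : content (a ∘ π) = content a :=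
  content_comp _ _

/-- The highest weight `m` occurs once in the range of `weylProj m`: the trace against the
projection onto words of content `m` is a sum of fixed-point counts. -/
lemma sum_weylProj_diag : ∑ a with content a = m.1, weylProj m a a = 1 := by
  classical
  set f : Idx n d → ℂ := fun a => if content a = m.1 then 1 else 0 with hf
  have hinv : IsPermInvariant (Matrix.diagonal f : Op n d) :=
    diagonal_isPermInvariant fun π a => by simp only [hf, content_comp_perm]
  have h1 : (weylProj m * Matrix.diagonal f).trace = ∑ a with content a = m.1, weylProj m a a := by
    simp [Matrix.trace, Matrix.mul_diagonal, hf, Finset.sum_filter]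
  rw [← h1, trace_weylProj_mul hinv, toOp_eq_sum, Finset.sum_mul, Matrix.trace_sum]
  have h2 := sum_idemCoeff_fixedCount_self (m := m)
  have h3 : ∑ g, (idemCoeff m g : ℂ) * fixedCount d m.1 g = 1 := by exact_mod_cast h2
  rw [← h3]
  refine Finset.sum_congr rfl fun g _ => ?_
  rw [Matrix.smul_mul, Matrix.trace_smul, trace_permMat_diagonal, ofReal_idemCoeff, smul_eq_mul,
    fixedCount, Finset.card_filter]
  congr 1
  rw [Finset.sum_filter]
  push_cast
  refine Finset.sum_congr rfl fun a _ => ?_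
  simp only [hf]
  by_cases h : a ∘ g = a <;> simp [h]

/-- The Schur polynomial is a combination of monomials whose weights are diagonal entries of a
positive operator, and the weights of `t ^ m` add up to one. -/
lemma prod_pow_le_schur {t : Fin d → ℝ} (ht : ∀ i, 0 ≤ t i) : ∏ j, t j ^ m.1 j ≤ schur m.1 t := by
  classical
  have h1 := trace_weylProj_diagonal (m := m) t
  obtain ⟨w, hw⟩ : ∃ w : Idx n d → ℝ, ∀ a, weylProj m a a = w a :=
    ⟨fun a => (weylProj m a a).re, fun a => (weylProj_isHermitian.coe_re_apply_self a).symm⟩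
  have hw0 (a : Idx n d) : 0 ≤ w a := by
    have := weylProj_posSemidef.diag_nonneg (A := weylProj m) (i := a)
    rwa [hw, Complex.zero_le_real] at this
  have h2 : schur m.1 t = ∑ a, w a * ∏ i, t (a i) := by
    rw [tensorPower_diagonal] at h1
    simp only [Matrix.trace, Matrix.diag_apply, Matrix.mul_diagonal, hw] at h1
    exact_mod_cast h1.symm
  have h3 : ∑ a with content a = m.1, w a = 1 := by
    have := sum_weylProj_diag (m := m)
    simp only [hw] at this
    exact_mod_cast this
  have hp (a : Idx n d) : ∏ i, t (a i) = ∏ j, t j ^ content a j := by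
    rw [← Finset.prod_fiberwise_of_maps_to (g := a) (fun i _ => Finset.mem_univ (a i))]
    refine Finset.prod_congr rfl fun j _ => ?_
    rw [content, ← Finset.prod_const]
    refine Finset.prod_congr rfl fun i hi => ?_
    rw [(Finset.mem_filter.mp hi).2]
  rw [h2]
  calc ∏ j, t j ^ m.1 j = ∑ a with content a = m.1, w a * ∏ i, t (a i) := by
        rw [Finset.sum_congr rfl fun a ha => by rw [hp a, (Finset.mem_filter.mp ha).2],
          ← Finset.sum_mul, h3, one_mul]
    _ ≤ _ := Finset.sum_le_sum_of_subset_of_nonneg (Finset.filter_subset _ _) fun a _ _ =>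
        mul_nonneg (hw0 a) (Finset.prod_nonneg fun i _ => ht _)

lemma empirical_nonneg (i : Fin d) : 0 ≤ empirical m i := by
  rw [empirical]
  positivity

lemma empirical_prod_pos (hn : 0 < n) : 0 < ∏ j, empirical m j ^ m.1 j := by
  refine Finset.prod_pos fun j _ => ?_
  rcases Nat.eq_zero_or_pos (m.1 j) with h | h
  · rw [h]; simp
  · have : (0 : ℝ) < m.1 j := Nat.cast_pos.mpr h
    have : (0 : ℝ) < n := Nat.cast_pos.mpr hn
    exact pow_pos (div_pos ‹_› ‹_›) _

lemma schur_empirical_pos (hn : 0 < n) : 0 < schur m.1 (empirical m) :=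
  (empirical_prod_pos hn).trans_le (prod_pow_le_schur empirical_nonneg)

theorem fqDiag_le_fq (hd : 0 < d) (hn : 0 < n) : fqDiag m ≤ fq n d := by
  refine le_trans ?_ (prefactor_le (m := m) hd hn)
  have h : fqDiag m = (schur m.1 fun _ => 1) / dimV m / schur m.1 (empirical m) := by
    rw [fqDiag, dimU_eq, div_div, mul_comm]
  rw [h, schur_one_div_dimV hd]
  exact div_le_div_of_nonneg_left (by positivity) (empirical_prod_pos hn)
    (prod_pow_le_schur empirical_nonneg)

end QDF
end

/-! ### The Haar average, the double commutant and Schur's lemma -/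

noncomputable section
namespace QDF

variable {n d : ℕ} {m : YoungDiag n d}

lemma tensorPower_mul (A B : Matrix (Fin d) (Fin d) ℂ) :
    tensorPower n (A * B) = tensorPower n A * tensorPower n B := by
  ext a b
  simp only [tensorPower, Matrix.of_apply, Matrix.mul_apply, ← Finset.prod_mul_distrib]
  rw [Finset.prod_univ_sum, Fintype.piFinset_univ]

lemma tensorPower_conjTranspose (A : Matrix (Fin d) (Fin d) ℂ) :
    tensorPower n A.conjTranspose = (tensorPower n A).conjTranspose := by
  ext a b
  simp [tensorPower, Matrix.conjTranspose_apply]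

instance haarU_isHaarMeasure (d : ℕ) : (haarU d).IsHaarMeasure := by
  unfold haarU
  infer_instance

instance haarU_isProbabilityMeasure (d : ℕ) : MeasureTheory.IsProbabilityMeasure (haarU d) :=
  ⟨by
    have := MeasureTheory.Measure.haarMeasure_self
      (K₀ := (⊤ : TopologicalSpace.PositiveCompacts (Matrix.unitaryGroup (Fin d) ℂ)))
    simpa [haarU] using this⟩

/-- The integrand of `haarIID`. -/
def rotated (n : ℕ) {d : ℕ} (t : Fin d → ℝ) (U : Matrix.unitaryGroup (Fin d) ℂ) : Op n d :=
  tensorPower n ((U : Matrix (Fin d) (Fin d) ℂ) * Matrix.diagonal (fun i => (t i : ℂ)) *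
      (U : Matrix (Fin d) (Fin d) ℂ).conjTranspose)

lemma continuous_rotated (t : Fin d → ℝ) : Continuous (rotated n t) := by
  refine continuous_matrix fun a b => ?_
  simp only [rotated, tensorPower, Matrix.of_apply]
  refine continuous_finsetProd _ fun i _ => ?_
  have : Continuous fun U : Matrix.unitaryGroup (Fin d) ℂ => (U : Matrix (Fin d) (Fin d) ℂ) *
      Matrix.diagonal (fun i => (t i : ℂ)) * (U : Matrix (Fin d) (Fin d) ℂ).conjTranspose := by
    fun_prop
  exact this.matrix_elem _ _

lemma integrable_rotated (t : Fin d → ℝ) (a b : Idx n d) :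
    MeasureTheory.Integrable (fun U => rotated n t U a b) (haarU d) :=
  ((continuous_rotated t).matrix_elem a b).integrable_of_hasCompactSupport
    (HasCompactSupport.of_compactSpace _)

lemma haarIID_apply (t : Fin d → ℝ) (a b : Idx n d) :
    haarIID n t a b = ∫ U, rotated n t U a b ∂(haarU d) := rfl

/-- A linear functional of the Haar average is the average of the functional. -/
lemma sum_mul_haarIID (t : Fin d → ℝ) (c : Idx n d → Idx n d → ℂ) :
    ∑ a, ∑ b, c a b * haarIID n t a b = ∫ U, ∑ a, ∑ b, c a b * rotated n t U a b ∂(haarU d) := by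
  rw [MeasureTheory.integral_finsetSum _ fun a _ => MeasureTheory.integrable_finsetSum _ fun b _ =>
    (integrable_rotated t a b).const_mul _]
  refine Finset.sum_congr rfl fun a _ => ?_
  rw [MeasureTheory.integral_finsetSum _ fun b _ => (integrable_rotated t a b).const_mul _]
  refine Finset.sum_congr rfl fun b _ => ?_
  rw [MeasureTheory.integral_const_mul, haarIID_apply]

lemma mul_mul_apply_eq_sum (A X B : Op n d) (i j : Idx n d) :
    (A * X * B) i j = ∑ a, ∑ b, A i a * B b j * X a b := by
  simp only [Matrix.mul_apply, Finset.sum_mul]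
  rw [Finset.sum_comm]
  exact Finset.sum_congr rfl fun a _ => Finset.sum_congr rfl fun b _ => by ring

lemma mul_single_mul_apply (A B : Op n d) (a b i j : Idx n d) :
    (A * (Matrix.single a b 1 : Op n d) * B) i j = A i a * B b j := by
  rw [mul_mul_apply_eq_sum, Finset.sum_eq_single a, Finset.sum_eq_single b]
  · simp
  · intro c _ hc
    simp [hc.symm]
  · simp
  · intro c _ hc
    simp [hc.symm]
  · simp

lemma mul_haarIID_mul_apply (t : Fin d → ℝ) (A B : Op n d) (i j : Idx n d) :
    (A * haarIID n t * B) i j = ∫ U, (A * rotated n t U * B) i j ∂(haarU d) := by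
  simp only [mul_mul_apply_eq_sum]
  exact sum_mul_haarIID t _

lemma rotated_eq (t : Fin d → ℝ) (U : Matrix.unitaryGroup (Fin d) ℂ) :
    rotated n t U = tensorPower n (U : Matrix (Fin d) (Fin d) ℂ) *
      tensorPower n (Matrix.diagonal fun i => (t i : ℂ)) *
        (tensorPower n (U : Matrix (Fin d) (Fin d) ℂ)).conjTranspose := by
  rw [rotated, tensorPower_mul, tensorPower_mul, tensorPower_conjTranspose]

lemma tensorPower_unitary_mul (V : Matrix.unitaryGroup (Fin d) ℂ) :
    (tensorPower n (V : Matrix (Fin d) (Fin d) ℂ)).conjTranspose *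
      tensorPower n (V : Matrix (Fin d) (Fin d) ℂ) = 1 := by
  rw [← tensorPower_conjTranspose, ← tensorPower_mul]
  have := Matrix.mem_unitaryGroup_iff'.mp V.2
  rw [Matrix.star_eq_conjTranspose] at this
  rw [this, tensorPower_one]

/-- Conjugation by `V^{⊗n}` replaces `U` by `V U` under the integral, and Haar measure is left
invariant. -/
lemma haarIID_comm_unitary (t : Fin d → ℝ) (V : Matrix.unitaryGroup (Fin d) ℂ) :
    tensorPower n (V : Matrix (Fin d) (Fin d) ℂ) * haarIID n t =
      haarIID n t * tensorPower n (V : Matrix (Fin d) (Fin d) ℂ) := by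
  set W := tensorPower n (V : Matrix (Fin d) (Fin d) ℂ) with hW
  have h : W * haarIID n t * W.conjTranspose = haarIID n t := by
    ext i j
    rw [mul_haarIID_mul_apply, haarIID_apply]
    rw [← MeasureTheory.integral_mul_left_eq_self (fun U => rotated n t U i j) V]
    congr 1
    funext U
    rw [rotated_eq, rotated_eq]
    have : tensorPower n ((V * U : Matrix.unitaryGroup (Fin d) ℂ) : Matrix (Fin d) (Fin d) ℂ)
        = W * tensorPower n (U : Matrix (Fin d) (Fin d) ℂ) := by
      rw [hW, ← tensorPower_mul]
      rfl
    rw [this, Matrix.conjTranspose_mul]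
    simp only [Matrix.mul_assoc]
  conv_rhs => rw [← h]
  rw [Matrix.mul_assoc _ W.conjTranspose, tensorPower_unitary_mul, Matrix.mul_one]

lemma haarIID_isPermInvariant (t : Fin d → ℝ) : IsPermInvariant (haarIID n t) := by
  intro π
  ext a b
  rw [Matrix.submatrix_apply, haarIID_apply, haarIID_apply]
  congr 1
  funext U
  exact congrFun (congrFun (tensorPower_isPermInvariant _ π) a) b

/-- The Haar average is positive at nonnegative spectra. -/
lemma haarIID_posSemidef {t : Fin d → ℝ} (ht : ∀ i, 0 ≤ t i) : (haarIID n t).PosSemidef := by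
  have hr (U) : (rotated n t U).PosSemidef := by
    rw [rotated_eq, tensorPower_diagonal]
    refine Matrix.PosSemidef.mul_mul_conjTranspose_same ?_ _
    refine Matrix.PosSemidef.diagonal fun a => ?_
    have : (0 : ℂ) ≤ ((∏ i, t (a i) : ℝ) : ℂ) :=
      Complex.zero_le_real.mpr (Finset.prod_nonneg fun i _ => ht _)
    simpa using this
  refine Matrix.PosSemidef.of_dotProduct_mulVec_nonneg ?_ fun x => ?_
  · ext a b
    rw [Matrix.conjTranspose_apply, haarIID_apply, haarIID_apply, ← starRingEnd_apply, ← integral_conj]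
    congr 1
    funext U
    exact (hr U).1.apply a b
  · have h (X : Op n d) : star x ⬝ᵥ X.mulVec x = ∑ a, ∑ b, (star (x a) * x b) * X a b := by
      simp only [dotProduct, Matrix.mulVec, Finset.mul_sum, Pi.star_apply]
      exact Finset.sum_congr rfl fun a _ => Finset.sum_congr rfl fun b _ => by ring
    rw [h, sum_mul_haarIID]
    refine MeasureTheory.integral_nonneg fun U => ?_
    simp only [Pi.zero_apply]
    rw [← h]
    exact (hr U).dotProduct_mulVec_nonneg x

section DoubleCommutant

variable {Y : Op n d}

lemma content_le (a : Idx n d) (j : Fin d) : content a j ≤ n := by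
  rw [content]
  exact (Finset.card_filter_le _ _).trans (by simp)

/-- An operator commuting with `V^{⊗n}` for all unitary `V` commutes with the powers of diagonal
matrices. -/
lemma comm_diagonal (hY : ∀ V : Matrix.unitaryGroup (Fin d) ℂ,
      tensorPower n (V : Matrix (Fin d) (Fin d) ℂ) * Y = Y * tensorPower n (V : Matrix (Fin d) (Fin d) ℂ))
    (z : Fin d → ℂ) :
    tensorPower n (Matrix.diagonal z) * Y = Y * tensorPower n (Matrix.diagonal z) := by
  have hprod (z : Fin d → ℂ) (a : Idx n d) : ∏ i, z (a i) = ∏ j, z j ^ content a j := by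
    rw [← Finset.prod_fiberwise_of_maps_to (g := a) (fun i _ => Finset.mem_univ (a i))]
    refine Finset.prod_congr rfl fun j _ => ?_
    rw [content, ← Finset.prod_const]
    refine Finset.prod_congr rfl fun i hi => ?_
    rw [(Finset.mem_filter.mp hi).2]
  -- A primitive `(n+1)`-st root of unity at one diagonal place separates contents, since no value
  -- occurs more than `n` times.
  have key (a b : Idx n d) : Y a b = 0 ∨ content a = content b := by
    by_contra! h
    obtain ⟨j, hj⟩ := Function.ne_iff.mp h.2
    have hζ := Complex.isPrimitiveRoot_exp (n + 1) n.succ_ne_zero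
    set ζ := Complex.exp (2 * Real.pi * Complex.I / (n + 1 : ℕ))
    have hu : Matrix.diagonal (Function.update (1 : Fin d → ℂ) j ζ) ∈ Matrix.unitaryGroup (Fin d) ℂ := by
      rw [Matrix.mem_unitaryGroup_iff, Matrix.star_eq_conjTranspose, Matrix.diagonal_conjTranspose,
        Matrix.diagonal_mul_diagonal, ← Matrix.diagonal_one]
      congr 1
      funext i
      have hn : ‖ζ‖ = 1 := hζ.norm'_eq_one n.succ_ne_zero
      rcases eq_or_ne i j with rfl | hi
      · simp [Complex.mul_conj, Complex.normSq_eq_norm_sq, hn]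
      · simp [hi]
    have h1 := congrFun (congrFun (hY ⟨_, hu⟩) a) b
    rw [tensorPower_diagonal, Matrix.diagonal_mul, Matrix.mul_diagonal, mul_comm] at h1
    have h2 := mul_left_cancel₀ h.1 h1
    have h3 (a : Idx n d) : ∏ i, Function.update (1 : Fin d → ℂ) j ζ (a i) = ζ ^ content a j := by
      rw [hprod, Finset.prod_eq_single j (fun i _ hi => by simp [hi]) (by simp)]
      simp
    rw [h3, h3] at h2
    exact hj (hζ.pow_inj (Nat.lt_succ_of_le (content_le _ _)) (Nat.lt_succ_of_le (content_le _ _)) h2)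
  ext a b
  rw [tensorPower_diagonal, Matrix.diagonal_mul, Matrix.mul_diagonal, hprod, hprod]
  rcases key a b with h | h
  · simp [h]
  · rw [h, mul_comm]

lemma comm_hermitian (hY : ∀ V : Matrix.unitaryGroup (Fin d) ℂ,
      tensorPower n (V : Matrix (Fin d) (Fin d) ℂ) * Y = Y * tensorPower n (V : Matrix (Fin d) (Fin d) ℂ))
    {H : Matrix (Fin d) (Fin d) ℂ} (hH : H.IsHermitian) :
    tensorPower n H * Y = Y * tensorPower n H := by
  have hs := hH.spectral_theorem
  rw [Unitary.conjStarAlgAut_apply] at hs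
  set U := hH.eigenvectorUnitary
  have h3 := hY (star U)
  have h1 := hY U
  rw [hs, tensorPower_mul, tensorPower_mul, Matrix.mul_assoc]
  rw [show tensorPower n (star (U : Matrix (Fin d) (Fin d) ℂ)) * Y = _ from h3, ← Matrix.mul_assoc,
    Matrix.mul_assoc _ _ Y, comm_diagonal hY, ← Matrix.mul_assoc, h1]
  simp only [Matrix.mul_assoc]
  rfl

open Polynomial in
lemma comm_tensorPower (hY : ∀ V : Matrix.unitaryGroup (Fin d) ℂ,
      tensorPower n (V : Matrix (Fin d) (Fin d) ℂ) * Y = Y * tensorPower n (V : Matrix (Fin d) (Fin d) ℂ))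
    (M : Matrix (Fin d) (Fin d) ℂ) :
    tensorPower n M * Y = Y * tensorPower n M := by
  obtain ⟨A, B, hA, hB, rfl⟩ : ∃ A B : Matrix (Fin d) (Fin d) ℂ, A.IsHermitian ∧ B.IsHermitian ∧
      M = A + Complex.I • B := by
    refine ⟨(realPart M : Matrix (Fin d) (Fin d) ℂ), (imaginaryPart M : Matrix (Fin d) (Fin d) ℂ),
      (realPart M).2, (imaginaryPart M).2, (realPart_add_I_smul_imaginaryPart M).symm⟩
  ext a b
  -- An entry of the commutator at `A + s B` is polynomial in `s`. It vanishes for real `s`, where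
  -- the matrix is Hermitian, hence also at `s = i`.
  let q : ℂ[X] := ∑ c, (∏ i, (C (A (a i) (c i)) + X * C (B (a i) (c i)))) * C (Y c b) -
    ∑ c, C (Y a c) * ∏ i, (C (A (c i) (b i)) + X * C (B (c i) (b i)))
  have hq (s : ℂ) : q.eval s = (tensorPower n (A + s • B) * Y) a b - (Y * tensorPower n (A + s • B)) a b := by
    simp [q, eval_finsetSum, eval_prod, Matrix.mul_apply, tensorPower, mul_comm s]
  have h0 : q = 0 := by
    refine Polynomial.eq_zero_of_infinite_isRoot q ?_
    refine Set.Infinite.mono ?_ (Set.infinite_range_of_injective Complex.ofReal_injective)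
    rintro _ ⟨s, rfl⟩
    have hs : (A + (s : ℂ) • B).IsHermitian := hA.add (by
      rw [Matrix.IsHermitian, Matrix.conjTranspose_smul, hB.eq]
      simp)
    change q.eval (s : ℂ) = 0
    rw [hq, comm_hermitian hY hs, sub_self]
  have := hq Complex.I
  rw [h0, eval_zero] at this
  exact (sub_eq_zero.mp this.symm)

/-- The multiset of pairs `(a i, b i)`, as an exponent vector. -/
def pairContent (a b : Idx n d) : Fin d × Fin d →₀ ℕ := ∑ i, Finsupp.single (a i, b i) 1

lemma exists_perm_of_pairContent_eq {a b a' b' : Idx n d} (h : pairContent a b = pairContent a' b') :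
    ∃ π : Equiv.Perm (Fin n), a' ∘ π = a ∧ b' ∘ π = b := by
  classical
  have hcard (a b : Idx n d) (c : Fin d × Fin d) :
      Fintype.card {i // (a i, b i) = c} = pairContent a b c := by
    rw [pairContent, Finsupp.finsetSum_apply, Fintype.card_subtype, Finset.card_filter]
    exact Finset.sum_congr rfl fun i _ => by rw [Finsupp.single_apply]
  let π : Equiv.Perm (Fin n) := Equiv.ofFiberEquiv (f := fun i => (a i, b i)) (g := fun i => (a' i, b' i))
    fun c => Fintype.equivOfCardEq (by rw [hcard, hcard, h])
  have hπ (i : Fin n) : (a' (π i), b' (π i)) = (a i, b i) :=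
    Equiv.ofFiberEquiv_map (f := fun i => (a i, b i)) (g := fun i => (a' i, b' i)) _ i
  exact ⟨π, funext fun i => (Prod.ext_iff.mp (hπ i)).1, funext fun i => (Prod.ext_iff.mp (hπ i)).2⟩

open MvPolynomial in
/-- An operator commuting with `V^{⊗n}` for all unitary `V` commutes with every
permutation-invariant operator. -/
theorem comm_of_isPermInvariant (hY : ∀ V : Matrix.unitaryGroup (Fin d) ℂ,
      tensorPower n (V : Matrix (Fin d) (Fin d) ℂ) * Y = Y * tensorPower n (V : Matrix (Fin d) (Fin d) ℂ))
    {X : Op n d} (hX : IsPermInvariant X) : X * Y = Y * X := by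
  classical
  -- Index pairs with the same multiset of letter pairs lie in one orbit of `S_n`, so an invariant
  -- operator is a function of that multiset.
  obtain ⟨x, hx⟩ : ∃ x : (Fin d × Fin d →₀ ℕ) → ℂ, ∀ a b, x (pairContent a b) = X a b := by
    refine ⟨fun κ => if h : ∃ ab : Idx n d × Idx n d, pairContent ab.1 ab.2 = κ then
      X h.choose.1 h.choose.2 else 0, fun a b => ?_⟩
    have h : ∃ ab : Idx n d × Idx n d, pairContent ab.1 ab.2 = pairContent a b := ⟨(a, b), rfl⟩
    simp only [dif_pos h]
    obtain ⟨π, h1, h2⟩ := exists_perm_of_pairContent_eq h.choose_spec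
    have := congrFun (congrFun (hX π) a) b
    rw [← h1, ← h2]
    exact this
  -- Commuting with all `M^{⊗n}` is a polynomial identity in the entries of `M`; the functional `L`
  -- turns each monomial into the corresponding entry of `X`.
  let L : MvPolynomial (Fin d × Fin d) ℂ →ₗ[ℂ] ℂ := (basisMonomials (Fin d × Fin d) ℂ).constr ℂ x
  have hL (a b : Idx n d) (y : ℂ) :
      L (y • ∏ i, (MvPolynomial.X (a i, b i) : MvPolynomial (Fin d × Fin d) ℂ)) = y * X a b := by
    have : ∏ i, (MvPolynomial.X (a i, b i) : MvPolynomial (Fin d × Fin d) ℂ)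
        = basisMonomials (Fin d × Fin d) ℂ (pairContent a b) := by
      rw [coe_basisMonomials]
      exact (MvPolynomial.monomial_sum_one _ _).symm
    rw [this, map_smul, Module.Basis.constr_basis, hx, smul_eq_mul]
  ext a b
  have hpoly : ∑ c, Y c b • ∏ i, (MvPolynomial.X (a i, c i) : MvPolynomial (Fin d × Fin d) ℂ) =
      ∑ c, Y a c • ∏ i, (MvPolynomial.X (c i, b i) : MvPolynomial (Fin d × Fin d) ℂ) := by
    refine MvPolynomial.funext fun s => ?_
    have := congrFun (congrFun (comm_tensorPower hY (Matrix.of fun i j => s (i, j))) a) b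
    simp only [Matrix.mul_apply, tensorPower, Matrix.of_apply] at this
    simp only [map_sum, smul_eval, map_prod, eval_X]
    rw [← this]
    exact Finset.sum_congr rfl fun c _ => mul_comm _ _
  have := congrArg L hpoly
  simp only [map_sum, hL] at this
  rw [Matrix.mul_apply, Matrix.mul_apply, ← this]
  exact Finset.sum_congr rfl fun c _ => mul_comm _ _

end DoubleCommutant

/-- The average over conjugation with permutations. -/
def twirl (n d : ℕ) : Op n d →ₗ[ℂ] Op n d where
  toFun X := (n.factorial : ℂ)⁻¹ • ∑ h : Equiv.Perm (Fin n), permMat d h * X * permMat d h⁻¹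
  map_add' X Y := by simp only [mul_add, add_mul, Finset.sum_add_distrib, smul_add]
  map_smul' c X := by
    simp only [Matrix.mul_smul, Matrix.smul_mul, ← Finset.smul_sum, RingHom.id_apply]
    rw [smul_comm]

lemma twirl_apply (X : Op n d) : twirl n d X =
    (n.factorial : ℂ)⁻¹ • ∑ h : Equiv.Perm (Fin n), permMat d h * X * permMat d h⁻¹ := rfl

lemma twirl_isPermInvariant (X : Op n d) : IsPermInvariant (twirl n d X) := by
  rw [isPermInvariant_iff]
  intro π
  rw [twirl_apply, Matrix.mul_smul, Matrix.smul_mul, Finset.mul_sum, Finset.sum_mul]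
  rw [← Equiv.sum_comp (Equiv.mulLeft π) fun h => permMat d h * X * permMat d h⁻¹ * permMat d π]
  refine congrArg _ (Finset.sum_congr rfl fun h _ => ?_)
  rw [Equiv.coe_mulLeft, mul_inv_rev, permMat_mul, permMat_mul]
  simp only [Matrix.mul_assoc]
  rw [permMat_inv_mul, Matrix.mul_one]

lemma twirl_mul_left {Z : Op n d} (hZ : IsPermInvariant Z) (X : Op n d) :
    twirl n d (Z * X) = Z * twirl n d X := by
  rw [twirl_apply, twirl_apply, Matrix.mul_smul, Finset.mul_sum]
  refine congrArg _ (Finset.sum_congr rfl fun h _ => ?_)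
  rw [← Matrix.mul_assoc, isPermInvariant_iff.mp hZ]
  simp only [Matrix.mul_assoc]

lemma twirl_mul_right {Z : Op n d} (hZ : IsPermInvariant Z) (X : Op n d) :
    twirl n d (X * Z) = twirl n d X * Z := by
  rw [twirl_apply, twirl_apply, Matrix.smul_mul, Finset.sum_mul]
  refine congrArg _ (Finset.sum_congr rfl fun h _ => ?_)
  simp only [Matrix.mul_assoc]
  rw [← isPermInvariant_iff.mp hZ]

lemma twirl_one : twirl n d 1 = 1 := by
  rw [twirl_apply]
  simp only [Matrix.mul_one, permMat_mul_inv, Finset.sum_const, Finset.card_univ, Fintype.card_perm,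
    Fintype.card_fin]
  rw [← Nat.cast_smul_eq_nsmul ℂ, smul_smul, inv_mul_cancel₀, one_smul]
  exact Nat.cast_ne_zero.mpr n.factorial_ne_zero

lemma twirl_of_isPermInvariant {Z : Op n d} (hZ : IsPermInvariant Z) : twirl n d Z = Z := by
  have := twirl_mul_left hZ 1
  rwa [Matrix.mul_one, twirl_one, Matrix.mul_one] at this

lemma trace_twirl (X : Op n d) : (twirl n d X).trace = X.trace := by
  have h (g : Equiv.Perm (Fin n)) : (permMat d g * X * permMat d g⁻¹).trace = X.trace := by
    rw [Matrix.trace_mul_comm, ← Matrix.mul_assoc, permMat_inv_mul, Matrix.one_mul]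
  rw [twirl_apply, Matrix.trace_smul, Matrix.trace_sum, Finset.sum_congr rfl fun g _ => h g]
  simp only [Finset.sum_const, Finset.card_univ, Fintype.card_perm, Fintype.card_fin]
  rw [← Nat.cast_smul_eq_nsmul ℂ, smul_smul, inv_mul_cancel₀, one_smul]
  exact Nat.cast_ne_zero.mpr n.factorial_ne_zero

lemma isoProj_eq_twirl : isoProj m = (dimV m : ℂ) • twirl n d (weylProj m) := by
  rw [isoProj_eq, toOp_isoIdem, twirl_apply, smul_smul, div_eq_mul_inv]

lemma schur_one_ge : 1 ≤ schur m.1 (fun _ => 1) := by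
  have := prod_pow_le_schur (m := m) (t := fun _ => 1) fun _ => zero_le_one
  simpa using this

lemma dimU_pos : 0 < dimU m := by
  have h1 := schur_one_ge (m := m)
  rw [← dimU_eq] at h1
  exact_mod_cast lt_of_lt_of_le one_pos h1

lemma weylProj_ne_zero : weylProj m ≠ 0 := by
  intro h
  have h1 := trace_weylProj (m := m)
  rw [h, Matrix.trace_zero] at h1
  exact dimU_pos.ne (by exact_mod_cast h1)

/-- Primitivity turns each `e g e` into a multiple of `e`, so compressing the average returns `e X
e` up to one constant. Were it zero, then `e = e P e`, with `P` a multiple of the average of `e`,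
would vanish. Every operator on the range of `e` is thus a compressed invariant operator. -/
lemma weylProj_corner : ∃ C : ℂ, C ≠ 0 ∧ ∀ X : Op n d,
    weylProj m * twirl n d (weylProj m * X * weylProj m) * weylProj m
      = C • (weylProj m * X * weylProj m) := by
  have h (g : Equiv.Perm (Fin n)) : ∃ c : ℂ,
      weylProj m * permMat d g * weylProj m = c • weylProj m := by
    obtain ⟨c, hc⟩ := (youngProj_isPrimitive (m := m)).corner (MonoidAlgebra.single g 1)
    refine ⟨c, ?_⟩
    have := congrArg (toOp n d) hc
    rwa [map_mul, map_mul, map_smul, toOp_single, one_smul] at this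
  choose c hc using h
  have key (X : Op n d) : weylProj m * twirl n d (weylProj m * X * weylProj m) * weylProj m
      = ((n.factorial : ℂ)⁻¹ * ∑ g, c g * c g⁻¹) • (weylProj m * X * weylProj m) := by
    rw [twirl_apply, Matrix.mul_smul, Matrix.smul_mul, Finset.mul_sum, Finset.sum_mul, mul_smul,
      Finset.sum_smul]
    congr 1
    refine Finset.sum_congr rfl fun g _ => ?_
    calc weylProj m * (permMat d g * (weylProj m * X * weylProj m) * permMat d g⁻¹) * weylProj m
        = (weylProj m * permMat d g * weylProj m) * X * (weylProj m * permMat d g⁻¹ * weylProj m) := by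
          simp only [Matrix.mul_assoc]
      _ = _ := by
          rw [hc, hc, Matrix.smul_mul, Matrix.mul_smul, Matrix.smul_mul, smul_smul, mul_comm]
  refine ⟨_, fun h0 => ?_, key⟩
  have h1 := key 1
  rw [h0, zero_smul, Matrix.mul_one, weylProj_mul_self] at h1
  refine weylProj_ne_zero (m := m) ?_
  calc weylProj m = weylProj m * isoProj m * weylProj m := by
        rw [weylProj_mul_isoProj, weylProj_mul_self]
    _ = 0 := by
        rw [isoProj_eq_twirl, Matrix.mul_smul, Matrix.smul_mul, h1, smul_zero]

/-- Schur's lemma for the range of `weylProj m`. -/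
theorem trace_smul_weylProj_mul {Y : Op n d} (hY : IsPermInvariant Y)
    (hc : ∀ X, IsPermInvariant X → X * Y = Y * X) :
    (weylProj m).trace • (weylProj m * Y) = (weylProj m * Y).trace • weylProj m := by
  obtain ⟨C, hC, hX⟩ := weylProj_corner (m := m)
  have hp : weylProj m * Y = Y * weylProj m := toOp_comm hY _
  -- `Y` commutes with every operator on the range of `weylProj m`; testing on matrix units and
  -- summing over a diagonal index gives the scalar.
  have h1 (X : Op n d) : weylProj m * X * weylProj m * Y = Y * (weylProj m * X * weylProj m) := by
    have h := hc _ (twirl_isPermInvariant (weylProj m * X * weylProj m))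
    have : C • (weylProj m * X * weylProj m * Y) = C • (Y * (weylProj m * X * weylProj m)) := by
      rw [show C • (weylProj m * X * weylProj m * Y) = (C • (weylProj m * X * weylProj m)) * Y from
        (Matrix.smul_mul _ _ _).symm, ← Matrix.mul_smul Y C, ← hX, Matrix.mul_assoc _ _ Y, hp, ← Matrix.mul_assoc, Matrix.mul_assoc (weylProj m) _ Y, h,
        ← Matrix.mul_assoc, hp]
      simp only [Matrix.mul_assoc]
    exact smul_right_injective _ hC this
  ext b j
  have h2 (a : Idx n d) : weylProj m a a * (weylProj m * Y) b j
      = (weylProj m * Y) a a * weylProj m b j := by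
    have := congrFun (congrFun (h1 (Matrix.single a b 1)) a) j
    have e1 : weylProj m * Matrix.single a b 1 * weylProj m * Y =
        weylProj m * Matrix.single a b 1 * (weylProj m * Y) := by simp only [Matrix.mul_assoc]
    have e2 : Y * (weylProj m * Matrix.single a b 1 * weylProj m) =
        (weylProj m * Y) * Matrix.single a b 1 * weylProj m := by
      rw [hp]; simp only [Matrix.mul_assoc]
    rwa [e1, e2, mul_single_mul_apply, mul_single_mul_apply] at this
  rw [Matrix.smul_apply, Matrix.smul_apply, smul_eq_mul, smul_eq_mul, Matrix.trace, Matrix.trace,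
    Finset.sum_mul, Finset.sum_mul]
  exact Finset.sum_congr rfl fun a _ => h2 a

/-- `weylProj m` commutes with `U^{⊗n}`, so the trace of the integrand does not depend on `U`. -/
lemma trace_weylProj_mul_haarIID (t : Fin d → ℝ) :
    (weylProj m * haarIID n t).trace = schur m.1 t := by
  have h1 : (weylProj m * haarIID n t).trace = ∑ a, ∑ b, weylProj m b a * haarIID n t a b := by
    simp only [Matrix.trace, Matrix.diag_apply, Matrix.mul_apply]
    exact Finset.sum_comm
  have h2 (U) : ∑ a, ∑ b, weylProj m b a * rotated n t U a b = schur m.1 t := by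
    calc _ = (weylProj m * rotated n t U).trace := by
          simp only [Matrix.trace, Matrix.diag_apply, Matrix.mul_apply]
          exact Finset.sum_comm
      _ = _ := by
          rw [rotated_eq, ← Matrix.mul_assoc, ← Matrix.mul_assoc, weylProj,
            toOp_comm (tensorPower_isPermInvariant _), Matrix.trace_mul_comm, Matrix.mul_assoc,
            ← Matrix.mul_assoc, tensorPower_unitary_mul, Matrix.one_mul]
          exact trace_weylProj_diagonal t
  rw [h1, sum_mul_haarIID]
  simp only [h2]
  simp

theorem weylProj_mul_haarIID (t : Fin d → ℝ) :
    (dimU m : ℂ) • (weylProj m * haarIID n t) = (schur m.1 t : ℂ) • weylProj m := by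
  rw [← trace_weylProj, ← trace_weylProj_mul_haarIID]
  exact trace_smul_weylProj_mul (haarIID_isPermInvariant t) fun X hX =>
    comm_of_isPermInvariant (haarIID_comm_unitary t) hX

end QDF
end

/-! ### Kraus maps and complete positivity -/

noncomputable section
namespace QDF

variable {n d : ℕ} {m : YoungDiag n d}

/-- The completely positive map with Kraus operators `K`. -/
def krausMap {ι κ : Type*} [Fintype ι] [Fintype κ] (K : κ → Matrix ι ι ℂ) :
    Matrix ι ι ℂ →ₗ[ℂ] Matrix ι ι ℂ where
  toFun X := ∑ k, K k * X * (K k).conjTranspose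
  map_add' X Y := by simp only [mul_add, add_mul, Finset.sum_add_distrib]
  map_smul' c X := by simp only [Matrix.mul_smul, Matrix.smul_mul, ← Finset.smul_sum, RingHom.id_apply]

lemma krausMap_apply {ι κ : Type*} [Fintype ι] [Fintype κ] (K : κ → Matrix ι ι ℂ) (X : Matrix ι ι ℂ) :
    krausMap K X = ∑ k, K k * X * (K k).conjTranspose := rfl

section CompletelyPositive

open scoped Matrix.Norms.L2Operator

/-- The amplified map is a sum of conjugations by block-diagonal copies of the Kraus operators. -/
lemma krausMap_cstarMatrix_nonneg {ι κ : Type*} [Fintype ι] [DecidableEq ι] [Fintype κ]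
    (K : κ → Matrix ι ι ℂ) (k : ℕ) (M : CStarMatrix (Fin k) (Fin k) (Matrix ι ι ℂ)) (hM : 0 ≤ M) :
    0 ≤ M.map (krausMap K) := by
  have h : M.map (krausMap K) = ∑ j, CStarMatrix.ofMatrix (Matrix.diagonal fun _ : Fin k => K j) * M *
      star (CStarMatrix.ofMatrix (Matrix.diagonal fun _ : Fin k => K j)) := by
    refine CStarMatrix.ext fun a b => ?_
    have hsum (f : κ → CStarMatrix (Fin k) (Fin k) (Matrix ι ι ℂ)) :
        (∑ j, f j) a b = ∑ j, f j a b := Matrix.sum_apply a b Finset.univ f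
    rw [hsum, CStarMatrix.map_apply, krausMap_apply]
    refine Finset.sum_congr rfl fun j _ => ?_
    let M' : Matrix (Fin k) (Fin k) (Matrix ι ι ℂ) := CStarMatrix.ofMatrix.symm M
    have h2 : ((Matrix.diagonal fun _ : Fin k => K j) * M' *
        (Matrix.diagonal fun _ : Fin k => K j).conjTranspose) a b
        = K j * M a b * (K j).conjTranspose := by
      rw [Matrix.diagonal_conjTranspose, Matrix.mul_diagonal, Matrix.diagonal_mul]
      rfl
    exact h2.symm
  rw [h]
  exact Finset.sum_nonneg fun j _ => star_right_conjugate_nonneg hM _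

lemma isCPTP_krausMap {ι κ : Type*} [Fintype ι] [DecidableEq ι] [Fintype κ] (K : κ → Matrix ι ι ℂ)
    (htr : ∀ X, (krausMap K X).trace = X.trace) : IsCPTP (krausMap K) :=
  ⟨⟨⟨krausMap K, krausMap_cstarMatrix_nonneg K⟩, rfl⟩, htr⟩

end CompletelyPositive

/-! ### Support projections -/

section Support

lemma isStarProjection_le_of_mul_eq {ι : Type*} [Fintype ι] {Q Q' : Matrix ι ι ℂ} (hQ : IsStarProjection Q)
    (hQ' : IsStarProjection Q') (h : Q' * Q = Q) : Q ≤ Q' := by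
  have h' : Q * Q' = Q := by
    have := congrArg star h
    rwa [star_mul, hQ.2.star_eq, hQ'.2.star_eq] at this
  rw [Matrix.le_iff]
  have h1 : (Q' - Q).conjTranspose = Q' - Q := by
    rw [← Matrix.star_eq_conjTranspose, star_sub, hQ.2.star_eq, hQ'.2.star_eq]
  have h2 := Matrix.posSemidef_conjTranspose_mul_self (Q' - Q)
  rw [h1, sub_mul, mul_sub, mul_sub, hQ'.1.eq, hQ.1.eq, h, h', sub_self, sub_zero] at h2
  exact h2

variable {ι : Type*} [Fintype ι] [DecidableEq ι]

open scoped Matrix.Norms.L2Operator in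
/-- A projection that captures the whole trace of a positive operator fixes the operator. -/
lemma mul_eq_of_trace_mul_eq {Q τ : Matrix ι ι ℂ} (hQ : IsStarProjection Q) (hτ : τ.PosSemidef)
    (h : (Q * τ).trace = τ.trace) : Q * τ = τ := by
  obtain ⟨B, rfl⟩ : ∃ B : Matrix ι ι ℂ, τ = B * B.conjTranspose :=
    CStarAlgebra.nonneg_iff_eq_mul_star_self.mp hτ.nonneg
  have hQh : Q.conjTranspose = Q := hQ.2
  have h0 : ((1 - Q) * B * ((1 - Q) * B).conjTranspose).trace = 0 := by
    have hQ1 : (1 - Q) * (1 - Q) = 1 - Q := by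
      rw [sub_mul, mul_sub, mul_sub, hQ.1.eq]; simp
    rw [Matrix.conjTranspose_mul, Matrix.conjTranspose_sub, Matrix.conjTranspose_one, hQh,
      ← Matrix.mul_assoc, Matrix.trace_mul_comm, ← Matrix.mul_assoc, ← Matrix.mul_assoc, hQ1,
      Matrix.mul_assoc, sub_mul, Matrix.trace_sub, h, Matrix.one_mul, sub_self]
  have h1 : (1 - Q) * B = 0 := Matrix.trace_mul_conjTranspose_self_eq_zero_iff.mp h0
  rw [sub_mul, Matrix.one_mul, sub_eq_zero] at h1
  rw [← Matrix.mul_assoc, ← h1]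

lemma exists_isSupportProjection {τ : Matrix ι ι ℂ} (hτ : τ.PosSemidef) :
    ∃ Q, IsSupportProjection τ Q := by
  have hs := hτ.1.spectral_theorem
  rw [Unitary.conjStarAlgAut_apply] at hs
  set U : Matrix ι ι ℂ := (hτ.1.eigenvectorUnitary : Matrix ι ι ℂ)
  have hU : star U * U = 1 := Matrix.mem_unitaryGroup_iff'.mp hτ.1.eigenvectorUnitary.2
  set l : ι → ℂ := RCLike.ofReal ∘ hτ.1.eigenvalues
  have hl (i : ι) : star (l i) = l i := RCLike.conj_ofReal _
  have hmul (x y : ι → ℂ) : (U * Matrix.diagonal x * star U) * (U * Matrix.diagonal y * star U)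
      = U * Matrix.diagonal (fun i => x i * y i) * star U := by
    calc _ = U * Matrix.diagonal x * (star U * U) * Matrix.diagonal y * star U := by
          simp only [Matrix.mul_assoc]
      _ = _ := by
          rw [hU, Matrix.mul_one, Matrix.mul_assoc U, Matrix.diagonal_mul_diagonal]
  -- The pseudo-inverse, as `0⁻¹ = 0`. The support is `τ * g`; a projection capturing the trace
  -- fixes `τ` and therefore `τ * g`.
  set g := U * Matrix.diagonal (fun i => (l i)⁻¹) * star U
  have hQ : τ * g = U * Matrix.diagonal (fun i => l i * (l i)⁻¹) * star U := by
    conv_lhs => rw [hs]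
    exact hmul _ _
  have hproj : IsStarProjection (τ * g) := by
    rw [hQ]
    refine ⟨?_, ?_⟩
    · rw [IsIdempotentElem, hmul]
      congr 3
      funext i
      rcases eq_or_ne (l i) 0 with h | h <;> simp [h]
    · rw [IsSelfAdjoint, star_mul, star_mul, star_star, ← Matrix.mul_assoc, Matrix.star_eq_conjTranspose,
        Matrix.diagonal_conjTranspose]
      congr 3
      funext i
      simp [hl]
  have hfix : τ * g * τ = τ := by
    conv_lhs => rw [hQ]
    conv_lhs => rw [hs]
    conv_rhs => rw [hs]
    rw [hmul]
    congr 3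
    funext i
    rcases eq_or_ne (l i) 0 with h | h <;> simp [h]
  refine ⟨τ * g, ⟨hproj, by rw [hfix]⟩, fun Q' hQ' => ?_⟩
  refine isStarProjection_le_of_mul_eq hproj hQ'.1 ?_
  rw [← Matrix.mul_assoc, mul_eq_of_trace_mul_eq hQ'.1 hτ hQ'.2]

end Support

/-! ### Kraus maps in the presence of a side system -/

section SideSystem

variable {E : Type*} [NormedAddCommGroup E] [InnerProductSpace ℂ E]

lemma extendE_mul (X Y : Op n d) : extendE E (X * Y) = extendE E X * extendE E Y :=
  Matrix.map_mul

lemma extendE_one : extendE E (1 : Op n d) = 1 := by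
  simp [extendE, Matrix.map_one]

lemma extendE_sum {κ : Type*} [Fintype κ] (X : κ → Op n d) :
    extendE E (∑ k, X k) = ∑ k, extendE E (X k) := by
  ext1 i j
  simp [extendE, Matrix.sum_apply]

lemma extendE_mul_mul_apply (A B : Op n d) (ρ : OpE n d E) (i j : Idx n d) :
    (extendE E A * ρ * extendE E B) i j = ∑ a, ∑ b, (A i a * B b j) • ρ a b := by
  simp only [Matrix.mul_apply, Finset.sum_mul, extendE, Matrix.map_apply]
  rw [Finset.sum_comm]
  refine Finset.sum_congr rfl fun a _ => Finset.sum_congr rfl fun b _ => ?_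
  rw [← Algebra.commutes, ← mul_assoc, ← map_mul, mul_comm (B b j), Algebra.smul_def]

lemma ampliate_krausMap {κ : Type*} [Fintype κ] (K : κ → Op n d) (ρ : OpE n d E) :
    ampliate (krausMap K) ρ =
      ∑ k, extendE E (K k) * ρ * extendE E (K k).conjTranspose := by
  ext1 i j
  simp only [ampliate, Matrix.of_apply, Matrix.sum_apply, extendE_mul_mul_apply, krausMap_apply,
    mul_single_mul_apply, Finset.sum_smul]
  rw [Finset.sum_congr rfl fun a _ => Finset.sum_comm, Finset.sum_comm]

lemma ampliate_krausMap_conj {κ : Type*} [Fintype κ] {K : κ → Op n d} {P : Op n d}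
    (h : ∀ k, K k * P = P * K k) (h' : ∀ k, (K k).conjTranspose * P = P * (K k).conjTranspose)
    (ρ : OpE n d E) :
    ampliate (krausMap K) (extendE E P * ρ * extendE E P) =
      extendE E P * ampliate (krausMap K) ρ * extendE E P := by
  rw [ampliate_krausMap, ampliate_krausMap, Finset.mul_sum, Finset.sum_mul]
  refine Finset.sum_congr rfl fun k _ => ?_
  calc extendE E (K k) * (extendE E P * ρ * extendE E P) * extendE E (K k).conjTranspose
      = (extendE E (K k) * extendE E P) * ρ * (extendE E P * extendE E (K k).conjTranspose) := by
        simp only [Matrix.mul_assoc]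
    _ = _ := by
        rw [← extendE_mul, ← extendE_mul, h, ← h', extendE_mul, extendE_mul]
        simp only [Matrix.mul_assoc]

lemma extendE_permMat_comm {ρ : OpE n d E} (hρ : IsPermInvariant ρ) (π : Equiv.Perm (Fin n)) :
    extendE E (permMat d π) * ρ = ρ * extendE E (permMat d π) := by
  have h1 (σ : Equiv.Perm (Fin n)) : extendE E (permMat d σ) * ρ * extendE E (permMat d σ⁻¹) = ρ := by
    conv_rhs => rw [← hρ σ]
    ext1 i j
    rw [extendE_mul_mul_apply, Matrix.submatrix_apply, Finset.sum_eq_single (i ∘ σ),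
      Finset.sum_eq_single (j ∘ σ)]
    · have : (j ∘ σ) ∘ ⇑σ⁻¹ = j := by funext x; simp
      have e1 : permMat d σ i (i ∘ σ) = 1 := if_pos rfl
      have e2 : permMat d σ⁻¹ (j ∘ σ) j = 1 := if_pos this
      rw [e1, e2, mul_one, one_smul]
    · intro b _ hb
      have : b ∘ ⇑σ⁻¹ ≠ j := by
        rintro rfl
        exact hb (by funext x; simp)
      have e2 : permMat d σ⁻¹ b j = 0 := if_neg this
      rw [e2, mul_zero, zero_smul]
    · simp
    · intro a _ ha
      simp [permMat, ha.symm]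
    · simp
  conv_rhs => rw [← h1 π]
  rw [Matrix.mul_assoc _ (extendE E (permMat d π⁻¹)), ← extendE_mul, permMat_inv_mul, extendE_one,
    Matrix.mul_one]

lemma extendE_toOp_comm {ρ : OpE n d E} (hρ : IsPermInvariant ρ) (x : GroupAlg n) :
    extendE E (toOp n d x) * ρ = ρ * extendE E (toOp n d x) := by
  have h (c : ℂ) (X : Op n d) : extendE E (c • X) = c • extendE E X := by
    ext1 i j
    change algebraMap ℂ (E →L[ℂ] E) (c * X i j) = c • algebraMap ℂ (E →L[ℂ] E) (X i j)
    rw [map_mul, Algebra.smul_def]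
  rw [toOp_eq_sum, extendE_sum, Finset.sum_mul, Finset.mul_sum]
  refine Finset.sum_congr rfl fun g _ => ?_
  rw [h, Matrix.smul_mul, extendE_permMat_comm hρ, Matrix.mul_smul]

/-- Kraus operators from the group algebra act on the `A` part only and commute with an invariant
state, which can be pulled out, leaving the map applied to `1`. -/
lemma ampliate_krausMap_of_unital {κ : Type*} [Fintype κ] {K : κ → Op n d}
    (hK : ∀ k, ∃ x, K k = toOp n d x) (h1 : krausMap K 1 = 1) {ρ : OpE n d E}
    (hρ : IsPermInvariant ρ) : ampliate (krausMap K) ρ = ρ := by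
  have h (k : κ) : extendE E (K k) * ρ * extendE E (K k).conjTranspose
      = ρ * extendE E (K k * 1 * (K k).conjTranspose) := by
    obtain ⟨x, hx⟩ := hK k
    rw [hx, extendE_toOp_comm hρ, Matrix.mul_assoc, ← extendE_mul, Matrix.mul_one]
  rw [ampliate_krausMap, Finset.sum_congr rfl fun k _ => h k, ← Finset.mul_sum, ← extendE_sum,
    ← krausMap_apply, h1, extendE_one, Matrix.mul_one]

end SideSystem

/-! ### The twirling and compressing channels -/

lemma krausMap_comp {ι κ κ' : Type*} [Fintype ι] [Fintype κ] [Fintype κ'] (K : κ → Matrix ι ι ℂ)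
    (K' : κ' → Matrix ι ι ℂ) :
    krausMap K ∘ₗ krausMap K' = krausMap fun k : κ × κ' => K k.1 * K' k.2 := by
  refine LinearMap.ext fun X => ?_
  rw [LinearMap.comp_apply, krausMap_apply, krausMap_apply, krausMap_apply, Fintype.sum_prod_type]
  refine Finset.sum_congr rfl fun k _ => ?_
  rw [Finset.mul_sum, Finset.sum_mul]
  refine Finset.sum_congr rfl fun k' _ => ?_
  rw [Matrix.conjTranspose_mul]
  simp only [Matrix.mul_assoc]

/-- Kraus operators of the twirling channel. -/
def twirlKraus (n d : ℕ) (h : Equiv.Perm (Fin n)) : Op n d :=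
  ((√((n.factorial : ℝ)⁻¹) : ℝ) : ℂ) • permMat d h

/-- Kraus operators of the channel that compresses each isotypic component to a copy of `U_m`. -/
def schurKraus (n d : ℕ) (k : YoungDiag n d × Equiv.Perm (Fin n)) : Op n d :=
  ((√(dimV k.1 : ℝ) : ℝ) : ℂ) • weylProj k.1 * twirlKraus n d k.2

lemma ofReal_sqrt_mul_self {x : ℝ} (hx : 0 ≤ x) : ((√x : ℝ) : ℂ) * ((√x : ℝ) : ℂ) = x := by
  rw [← Complex.ofReal_mul, Real.mul_self_sqrt hx]

lemma krausMap_twirlKraus : krausMap (twirlKraus n d) = twirl n d := by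
  refine LinearMap.ext fun X => ?_
  rw [krausMap_apply, twirl_apply, Finset.smul_sum]
  refine Finset.sum_congr rfl fun h _ => ?_
  rw [twirlKraus, Matrix.conjTranspose_smul, permMat_conjTranspose, Matrix.smul_mul, Matrix.smul_mul,
    Matrix.mul_smul, smul_smul, RCLike.star_def, Complex.conj_ofReal,
    ofReal_sqrt_mul_self (by positivity)]
  push_cast
  rfl

lemma krausMap_schurKraus (X : Op n d) : krausMap (schurKraus n d) X =
    ∑ m : YoungDiag n d, (dimV m : ℝ) • (weylProj m * twirl n d X * weylProj m) := by
  rw [krausMap_apply, Fintype.sum_prod_type]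
  refine Finset.sum_congr rfl fun m _ => ?_
  rw [← krausMap_twirlKraus, krausMap_apply, Finset.mul_sum, Finset.sum_mul, Finset.smul_sum]
  refine Finset.sum_congr rfl fun h _ => ?_
  rw [schurKraus, Matrix.conjTranspose_mul, Matrix.conjTranspose_smul, weylProj_isHermitian.eq]
  simp only [Matrix.smul_mul, Matrix.mul_smul, smul_smul, RCLike.star_def, Complex.conj_ofReal,
    Matrix.mul_assoc]
  rw [ofReal_sqrt_mul_self (by positivity)]
  rfl

lemma isCPTP_twirl : IsCPTP (krausMap (twirlKraus n d)) :=
  isCPTP_krausMap _ fun X => by rw [krausMap_twirlKraus, trace_twirl]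

/-- The weight `dimV m` makes the compressed sector carry the trace of `isoProj m` against the
averaged operator, and these projections sum to the identity. -/
lemma isCPTP_schur : IsCPTP (krausMap (schurKraus n d)) := by
  refine isCPTP_krausMap _ fun X => ?_
  have h (m : YoungDiag n d) : ((dimV m : ℝ) • (weylProj m * twirl n d X * weylProj m)).trace
      = (isoProj m * twirl n d X).trace := by
    rw [trace_isoProj_mul (twirl_isPermInvariant X), Matrix.trace_smul, Matrix.trace_mul_comm,
      ← Matrix.mul_assoc, weylProj_mul_self]
    simp
  rw [krausMap_schurKraus, Matrix.trace_sum, Finset.sum_congr rfl fun m _ => h m, ← Matrix.trace_sum,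
    ← Finset.sum_mul, sum_isoProj, Matrix.one_mul, trace_twirl]

lemma twirlKraus_eq_toOp (h : Equiv.Perm (Fin n)) : ∃ x, twirlKraus n d h = toOp n d x :=
  ⟨_, (toOp_single h _).symm⟩

lemma schurKraus_eq_toOp (k : YoungDiag n d × Equiv.Perm (Fin n)) :
    ∃ x, schurKraus n d k = toOp n d x := by
  obtain ⟨x, hx⟩ := twirlKraus_eq_toOp (d := d) k.2
  refine ⟨((√(dimV k.1 : ℝ) : ℝ) : ℂ) • youngProj k.1 * x, ?_⟩
  rw [schurKraus, hx, map_mul, map_smul, weylProj]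

lemma schurKraus_comm_isoProj (k : YoungDiag n d × Equiv.Perm (Fin n)) :
    schurKraus n d k * isoProj m = isoProj m * schurKraus n d k := by
  obtain ⟨x, hx⟩ := schurKraus_eq_toOp k
  rw [hx, isoProj_mul_toOp]

lemma schurKraus_conjTranspose_comm_isoProj (k : YoungDiag n d × Equiv.Perm (Fin n)) :
    (schurKraus n d k).conjTranspose * isoProj m = isoProj m * (schurKraus n d k).conjTranspose := by
  have := congrArg Matrix.conjTranspose (schurKraus_comm_isoProj (m := m) k)
  rw [Matrix.conjTranspose_mul, Matrix.conjTranspose_mul, isoProj_isHermitian.eq] at this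
  exact this.symm

lemma smul_twirl_weylProj : (dimV m : ℝ) • twirl n d (weylProj m) = isoProj m := by
  rw [isoProj_eq_twirl]
  rfl

lemma twirl_real_smul (c : ℝ) (X : Op n d) : twirl n d (c • X) = c • twirl n d X :=
  LinearMap.map_smul_of_tower _ c X

/-- The compressing channel sends `1` to the sum of the `dimV m` multiples of `weylProj m`, whose
averages are the `isoProj m`. -/
lemma twirl_schur_one : krausMap (fun k : Equiv.Perm (Fin n) × YoungDiag n d × Equiv.Perm (Fin n) =>
    twirlKraus n d k.1 * schurKraus n d k.2) 1 = 1 := by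
  rw [← krausMap_comp, LinearMap.comp_apply, krausMap_schurKraus, krausMap_twirlKraus, map_sum,
    ← sum_isoProj]
  refine Finset.sum_congr rfl fun m _ => ?_
  rw [sum_isoProj, twirl_one, Matrix.mul_one, weylProj_mul_self, twirl_real_smul, smul_twirl_weylProj]

/-- This is where the prefactor comes from: it normalizes the scalar by which the Haar average acts
on the range of `weylProj m`. -/
theorem fqDiag_smul_weylProj_mul_haarIID (hn : 0 < n) :
    (fqDiag m * dimV m) • (weylProj m * haarIID n (empirical m)) = weylProj m := by
  have h := weylProj_mul_haarIID (m := m) (empirical m)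
  have hs := schur_empirical_pos (m := m) hn
  have hv : (0 : ℝ) < dimV m := Nat.cast_pos.mpr dimV_pos
  have h1 : fqDiag m * dimV m = (schur m.1 (empirical m))⁻¹ * dimU m := by
    rw [fqDiag]
    field_simp
  have h' : (dimU m : ℝ) • (weylProj m * haarIID n (empirical m))
      = (schur m.1 (empirical m)) • weylProj m := h
  rw [h1, mul_smul, h', smul_smul, inv_mul_cancel₀ hs.ne', one_smul]

lemma fqDiag_nonneg (hn : 0 < n) : 0 ≤ fqDiag m := by
  have hs := schur_empirical_pos (m := m) hn
  rw [fqDiag]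
  positivity

lemma weylProj_isStarProjection : IsStarProjection (weylProj m) :=
  isStarProjection_of_isHermitian weylProj_isHermitian weylProj_mul_self

lemma krausMap_schurKraus_compress {ρ : Op n d} (hρ : IsPermInvariant ρ) :
    krausMap (schurKraus n d) (isoProj m * ρ * isoProj m)
      = (dimV m : ℝ) • (weylProj m * ρ * weylProj m) := by
  rw [krausMap_schurKraus, Finset.sum_eq_single m]
  · rw [twirl_mul_right isoProj_isPermInvariant, twirl_mul_left isoProj_isPermInvariant,
      twirl_of_isPermInvariant hρ]
    congr 1
    calc weylProj m * (isoProj m * ρ * isoProj m) * weylProj m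
        = (weylProj m * isoProj m) * ρ * (isoProj m * weylProj m) := by simp only [Matrix.mul_assoc]
      _ = _ := by rw [isoProj_mul_weylProj, weylProj_mul_isoProj]
  · intro m' _ hm
    have h0 : weylProj m' * isoProj m = 0 := by
      rw [← weylProj_mul_isoProj, Matrix.mul_assoc, isoProj_mul_isoProj hm, Matrix.mul_zero]
    rw [Matrix.mul_assoc (isoProj m), twirl_mul_left isoProj_isPermInvariant, ← Matrix.mul_assoc, h0,
      Matrix.zero_mul, Matrix.zero_mul, smul_zero]
  · simp

lemma posSemidef_real_smul {ι : Type*} [Fintype ι] {X : Matrix ι ι ℂ} (hX : X.PosSemidef) {c : ℝ}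
    (hc : 0 ≤ c) : (c • X).PosSemidef :=
  hX.smul hc

lemma weylProj_conj_posSemidef {X : Op n d} (hX : X.PosSemidef) :
    (weylProj m * X * weylProj m).PosSemidef := by
  have := hX.mul_mul_conjTranspose_same (weylProj m)
  rwa [weylProj_isHermitian.eq] at this

/-- `weylProj m` captures the whole trace of the compressed state, so the support lies below it. In
the scaled image of the Haar average the term of `m` is exactly `weylProj m`, and the terms of the
other diagrams are positive. -/
theorem exists_support_le (hn : 0 < n) {ρ : Op n d} (hρ : IsDensity ρ) (hinv : IsPermInvariant ρ) :
    ∃ Q : Op n d, IsSupportProjection (krausMap (schurKraus n d) (isoProj m * ρ * isoProj m)) Q ∧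
      Q ≤ fqDiag m • krausMap (schurKraus n d) (haarIID n (empirical m)) := by
  classical
  have hpos : (krausMap (schurKraus n d) (isoProj m * ρ * isoProj m)).PosSemidef := by
    rw [krausMap_schurKraus_compress hinv]
    exact posSemidef_real_smul (weylProj_conj_posSemidef hρ.1) (by positivity)
  obtain ⟨Q, hQ⟩ := exists_isSupportProjection hpos
  refine ⟨Q, hQ, (hQ.2 ⟨weylProj_isStarProjection (m := m), ?_⟩).trans ?_⟩
  · rw [krausMap_schurKraus_compress hinv, Matrix.mul_smul, ← Matrix.mul_assoc, ← Matrix.mul_assoc,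
      weylProj_mul_self]
  · have hcomm : weylProj m * haarIID n (empirical m) * weylProj m
        = weylProj m * haarIID n (empirical m) := by
      rw [Matrix.mul_assoc, weylProj, ← toOp_comm (haarIID_isPermInvariant _), ← weylProj,
        ← Matrix.mul_assoc, weylProj_mul_self]
    rw [krausMap_schurKraus, twirl_of_isPermInvariant (haarIID_isPermInvariant _),
      ← Finset.add_sum_erase _ _ (Finset.mem_univ m), smul_add, smul_smul, hcomm,
      fqDiag_smul_weylProj_mul_haarIID hn, Matrix.le_iff, add_sub_cancel_left]
    refine posSemidef_real_smul (Matrix.posSemidef_sum _ fun m' _ => ?_) (fqDiag_nonneg hn)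
    exact posSemidef_real_smul (weylProj_conj_posSemidef (haarIID_posSemidef empirical_nonneg))
      (by positivity)

/-! ### Domination by mixtures of Haar averages -/

section Mixture

variable {ρ : Op n d}

lemma twirl_posSemidef {X : Op n d} (hX : X.PosSemidef) : (twirl n d X).PosSemidef := by
  rw [← krausMap_twirlKraus, krausMap_apply]
  exact Matrix.posSemidef_sum _ fun h _ => hX.mul_mul_conjTranspose_same _

/-- A positive operator is at most its trace times the identity. -/
lemma PosSemidef.le_trace_smul_one {ι : Type*} [Fintype ι] [DecidableEq ι] {A : Matrix ι ι ℂ}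
    (hA : A.PosSemidef) : (A.trace.re • (1 : Matrix ι ι ℂ) - A).PosSemidef := by
  have hs := hA.1.spectral_theorem
  rw [Unitary.conjStarAlgAut_apply] at hs
  have htr := hA.1.trace_eq_sum_eigenvalues
  set U : Matrix ι ι ℂ := (hA.1.eigenvectorUnitary : Matrix ι ι ℂ)
  have hU : U * star U = 1 := Matrix.mem_unitaryGroup_iff.mp hA.1.eigenvectorUnitary.2
  have hre : A.trace.re = ∑ i, hA.1.eigenvalues i := by
    rw [htr]
    simp
  have h1 : A.trace.re • (1 : Matrix ι ι ℂ) - A = U * Matrix.diagonal (fun i =>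
      ((∑ j, hA.1.eigenvalues j - hA.1.eigenvalues i : ℝ) : ℂ)) * U.conjTranspose := by
    have h2 : Matrix.diagonal (fun i => ((∑ j, hA.1.eigenvalues j - hA.1.eigenvalues i : ℝ) : ℂ))
        = ((∑ j, hA.1.eigenvalues j : ℝ) : ℂ) • (1 : Matrix ι ι ℂ)
          - Matrix.diagonal (RCLike.ofReal ∘ hA.1.eigenvalues) := by
      rw [Matrix.smul_one_eq_diagonal, Matrix.diagonal_sub]
      congr 1
      funext i
      simp
    rw [h2, mul_sub, sub_mul, ← Matrix.star_eq_conjTranspose, ← hs, Matrix.mul_smul, Matrix.mul_one,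
      Matrix.smul_mul, hU, ← hre]
    rfl
  rw [h1]
  refine Matrix.PosSemidef.mul_mul_conjTranspose_same (Matrix.PosSemidef.diagonal fun i => ?_) _
  refine Complex.zero_le_real.mpr (sub_nonneg.mpr ?_)
  exact Finset.single_le_sum (fun j _ => hA.eigenvalues_nonneg j) (Finset.mem_univ i)

lemma isoProj_compress (hinv : IsPermInvariant ρ) : isoProj m * ρ * isoProj m = isoProj m * ρ := by
  rw [isoProj_eq, toOp_comm hinv, Matrix.mul_assoc, ← isoProj_eq, isoProj_mul_self]

lemma weylProj_compress (hinv : IsPermInvariant ρ) : weylProj m * ρ * weylProj m = weylProj m * ρ := by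
  rw [weylProj, toOp_comm hinv, Matrix.mul_assoc, ← weylProj, weylProj_mul_self]

lemma trace_weylProj_mul_eq (hρ : ρ.PosSemidef) (hinv : IsPermInvariant ρ) :
    (isoProj m * ρ).trace = (dimV m * (weylProj m * ρ).trace.re : ℝ) ∧
      0 ≤ (weylProj m * ρ).trace.re := by
  have h := (weylProj_conj_posSemidef (m := m) hρ).trace_nonneg
  rw [weylProj_compress hinv, Complex.nonneg_iff] at h
  refine ⟨?_, h.1⟩
  rw [trace_isoProj_mul hinv]
  apply Complex.ext
  · simp
  · simp [← h.2]

lemma isoWeight_eq (hρ : ρ.PosSemidef) (hinv : IsPermInvariant ρ) :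
    isoWeight m ρ = dimV m * (weylProj m * ρ).trace.re := by
  rw [isoWeight, (trace_weylProj_mul_eq hρ hinv).1, Complex.ofReal_re]

lemma isoWeight_nonneg (hρ : ρ.PosSemidef) (hinv : IsPermInvariant ρ) : 0 ≤ isoWeight m ρ := by
  rw [isoWeight_eq hρ hinv]
  exact mul_nonneg (by positivity) (trace_weylProj_mul_eq hρ hinv).2

lemma sum_isoWeight (hρ : IsDensity ρ) : ∑ m : YoungDiag n d, isoWeight m ρ = 1 := by
  have : ∑ m : YoungDiag n d, (isoProj m * ρ).trace = 1 := by
    rw [← Matrix.trace_sum, ← Finset.sum_mul, sum_isoProj, Matrix.one_mul, hρ.2]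
  have := congrArg Complex.re this
  rwa [Complex.re_sum, Complex.one_re] at this

lemma isoProj_mul_le (hn : 0 < n) (hρ : ρ.PosSemidef) (hinv : IsPermInvariant ρ) :
    isoProj m * ρ ≤ (fqDiag m * isoWeight m ρ) • (isoProj m * haarIID n (empirical m)) := by
  have hV : (0 : ℝ) < dimV m := Nat.cast_pos.mpr dimV_pos
  set r := (weylProj m * ρ).trace.re with hr
  -- On the range of `weylProj m` the state is at most its trace `r` times `weylProj m`, which is
  -- then rewritten through the Haar average; averaging carries the bound to the whole sector.
  have h1 : ((r * (fqDiag m * dimV m)) • (weylProj m * haarIID n (empirical m)) -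
      weylProj m * ρ).PosSemidef := by
    have h := weylProj_conj_posSemidef (m := m)
      (PosSemidef.le_trace_smul_one (weylProj_conj_posSemidef (m := m) hρ))
    rw [weylProj_compress hinv, ← hr, mul_sub, sub_mul, Matrix.mul_smul, Matrix.mul_one,
      Matrix.smul_mul, weylProj_mul_self, ← Matrix.mul_assoc, weylProj_mul_self,
      weylProj_compress hinv] at h
    rwa [mul_smul, fqDiag_smul_weylProj_mul_haarIID hn]
  have h2 (Z : Op n d) (hZ : IsPermInvariant Z) :
      (dimV m : ℝ) • twirl n d (weylProj m * Z) = isoProj m * Z := by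
    rw [twirl_mul_right hZ, ← Matrix.smul_mul, smul_twirl_weylProj]
  have h3 := posSemidef_real_smul (twirl_posSemidef h1) hV.le
  rw [map_sub, twirl_real_smul, smul_sub, smul_comm, h2 _ hinv, h2 _ (haarIID_isPermInvariant _)] at h3
  rw [Matrix.le_iff, isoWeight_eq hρ hinv, ← hr]
  rwa [show fqDiag m * (dimV m * r) = r * (fqDiag m * dimV m) by ring]

/-- The Haar average commutes with `isoProj m`, so the difference is its compression to the
complement. -/
lemma isoProj_mul_haarIID_le : isoProj m * haarIID n (empirical m) ≤ haarIID n (empirical m) := by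
  have hinv := haarIID_isPermInvariant (n := n) (empirical m)
  have h := (haarIID_posSemidef (n := n) (empirical_nonneg (m := m))).mul_mul_conjTranspose_same
    (1 - isoProj m)
  have hc : haarIID n (empirical m) * isoProj m = isoProj m * haarIID n (empirical m) := by
    rw [isoProj_eq, toOp_comm hinv]
  rw [Matrix.conjTranspose_sub, Matrix.conjTranspose_one, isoProj_isHermitian.eq, sub_mul,
    Matrix.one_mul, mul_sub, Matrix.mul_one, sub_mul, hc, isoProj_compress hinv, sub_self,
    sub_zero] at h
  exact h

lemma real_smul_le_smul {X Y : Op n d} (h : X ≤ Y) {c : ℝ} (hc : 0 ≤ c) : c • X ≤ c • Y := by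
  rw [Matrix.le_iff, ← smul_sub]
  exact posSemidef_real_smul (Matrix.le_iff.mp h) hc

theorem le_sum_fqDiag (hn : 0 < n) (hρ : IsDensity ρ) (hinv : IsPermInvariant ρ) :
    ρ ≤ ∑ m : YoungDiag n d, (fqDiag m * isoWeight m ρ) • haarIID n (empirical m) := by
  calc ρ = ∑ m : YoungDiag n d, isoProj m * ρ := by rw [← Finset.sum_mul, sum_isoProj, Matrix.one_mul]
    _ ≤ _ := Finset.sum_le_sum fun m _ => (isoProj_mul_le hn hρ.1 hinv).trans
        (real_smul_le_smul isoProj_mul_haarIID_le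
          (mul_nonneg (fqDiag_nonneg hn) (isoWeight_nonneg hρ.1 hinv)))

theorem le_fq_smul_sum (hd : 0 < d) (hn : 0 < n) (hρ : IsDensity ρ) (hinv : IsPermInvariant ρ) :
    ρ ≤ fq n d • ∑ m : YoungDiag n d, isoWeight m ρ • haarIID n (empirical m) := by
  refine (le_sum_fqDiag hn hρ hinv).trans ?_
  rw [Finset.smul_sum]
  refine Finset.sum_le_sum fun m _ => ?_
  rw [Matrix.le_iff, smul_smul, ← sub_smul, ← sub_mul]
  exact posSemidef_real_smul (haarIID_posSemidef empirical_nonneg)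
    (mul_nonneg (sub_nonneg.mpr (fqDiag_le_fq hd hn)) (isoWeight_nonneg hρ.1 hinv))

end Mixture

end QDF
end

theorem theorem1 (d : ℕ) (hd : 0 < d) :
    (∀ n : ℕ, 0 < n →
      -- the pair of channels
      (∃ S R : QDF.Op n d →ₗ[ℂ] QDF.Op n d, QDF.IsCPTP S ∧ QDF.IsCPTP R ∧
        -- (i) and (ii), for every side system
        (∀ (E : Type*) [NormedAddCommGroup E] [InnerProductSpace ℂ E] [CompleteSpace E]
          (ρ : QDF.OpE n d E), QDF.IsDensityE ρ →
            (∀ m : QDF.YoungDiag n d,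
              QDF.ampliate S (QDF.extendE E (QDF.isoProj m) * ρ * QDF.extendE E (QDF.isoProj m)) =
                QDF.extendE E (QDF.isoProj m) * QDF.ampliate S ρ *
                  QDF.extendE E (QDF.isoProj m)) ∧
            (QDF.IsPermInvariant ρ → QDF.ampliate (R ∘ₗ S) ρ = ρ)) ∧
        -- (iii)
        (∀ ρ : QDF.Op n d, QDF.IsDensity ρ → QDF.IsPermInvariant ρ → ∀ m : QDF.YoungDiag n d,
          ∃ Q : QDF.Op n d,
            QDF.IsSupportProjection (S (QDF.isoProj m * ρ * QDF.isoProj m)) Q ∧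
            Q ≤ QDF.fqDiag m • S (QDF.haarIID n (QDF.empirical m)))) ∧
      -- the bound on permutation-invariant states by mixtures of i.i.d. states
      (∀ ρ : QDF.Op n d, QDF.IsDensity ρ → QDF.IsPermInvariant ρ →
        (∀ m : QDF.YoungDiag n d, 0 ≤ QDF.isoWeight m ρ) ∧
        ∑ m : QDF.YoungDiag n d, QDF.isoWeight m ρ = 1 ∧
        ρ ≤ ∑ m : QDF.YoungDiag n d,
          (QDF.fqDiag m * QDF.isoWeight m ρ) • QDF.haarIID n (QDF.empirical m) ∧
        ρ ≤ QDF.fq n d • ∑ m : QDF.YoungDiag n d,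
          QDF.isoWeight m ρ • QDF.haarIID n (QDF.empirical m)) ∧
      -- the two prefactors
      (∀ m : QDF.YoungDiag n d, QDF.fqDiag m ≤ QDF.fq n d)) ∧
    (fun n : ℕ => QDF.fq n d) =O[Filter.atTop]
      (fun n : ℕ => (n : ℝ) ^ (((d : ℝ) ^ 2 - 1) / 2)) := by
  refine ⟨fun n hn => ⟨⟨QDF.krausMap (QDF.schurKraus n d), QDF.krausMap (QDF.twirlKraus n d),
    QDF.isCPTP_schur, QDF.isCPTP_twirl, ?_, fun ρ hρ hinv m => QDF.exists_support_le hn hρ hinv⟩,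
    fun ρ hρ hinv => ⟨fun m => QDF.isoWeight_nonneg hρ.1 hinv, QDF.sum_isoWeight hρ,
      QDF.le_sum_fqDiag hn hρ hinv, QDF.le_fq_smul_sum hd hn hρ hinv⟩,
    fun m => QDF.fqDiag_le_fq hd hn⟩, QDF.fq_isBigO hd⟩
  intro E _ _ _ ρ _
  refine ⟨fun m => QDF.ampliate_krausMap_conj QDF.schurKraus_comm_isoProj
    QDF.schurKraus_conjTranspose_comm_isoProj ρ, fun hinv => ?_⟩
  rw [QDF.krausMap_comp]
  refine QDF.ampliate_krausMap_of_unital (fun k => ?_) QDF.twirl_schur_one hinv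
  obtain ⟨x, hx⟩ := QDF.twirlKraus_eq_toOp (d := d) k.1
  obtain ⟨y, hy⟩ := QDF.schurKraus_eq_toOp k.2
  exact ⟨x * y, by rw [hx, hy, map_mul]⟩
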